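/- Let $d,n\ge 1$ be integers, $\alpha>-1$, $\kappa\in(0,1]$, $T\in(-\infty,\infty]$, and write $\mathbb R^d_+=\{x\in\mathbb R^d: x_d>0\}$, $\mathbb R_T=(-\infty,T)$, $\Omega_T=\mathbb R_T\times\mathbb R^d_+$, and $d\mu=x_d^\alpha\,dx$ on $\mathbb R^d_+$, $d\mu=x_d^\alpha\,dx\,dt$ on $\Omega_T$. The norm $|\cdot|$ of a vector or matrix is the square root of the sum of the squares of its entries; repeated indices $i,j$ are summed from $1$ to $d$; $Du=(D_1u,\dots,D_du)$ is the weak spatial gradient in $\Omega_T$. Let $A^{ij}=A^{ij}(t,x)$ $(1\le i,j\le d)$, $C_0=C_0(t,x)$ and $a_0=a_0(x)$ be measurable $\mathbb R^{n\times n}$-valued functions on $\Omega_T$, $\Omega_T$ and $\mathbb R^d_+$, respectively, such that for all $\xi,\xi_1,\dots,\xi_d\in\mathbb R^n$ $$\kappa\sum_{i=1}^d|\xi_i|^2\le\sum_{i,j=1}^dA^{ij}\xi_j\cdot\xi_i,\qquad |A^{ij}|\le\kappa^{-1},$$ $$\kappa|\xi|^2\le a_0\xi\cdot\xi,\quad |a_0|\le\kappa^{-1},\quad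 a_0=a_0^{T},\qquad \kappa|\xi|^2\le C_0\xi\cdot\xi,\quad |C_0|\le\kappa^{-1};$$ no regularity of the coefficients is assumed. Let $\mathcal H^1_2(\Omega_T,\mu)$ be the set of $u:\Omega_T\to\mathbb R^n$ with $u,Du\in L_2(\Omega_T,\mu)$ for which there are $G^1,\dots,G^d,g\in L_2(\Omega_T,\mu)$ such that $-\int_{\Omega_T}a_0u\cdot\varphi_t\,d\mu=\int_{\Omega_T}(G^i\cdot D_i\varphi+g\cdot\varphi)\,d\mu$ for all $\varphi\in C_0^\infty((-\infty,T)\times\mathbb R^d)^n$. For $\lambda\ge0$, $F=(F^1,\dots,F^d)\in L_2(\Omega_T,\mu)^d$ and $f\in L_2(\Omega_T,\mu)$ (all $\mathbb R^n$-valued), $u\in\mathcal H^1_2(\Omega_T,\mu)$ is called a weak solution of $$x_d^\alpha a_0u_t-D_i(x_d^\alpha A^{ij}D_ju)+\lambda x_d^\alpha C_0u=-D_i(x_d^\alpha F^i)+\sqrt\lambda\,x_d^\alpha f\ \text{ in }\Omega_T,\qquad \lim_{x_d\to0^+}x_d^\alpha(A^{dj}D_ju-F^d)=0\ \text{ on }\mathbb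 R_T\times\mathbb R^{d-1}$$ if $$\int_{\Omega_T}\bigl(-a_0u\cdot\varphi_t+A^{ij}D_ju\cdot D_i\varphi+\lambda C_0u\cdot\varphi\bigr)\,d\mu=\int_{\Omega_T}\bigl(F^i\cdot D_i\varphi+\sqrt\lambda\,f\cdot\varphi\bigr)\,d\mu$$ for all $\varphi\in C_0^\infty((-\infty,T)\times\mathbb R^d)^n$. Then there is a constant $N=N(d,n,\alpha,\kappa)>0$ such that, for all $T$, $\lambda$, coefficients, $F$ and $f$ as above: 1. If $\lambda\ge0$ and $u\in\mathcal H^1_2(\Omega_T,\mu)$ is a weak solution, then (after modification on a null set) $u\in C_b(\overline{\mathbb R_T};L_2(\mathbb R^d_+,\mu))$, the space of bounded continuous $L_2(\mathbb R^d_+,\mu)$-valued functions on the closure of $\mathbb R_T$ in $\mathbb R$, and $$\sup_{t<T}\int_{\mathbb R^d_+}|u(t,\cdot)|^2\,d\mu+\int_{\Omega_T}|Du|^2\,d\mu+\lambda\int_{\Omega_T}|u|^2\,d\mu\le N\int_{\Omega_T}|F|^2\,d\mu+N\int_{\Omega_T}|f|^2\,d\mu.$$ 2. If $\lambda>0$,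 then there is a weak solution $u\in\mathcal H^1_2(\Omega_T,\mu)$, and it is unique (up to equality almost everywhere). -/

import Mathlib

open MeasureTheory Set Filter Topology
open scoped ContDiff Matrix BoundedContinuousFunction

noncomputable section

namespace WeightedParabolic

/-- The space `ℝ^d` with its Euclidean norm; the dimension is `d = m + 1 ≥ 1`, and the
distinguished coordinate `x_d` is the one with index `Fin.last m`. -/
abbrev Sp (m : ℕ) := EuclideanSpace ℝ (Fin (m + 1))

/-- The space `ℝ^n` of values, with its Euclidean norm. -/
abbrev Val (n : ℕ) := EuclideanSpace ℝ (Fin n)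

/-- `ℝ_T = (-∞, T)`, for `T ∈ (-∞, ∞]`. -/
def timeRay (T : EReal) : Set ℝ := {t | (t : EReal) < T}

/-- The upper half-space `ℝ^d_+ = {x : x_d > 0}`. -/
def halfSpace (m : ℕ) : Set (Sp m) := {x | 0 < x (Fin.last m)}

/-- `Ω_T = (-∞, T) × ℝ^d_+`. -/
def cyl (m : ℕ) (T : EReal) : Set (ℝ × Sp m) := timeRay T ×ˢ halfSpace m

/-- `dμ = x_d^α dx` on `ℝ^d_+`. -/
def muSpace (m : ℕ) (α : ℝ) : Measure (Sp m) :=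
  (volume.restrict (halfSpace m)).withDensity
    fun x => ENNReal.ofReal (x (Fin.last m) ^ α)

/-- `dμ = x_d^α dx dt` on `Ω_T`. -/
def muCyl (m : ℕ) (α : ℝ) (T : EReal) : Measure (ℝ × Sp m) :=
  (volume.restrict (cyl m T)).withDensity
    fun z => ENNReal.ofReal (z.2 (Fin.last m) ^ α)

/-- Time derivative of a (smooth) function of `(t, x)`. -/
def dt {m : ℕ} {V : Type*} [NormedAddCommGroup V] [NormedSpace ℝ V]
    (φ : ℝ × Sp m → V) (z : ℝ × Sp m) : V :=
  fderiv ℝ φ z (1, 0)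

/-- Spatial partial derivative `∂/∂x_i` of a (smooth) function of `(t, x)`. -/
def dx {m : ℕ} {V : Type*} [NormedAddCommGroup V] [NormedSpace ℝ V]
    (i : Fin (m + 1)) (φ : ℝ × Sp m → V) (z : ℝ × Sp m) : V :=
  fderiv ℝ φ z (0, EuclideanSpace.single i 1)

/-- `φ ∈ C_0^∞(O)`: smooth on the whole space, with compact support contained in `O`. -/
def IsTest {m : ℕ} {V : Type*} [NormedAddCommGroup V] [NormedSpace ℝ V]
    (O : Set (ℝ × Sp m)) (φ : ℝ × Sp m → V) : Prop :=
  ContDiff ℝ ∞ φ ∧ HasCompactSupport φ ∧ tsupport φ ⊆ O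

/-- `M v · w` in `ℝ^n`. -/
def mdot {n : ℕ} (M : Matrix (Fin n) (Fin n) ℝ) (v w : Val n) : ℝ :=
  (M *ᵥ v.ofLp) ⬝ᵥ w.ofLp

/-- `|M|`, the square root of the sum of the squares of the entries. -/
def matAbs {n : ℕ} (M : Matrix (Fin n) (Fin n) ℝ) : ℝ :=
  √(∑ k, ∑ l, M k l ^ 2)

/-- The leading coefficients `A^{ij}` are (Lebesgue) measurable on `Ω_T`, bounded, and strongly
elliptic with constant `κ`. -/
structure EllipticCoeff {m n : ℕ} (κ : ℝ) (T : EReal)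
    (A : Fin (m + 1) → Fin (m + 1) → ℝ × Sp m → Matrix (Fin n) (Fin n) ℝ) : Prop where
  meas : ∀ i j k l, AEMeasurable (fun z => A i j z k l) (volume.restrict (cyl m T))
  elliptic : ∀ᵐ z ∂(volume.restrict (cyl m T)), ∀ ξ : Fin (m + 1) → Val n,
    κ * ∑ i, ‖ξ i‖ ^ 2 ≤ ∑ i, ∑ j, mdot (A i j z) (ξ j) (ξ i)
  bounded : ∀ᵐ z ∂(volume.restrict (cyl m T)), ∀ i j, matAbs (A i j z) ≤ κ⁻¹

/-- A matrix-valued function is (Lebesgue) measurable, bounded and positive definite with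
constant `κ` on the set `O`. No symmetry is included. -/
structure NondegCoeff {X : Type*} [MeasureSpace X] {n : ℕ} (κ : ℝ) (O : Set X)
    (M : X → Matrix (Fin n) (Fin n) ℝ) : Prop where
  meas : ∀ k l, AEMeasurable (fun x => M x k l) (volume.restrict O)
  posdef : ∀ᵐ x ∂(volume.restrict O), ∀ ξ : Val n, κ * ‖ξ‖ ^ 2 ≤ mdot (M x) ξ ξ
  bounded : ∀ᵐ x ∂(volume.restrict O), matAbs (M x) ≤ κ⁻¹

/-- `Du = (D_1 u, …, D_d u)` is the weak spatial gradient of `u` in the open set `Ω_T`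
(with respect to Lebesgue measure, tested with scalar functions in `C_0^∞(Ω_T)`). -/
def HasWeakGrad {m n : ℕ} (T : EReal) (u : ℝ × Sp m → Val n)
    (Du : Fin (m + 1) → ℝ × Sp m → Val n) : Prop :=
  ∀ (i : Fin (m + 1)) (ψ : ℝ × Sp m → ℝ), IsTest (cyl m T) ψ →
    ∫ z in cyl m T, dx i ψ z • u z = - ∫ z in cyl m T, ψ z • Du i z

/-- The distribution `x_d^α a_0 u_t` on `(-∞, T) × ℝ^d`, given by
`φ ↦ - ∫_{Ω_T} a_0 u · φ_t dμ`, belongs to `ℍ^{-1}_2(Ω_T, μ)`: it is represented by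
some `G^i, g ∈ L_2(Ω_T, μ)`. -/
def TimeDerivMemHMinusOne {m n : ℕ} (α : ℝ) (T : EReal)
    (a₀ : Sp m → Matrix (Fin n) (Fin n) ℝ) (u : ℝ × Sp m → Val n) : Prop :=
  ∃ (G : Fin (m + 1) → ℝ × Sp m → Val n) (g : ℝ × Sp m → Val n),
    (∀ i, MemLp (G i) 2 (muCyl m α T)) ∧ MemLp g 2 (muCyl m α T) ∧
    ∀ φ : ℝ × Sp m → Val n, IsTest (timeRay T ×ˢ univ) φ →
      - ∫ z, mdot (a₀ z.2) (u z) (dt φ z) ∂(muCyl m α T) =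
        ∫ z, ((∑ i, inner ℝ (G i z) (dx i φ z)) + inner ℝ (g z) (φ z)) ∂(muCyl m α T)

/-- `u ∈ 𝓗^1_2(Ω_T, μ)`, with weak spatial gradient `Du`. -/
structure MemH1 {m n : ℕ} (α : ℝ) (T : EReal) (a₀ : Sp m → Matrix (Fin n) (Fin n) ℝ)
    (u : ℝ × Sp m → Val n) (Du : Fin (m + 1) → ℝ × Sp m → Val n) : Prop where
  memLp : MemLp u 2 (muCyl m α T)
  grad_memLp : ∀ i, MemLp (Du i) 2 (muCyl m α T)
  weakGrad : HasWeakGrad T u Du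
  timeDeriv : TimeDerivMemHMinusOne α T a₀ u

/-- `u`, with weak spatial gradient `Du`, satisfies the variational identity that defines weak
solutions of
`x_d^α a_0 u_t - D_i (x_d^α A^{ij} D_j u) + λ x_d^α C_0 u = - D_i (x_d^α F^i) + √λ x_d^α f`
in `Ω_T` with the conormal condition `lim_{x_d → 0+} x_d^α (A^{dj} D_j u - F^d) = 0`.
The test functions need not vanish at `x_d = 0`. It is used only for `u, Du, F, f` in
`L_2(Ω_T, μ)`, where all the integrals converge absolutely. -/
def IsWeakSol {m n : ℕ} (α : ℝ) (T : EReal) (lam : ℝ)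
    (a₀ : Sp m → Matrix (Fin n) (Fin n) ℝ)
    (A : Fin (m + 1) → Fin (m + 1) → ℝ × Sp m → Matrix (Fin n) (Fin n) ℝ)
    (C₀ : ℝ × Sp m → Matrix (Fin n) (Fin n) ℝ)
    (F : Fin (m + 1) → ℝ × Sp m → Val n) (f : ℝ × Sp m → Val n)
    (u : ℝ × Sp m → Val n) (Du : Fin (m + 1) → ℝ × Sp m → Val n) : Prop :=
  ∀ φ : ℝ × Sp m → Val n, IsTest (timeRay T ×ˢ univ) φ →
    ∫ z, (- mdot (a₀ z.2) (u z) (dt φ z)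
        + (∑ i, ∑ j, mdot (A i j z) (Du j z) (dx i φ z))
        + lam * mdot (C₀ z) (u z) (φ z)) ∂(muCyl m α T) =
      ∫ z, ((∑ i, inner ℝ (F i z) (dx i φ z)) + √lam * inner ℝ (f z) (φ z)) ∂(muCyl m α T)

/-- The bounded continuous function `U` on the closure of `(-∞, T)`, with values in
`L_2(ℝ^d_+, μ)`, is a version of `u`: `U(t) = u(t, ·)` for almost every `t < T`. -/
def IsVersion {m n : ℕ} (α : ℝ) (T : EReal) (u : ℝ × Sp m → Val n)
    (U : closure (timeRay T) →ᵇ Lp (Val n) 2 (muSpace m α)) : Prop :=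
  ∀ᵐ t : ℝ, ∀ ht : t ∈ timeRay T,
    U ⟨t, subset_closure ht⟩ =ᵐ[muSpace m α] fun x => u (t, x)

end WeightedParabolic

end

/-!
Everything is derived from one energy inequality. Extend `u` by zero after a time `τ`. As `a₀` does
not depend on time, the energy `∫ a₀ w · w dμ` of the increment `w = u - u(· + s)` is an affine
function of the correlation `∫ a₀ u · u(· + s) dμ`. By the equation, this correlation has a right
derivative at `s = 0`; no derivative of `u` in time enters. On the other hand the increment equals
`u` on the slab `(τ - s, τ)`, so dividing by `s` and letting `s → 0` bounds the energy of `u` at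
time `τ` by the `L_2` pairing of the equation with `u`.

To use `u` as a test function one approximates `(u, Du)` in `L_2(μ)` by smooth jets `(φ, Dφ)`.
The weight `x_d^α` need not be a Muckenhoupt weight, but a mollification that looks only into the
past and away from the boundary is bounded on `L_2(μ)`, since averages of the translated weight
against its kernel are at most a multiple of the weight, and it commutes with the weak gradient.

Applied to the increments `u - u(· - h)`, the energy inequality gives a modulus of continuity in
time, hence the continuous version. Uniqueness is the case of vanishing data, and existence is
J.-L. Lions' lemma for the adjoint operator on test functions.
-/

open scoped ENNReal NNReal

noncomputable section

namespace WeightedParabolic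

/-! ### The weighted measures -/

section Measures

variable {m : ℕ} {α : ℝ} {S T : EReal}

lemma isLowerSet_timeRay (T : EReal) : IsLowerSet (timeRay T) := fun _ _ hst ht =>
  (EReal.coe_le_coe_iff.2 hst).trans_lt ht

lemma isOpen_timeRay (T : EReal) : IsOpen (timeRay T) :=
  isOpen_lt continuous_coe_real_ereal continuous_const

lemma timeRay_mono (h : S ≤ T) : timeRay S ⊆ timeRay T :=
  fun _ ht => lt_of_lt_of_le ht h

@[simp] lemma timeRay_top : timeRay ⊤ = univ := by
  ext t; simp [timeRay]

@[simp] lemma timeRay_coe (τ : ℝ) : timeRay (τ : EReal) = Iio τ := by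
  ext t; simp [timeRay]

lemma nonempty_timeRay (hT : ⊥ < T) : (timeRay T).Nonempty := by
  obtain ⟨τ, -, hτ⟩ := EReal.lt_iff_exists_real_btwn.1 hT
  exact ⟨τ, hτ⟩

lemma isOpen_halfSpace (m : ℕ) : IsOpen (halfSpace m) :=
  isOpen_lt continuous_const (by fun_prop)

lemma isOpen_cyl (m : ℕ) (T : EReal) : IsOpen (cyl m T) :=
  (isOpen_timeRay T).prod (isOpen_halfSpace m)

lemma cyl_mono (h : S ≤ T) : cyl m S ⊆ cyl m T :=
  prod_mono (timeRay_mono h) subset_rfl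

lemma measurableSet_timeRay_prod_univ (m : ℕ) (T : EReal) :
    MeasurableSet (timeRay T ×ˢ (univ : Set (Sp m))) :=
  ((isOpen_timeRay T).prod isOpen_univ).measurableSet

lemma measurable_ofReal_last_rpow (m : ℕ) (α : ℝ) :
    Measurable fun x : Sp m => ENNReal.ofReal (x (Fin.last m) ^ α) := by
  have : Measurable fun x : Sp m => x (Fin.last m) := by fun_prop
  fun_prop

instance instSFiniteMuSpace (m : ℕ) (α : ℝ) : SFinite (muSpace m α) := by
  unfold muSpace; infer_instance

lemma muCyl_eq_prod (m : ℕ) (α : ℝ) (T : EReal) :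
    muCyl m α T = (volume.restrict (timeRay T)).prod (muSpace m α) := by
  unfold muSpace muCyl cyl
  rw [prod_withDensity_right (measurable_ofReal_last_rpow m α), Measure.prod_restrict]
  rfl

lemma muCyl_top (m : ℕ) (α : ℝ) : muCyl m α ⊤ = volume.prod (muSpace m α) := by
  rw [muCyl_eq_prod, timeRay_top, Measure.restrict_univ]

lemma muCyl_restrict_of_le (h : S ≤ T) :
    (muCyl m α T).restrict (timeRay S ×ˢ univ) = muCyl m α S := by
  rw [muCyl_eq_prod, muCyl_eq_prod, ← Measure.prod_restrict,
    Measure.restrict_restrict_of_subset (timeRay_mono h), Measure.restrict_univ]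

lemma muCyl_eq_restrict (m : ℕ) (α : ℝ) (T : EReal) :
    muCyl m α T = (muCyl m α ⊤).restrict (timeRay T ×ˢ univ) :=
  (muCyl_restrict_of_le le_top).symm

lemma muCyl_mono (h : S ≤ T) : muCyl m α S ≤ muCyl m α T := by
  rw [← muCyl_restrict_of_le h]
  exact Measure.restrict_le_self

lemma muCyl_absolutelyContinuous (m : ℕ) (α : ℝ) (T : EReal) :
    muCyl m α T ≪ volume.restrict (cyl m T) :=
  withDensity_absolutelyContinuous _ _

lemma muSpace_absolutelyContinuous (m : ℕ) (α : ℝ) :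
    muSpace m α ≪ volume.restrict (halfSpace m) :=
  withDensity_absolutelyContinuous _ _

lemma volume_absolutelyContinuous_muCyl (m : ℕ) (α : ℝ) (T : EReal) :
    volume.restrict (cyl m T) ≪ muCyl m α T := by
  refine withDensity_absolutelyContinuous'
    ((measurable_ofReal_last_rpow m α).comp measurable_snd).aemeasurable ?_
  filter_upwards [ae_restrict_mem (isOpen_cyl m T).measurableSet] with z hz
  have : 0 < z.2 (Fin.last m) := hz.2
  simpa using Real.rpow_pos_of_pos this α

lemma ae_mem_cyl (m : ℕ) (α : ℝ) (T : EReal) : ∀ᵐ z ∂(muCyl m α T), z ∈ cyl m T :=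
  (muCyl_absolutelyContinuous m α T).ae_le (ae_restrict_mem (isOpen_cyl m T).measurableSet)

lemma quasiMeasurePreserving_snd (m : ℕ) (α : ℝ) (T : EReal) :
    Measure.QuasiMeasurePreserving (Prod.snd : ℝ × Sp m → Sp m) (muCyl m α T) (muSpace m α) := by
  rw [muCyl_eq_prod]
  exact Measure.quasiMeasurePreserving_snd

lemma integrableOn_Ioc_zero_rpow (hα : -1 < α) (R : ℝ) :
    IntegrableOn (fun s : ℝ => s ^ α) (Ioc 0 R) := by
  rcases le_or_gt 0 R with hR | hR
  · exact (intervalIntegrable_iff_integrableOn_Ioc_of_le hR).1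
      (intervalIntegral.intervalIntegrable_rpow' hα)
  · simp [Ioc_eq_empty (not_lt.2 hR.le)]

lemma measurableSet_box (m : ℕ) (R : ℝ) : MeasurableSet {x : Sp m | ∀ i, |x i| ≤ R} := by
  simp only [ofPred_forall]
  exact MeasurableSet.iInter fun i => (isClosed_le (f := fun x : Sp m => |x i|)
    (by fun_prop) continuous_const).measurableSet

lemma integrableOn_last_rpow_box (hα : -1 < α) (R : ℝ) :
    IntegrableOn (fun x : Sp m => x (Fin.last m) ^ α) ({x | ∀ i, |x i| ≤ R} ∩ halfSpace m) := by
  let g : Fin (m + 1) → ℝ → ℝ := fun i =>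
    if i = Fin.last m then (Ioc 0 R).indicator (fun s => s ^ α)
    else (Icc (-R) R).indicator (fun _ => 1)
  have hg : ∀ i, Integrable (g i) volume := by
    intro i
    by_cases hi : i = Fin.last m
    · simpa only [g, hi, if_true] using
        (integrable_indicator_iff measurableSet_Ioc).2 (integrableOn_Ioc_zero_rpow hα R)
    · simpa only [g, hi, if_false] using
        (integrable_indicator_iff measurableSet_Icc).2 (integrableOn_const (by simp))
  have hG : Integrable fun x : Sp m => ∏ i, g i (x i) :=
    (EuclideanSpace.volume_preserving_symm_measurableEquiv_toLp
      (Fin (m + 1))).integrable_comp_of_integrable (Integrable.fintype_prod hg)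
  refine hG.integrableOn.congr_fun (fun x hx => ?_)
    ((measurableSet_box m R).inter (isOpen_halfSpace m).measurableSet)
  obtain ⟨hxR, hx0⟩ := hx
  beta_reduce
  rw [Finset.prod_eq_single (Fin.last m) (fun i _ hi => ?_) (by simp)]
  · simpa only [g, if_true] using
      indicator_of_mem (s := Ioc 0 R) ⟨hx0, (le_abs_self _).trans (hxR _)⟩ _
  · simpa only [g, hi, if_false] using
      indicator_of_mem (s := Icc (-R) R) (abs_le.1 (hxR i)) _

lemma muSpace_box_lt_top (hα : -1 < α) (R : ℝ) : muSpace m α {x | ∀ i, |x i| ≤ R} < ⊤ := by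
  rw [muSpace, withDensity_apply _ (measurableSet_box m R),
    Measure.restrict_restrict (measurableSet_box m R)]
  exact (integrableOn_last_rpow_box hα R).lintegral_lt_top

lemma isLocallyFiniteMeasure_muSpace (hα : -1 < α) : IsLocallyFiniteMeasure (muSpace m α) := by
  refine ⟨fun x => ⟨Metric.ball x 1, Metric.ball_mem_nhds x one_pos, ?_⟩⟩
  refine lt_of_le_of_lt (measure_mono ?_) (muSpace_box_lt_top hα (‖x‖ + 1))
  intro y hy i
  calc |y i| ≤ ‖y‖ := by simpa using PiLp.norm_apply_le y i
    _ ≤ ‖x‖ + ‖y - x‖ := norm_le_norm_add_norm_sub' y x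
    _ ≤ ‖x‖ + 1 := by gcongr; exact (mem_ball_iff_norm.1 hy).le

lemma isLocallyFiniteMeasure_muCyl (hα : -1 < α) (T : EReal) :
    IsLocallyFiniteMeasure (muCyl m α T) := by
  have := isLocallyFiniteMeasure_muSpace (m := m) hα
  rw [muCyl_eq_prod]
  infer_instance

instance instIsLocallyFiniteMeasureMuCyl [IsLocallyFiniteMeasure (muCyl m α ⊤)] :
    IsLocallyFiniteMeasure (muCyl m α T) := by
  rw [muCyl_eq_restrict]
  infer_instance

end Measures

section TimeShift

variable {m : ℕ} {T : EReal}

/-- Translation of space-time by `s` in the time variable. -/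
def timeShift (m : ℕ) (s : ℝ) (z : ℝ × Sp m) : ℝ × Sp m := (z.1 + s, z.2)

lemma timeShift_eq_add (s : ℝ) (z : ℝ × Sp m) : timeShift m s z = z + (s, 0) := by
  simp [timeShift, Prod.add_def]

lemma timeShift_eq_addRight (s : ℝ) : timeShift m s = Homeomorph.addRight (s, (0 : Sp m)) :=
  funext (timeShift_eq_add s)

@[simp] lemma timeShift_zero (z : ℝ × Sp m) : timeShift m 0 z = z := by
  simp [timeShift]

@[simp] lemma timeShift_timeShift_neg (s : ℝ) (z : ℝ × Sp m) :
    timeShift m (-s) (timeShift m s z) = z := by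
  simp [timeShift]

lemma contDiff_timeShift (s : ℝ) : ContDiff ℝ ∞ (timeShift m s) := by
  unfold timeShift; fun_prop

lemma measurePreserving_timeShift (α s : ℝ) :
    MeasurePreserving (timeShift m s) (muCyl m α ⊤) (muCyl m α ⊤) := by
  rw [muCyl_top]
  exact (measurePreserving_add_right volume s).prod (MeasurePreserving.id _)

lemma measurableEmbedding_timeShift (s : ℝ) : MeasurableEmbedding (timeShift m s) := by
  rw [timeShift_eq_addRight]
  exact (Homeomorph.addRight _).measurableEmbedding

lemma timeShift_neg_fst_mem {z : ℝ × Sp m} {s : ℝ} (hs : 0 ≤ s) (hz : z.1 ∈ timeRay T) :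
    (timeShift m (-s) z).1 ∈ timeRay T :=
  lt_of_le_of_lt (EReal.coe_le_coe_iff.2 (by simpa [timeShift] using hs)) hz

end TimeShift

/-! ### Jets and test functions -/

/-- Values of `(u, D_1 u, …, D_d u)`, with the Euclidean norm; the index `none` stands for `u`. -/
abbrev Jet (m n : ℕ) := PiLp 2 fun _ : Option (Fin (m + 1)) => Val n

/-- The jet field `(u, Du)`; it turns the variational identity into one `L_2` pairing. -/
def mkJet {m n : ℕ} (u : ℝ × Sp m → Val n) (Du : Fin (m + 1) → ℝ × Sp m → Val n)
    (z : ℝ × Sp m) : Jet m n :=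
  WithLp.toLp 2 fun o => o.elim (u z) fun i => Du i z

/-- The jet field `(φ, Dφ)` of a smooth function `φ`. -/
def jet {m n : ℕ} (φ : ℝ × Sp m → Val n) : ℝ × Sp m → Jet m n :=
  mkJet φ fun i => dx i φ

section Jets

variable {m n : ℕ} {μ : Measure (ℝ × Sp m)} {p : ℝ≥0∞}
  {u φ ψ : ℝ × Sp m → Val n} {Du : Fin (m + 1) → ℝ × Sp m → Val n}

@[simp] lemma mkJet_none (u : ℝ × Sp m → Val n) (Du : Fin (m + 1) → ℝ × Sp m → Val n)
    (z : ℝ × Sp m) : mkJet u Du z none = u z := rfl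

@[simp] lemma mkJet_some (u : ℝ × Sp m → Val n) (Du : Fin (m + 1) → ℝ × Sp m → Val n)
    (z : ℝ × Sp m) (i : Fin (m + 1)) : mkJet u Du z (some i) = Du i z := rfl

@[simp] lemma jet_none (φ : ℝ × Sp m → Val n) (z : ℝ × Sp m) : jet φ z none = φ z := rfl

@[simp] lemma jet_some (φ : ℝ × Sp m → Val n) (z : ℝ × Sp m) (i : Fin (m + 1)) :
    jet φ z (some i) = dx i φ z := rfl

lemma inner_jet (v w : Jet m n) :
    inner ℝ v w = (∑ i : Fin (m + 1), inner ℝ (v (some i)) (w (some i)))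
      + inner ℝ (v none) (w none) := by
  rw [PiLp.inner_apply, Fintype.sum_option, add_comm]

lemma norm_sq_jet (v : Jet m n) :
    ‖v‖ ^ 2 = (∑ i : Fin (m + 1), ‖v (some i)‖ ^ 2) + ‖v none‖ ^ 2 := by
  rw [PiLp.norm_sq_eq_of_L2, Fintype.sum_option, add_comm]

lemma memLp_mkJet (hu : MemLp u p μ) (hDu : ∀ i, MemLp (Du i) p μ) : MemLp (mkJet u Du) p μ := by
  refine MemLp.of_eval_piLp fun o => ?_
  cases o with
  | none => exact hu
  | some i => exact hDu i

lemma jet_add (hφ : Differentiable ℝ φ) (hψ : Differentiable ℝ ψ) :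
    jet (φ + ψ) = jet φ + jet ψ := by
  ext z o
  cases o with
  | none => rfl
  | some i => simp [dx, fderiv_add (hφ z) (hψ z)]

lemma jet_const_smul (hφ : Differentiable ℝ φ) (c : ℝ) : jet (c • φ) = c • jet φ := by
  ext z o
  cases o with
  | none => rfl
  | some i => simp [dx, fderiv_const_smul (hφ z)]

end Jets

section Tests

variable {m : ℕ} {V : Type*} [NormedAddCommGroup V] [NormedSpace ℝ V] {T : EReal}
  {O O' : Set (ℝ × Sp m)} {φ ψ : ℝ × Sp m → V} {z : ℝ × Sp m}

lemma IsTest.mono (h : IsTest O φ) (hO : O ⊆ O') : IsTest O' φ :=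
  ⟨h.1, h.2.1, h.2.2.trans hO⟩

lemma IsTest.add (hφ : IsTest O φ) (hψ : IsTest O ψ) : IsTest O (φ + ψ) :=
  ⟨hφ.1.add hψ.1, hφ.2.1.add hψ.2.1,
    (tsupport_add φ ψ).trans (union_subset hφ.2.2 hψ.2.2)⟩

lemma IsTest.const_smul (c : ℝ) (hφ : IsTest O φ) : IsTest O (c • φ) :=
  ⟨hφ.1.const_smul c, hφ.2.1.smul_left (f := fun _ => c),
    (tsupport_smul_subset_right (fun _ => c) φ).trans hφ.2.2⟩

lemma isTest_zero : IsTest O (0 : ℝ × Sp m → V) :=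
  ⟨contDiff_const, HasCompactSupport.zero, by simp [tsupport]⟩

lemma IsTest.differentiable (hφ : IsTest O φ) : Differentiable ℝ φ :=
  hφ.1.differentiable (by simp)

lemma IsTest.continuous_fderiv_apply (hφ : IsTest O φ) (v : ℝ × Sp m) :
    Continuous fun z => fderiv ℝ φ z v :=
  (hφ.1.continuous_fderiv (by simp)).clm_apply continuous_const

lemma IsTest.eq_zero_of_notMem (hφ : IsTest O φ) (hz : z ∉ O) : φ z = 0 :=
  image_eq_zero_of_notMem_tsupport fun h => hz (hφ.2.2 h)

lemma fderiv_apply_eq_zero_of_notMem_tsupport (hz : z ∉ tsupport φ) (v : ℝ × Sp m) :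
    fderiv ℝ φ z v = 0 :=
  image_eq_zero_of_notMem_tsupport (f := fun z => fderiv ℝ φ z v) fun h =>
    hz (tsupport_fderiv_apply_subset ℝ v h)

lemma IsTest.fderiv_apply_eq_zero (hφ : IsTest O φ) (v : ℝ × Sp m) (hz : z ∉ O) :
    fderiv ℝ φ z v = 0 :=
  fderiv_apply_eq_zero_of_notMem_tsupport (fun h => hz (hφ.2.2 h)) v

lemma IsTest.dx_eq_zero (hφ : IsTest O φ) (i : Fin (m + 1)) (hz : z ∉ O) : dx i φ z = 0 :=
  hφ.fderiv_apply_eq_zero _ hz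

lemma IsTest.dt_eq_zero (hφ : IsTest (timeRay T ×ˢ univ) φ) (hz : z.1 ∉ timeRay T) : dt φ z = 0 :=
  hφ.fderiv_apply_eq_zero _ fun h => hz h.1

lemma IsTest.jet_eq_zero {n : ℕ} {φ : ℝ × Sp m → Val n} (hφ : IsTest (timeRay T ×ˢ univ) φ)
    (hz : z.1 ∉ timeRay T) : jet φ z = 0 := by
  have hz' : z ∉ timeRay T ×ˢ univ := fun h => hz h.1
  ext1 o
  cases o with
  | none => exact hφ.eq_zero_of_notMem hz'
  | some i => exact hφ.dx_eq_zero i hz'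

lemma IsTest.smul {n : ℕ} {χ : ℝ × Sp m → ℝ} {φ : ℝ × Sp m → Val n} (hχ : IsTest O χ)
    (hφ : ContDiff ℝ ∞ φ) : IsTest O (fun z => χ z • φ z) :=
  ⟨hχ.1.smul hφ, hχ.2.1.smul_right, (tsupport_smul_subset_left χ φ).trans hχ.2.2⟩

lemma fderiv_comp_timeShift (s : ℝ) (z v : ℝ × Sp m) :
    fderiv ℝ (φ ∘ timeShift m s) z v = fderiv ℝ φ (timeShift m s z) v := by
  have : φ ∘ timeShift m s = fun z => φ (z + (s, 0)) :=
    funext fun z => congrArg φ (timeShift_eq_add s z)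
  rw [this, fderiv_comp_add_right, timeShift_eq_add]

lemma IsTest.comp_timeShift (hφ : IsTest (timeRay T ×ˢ univ) φ) {s : ℝ} (hs : 0 ≤ s) :
    IsTest (timeRay T ×ˢ univ) (φ ∘ timeShift m s) := by
  refine ⟨hφ.1.comp (contDiff_timeShift s), ?_, fun z hz => ⟨?_, mem_univ _⟩⟩
  · rw [timeShift_eq_addRight]
    exact hφ.2.1.comp_homeomorph _
  · have hmem : timeShift m s z ∈ tsupport φ :=
      tsupport_comp_subset_preimage φ (contDiff_timeShift s).continuous hz
    simpa using timeShift_neg_fst_mem hs (hφ.2.2 hmem).1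

lemma dx_comp_timeShift (i : Fin (m + 1)) (s : ℝ) (z : ℝ × Sp m) :
    dx i (φ ∘ timeShift m s) z = dx i φ (timeShift m s z) :=
  fderiv_comp_timeShift s z _

lemma dt_comp_timeShift (s : ℝ) (z : ℝ × Sp m) :
    dt (φ ∘ timeShift m s) z = dt φ (timeShift m s z) :=
  fderiv_comp_timeShift s z _

lemma jet_comp_timeShift {n : ℕ} {φ : ℝ × Sp m → Val n} (s : ℝ) :
    jet (φ ∘ timeShift m s) = jet φ ∘ timeShift m s := by
  ext z o
  cases o with
  | none => rfl
  | some i => simp [dx_comp_timeShift]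

variable (μ : Measure (ℝ × Sp m)) [IsFiniteMeasureOnCompacts μ]

lemma IsTest.memLp_fderiv_apply (hφ : IsTest O φ) (v : ℝ × Sp m) :
    MemLp (fun z => fderiv ℝ φ z v) 2 μ :=
  (hφ.continuous_fderiv_apply v).memLp_of_hasCompactSupport (hφ.2.1.fderiv_apply ℝ v)

lemma IsTest.memLp (hφ : IsTest O φ) : MemLp φ 2 μ :=
  hφ.1.continuous.memLp_of_hasCompactSupport hφ.2.1

lemma IsTest.memLp_dt (hφ : IsTest O φ) : MemLp (dt φ) 2 μ :=
  hφ.memLp_fderiv_apply μ _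

lemma IsTest.memLp_jet {n : ℕ} {φ : ℝ × Sp m → Val n} (hφ : IsTest O φ) : MemLp (jet φ) 2 μ :=
  memLp_mkJet (hφ.memLp μ) fun _ => hφ.memLp_fderiv_apply μ _

end Tests

/-! ### Fields extended by zero to all times -/

/-- The field `w` on `(-∞, T) × ℝ^d`, extended by zero to all times; it carries problems on `Ω_T`
over to `ℝ × ℝ^d_+`, where time translations act. -/
def extendZero {m : ℕ} {E : Type*} [Zero E] (T : EReal) (w : ℝ × Sp m → E) : ℝ × Sp m → E :=
  (timeRay T ×ˢ univ).indicator w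

section ExtendZero

variable {m : ℕ} {α : ℝ} {S T : EReal} {E F : Type*} {z : ℝ × Sp m}

lemma extendZero_of_mem [Zero E] {w : ℝ × Sp m → E} (h : z.1 ∈ timeRay T) :
    extendZero T w z = w z :=
  indicator_of_mem (s := timeRay T ×ˢ univ) ⟨h, mem_univ _⟩ w

lemma extendZero_of_notMem [Zero E] {w : ℝ × Sp m → E} (h : z.1 ∉ timeRay T) :
    extendZero T w z = 0 :=
  indicator_of_notMem (fun h' => h h'.1) w

lemma extendZero_comp [Zero E] [Zero F] {g : E → F} (hg : g 0 = 0) (w : ℝ × Sp m → E) :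
    extendZero T (fun z => g (w z)) = fun z => g (extendZero T w z) :=
  indicator_comp_of_zero hg

variable [NormedAddCommGroup E]

lemma memLp_extendZero {w : ℝ × Sp m → E} {p : ℝ≥0∞} (hw : MemLp w p (muCyl m α T)) :
    MemLp (extendZero T w) p (muCyl m α ⊤) := by
  rw [muCyl_eq_restrict] at hw
  exact (memLp_indicator_iff_restrict (measurableSet_timeRay_prod_univ m T)).2 hw

lemma extendZero_ae_eq (w : ℝ × Sp m → E) : extendZero T w =ᵐ[muCyl m α T] w := by
  rw [muCyl_eq_restrict]
  exact indicator_ae_eq_restrict (measurableSet_timeRay_prod_univ m T)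

lemma integral_muCyl_of_le [NormedSpace ℝ E] {f : ℝ × Sp m → E} (h : S ≤ T)
    (hf : ∀ z, z.1 ∉ timeRay S → f z = 0) :
    ∫ z, f z ∂(muCyl m α T) = ∫ z, f z ∂(muCyl m α S) := by
  rw [← muCyl_restrict_of_le h, setIntegral_eq_integral_of_forall_compl_eq_zero]
  exact fun z hz => hf z fun h => hz ⟨h, mem_univ _⟩

lemma integral_inner_extendZero [InnerProductSpace ℝ E] (f g : ℝ × Sp m → E) :
    ∫ z, inner ℝ (extendZero T f z) (g z) ∂(muCyl m α ⊤)
      = ∫ z, inner ℝ (f z) (g z) ∂(muCyl m α T) := by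
  rw [integral_muCyl_of_le (S := T) le_top fun z hz => by
    rw [extendZero_of_notMem hz, inner_zero_left]]
  refine integral_congr_ae ?_
  filter_upwards [extendZero_ae_eq (α := α) (T := T) f] with z hz
  rw [hz]

end ExtendZero

section Hilbert

variable {X : Type*} [MeasurableSpace X] {μ : Measure X} {E : Type*} [NormedAddCommGroup E]
  [InnerProductSpace ℝ E] {f g : X → E}

lemma integrable_inner_of_memLp (hf : MemLp f 2 μ) (hg : MemLp g 2 μ) :
    Integrable (fun x => inner ℝ (f x) (g x)) μ := by
  refine (L2.integrable_inner (𝕜 := ℝ) (hf.toLp f) (hg.toLp g)).congr ?_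
  filter_upwards [hf.coeFn_toLp, hg.coeFn_toLp] with x hfx hgx
  rw [hfx, hgx]

lemma inner_toLp (hf : MemLp f 2 μ) (hg : MemLp g 2 μ) :
    inner ℝ (hf.toLp f) (hg.toLp g) = ∫ x, inner ℝ (f x) (g x) ∂μ := by
  rw [L2.inner_def]
  refine integral_congr_ae ?_
  filter_upwards [hf.coeFn_toLp, hg.coeFn_toLp] with x hfx hgx
  rw [hfx, hgx]

lemma norm_sq_toLp (hf : MemLp f 2 μ) : ‖hf.toLp f‖ ^ 2 = ∫ x, ‖f x‖ ^ 2 ∂μ := by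
  rw [← real_inner_self_eq_norm_sq, inner_toLp]
  simp

end Hilbert

section TestJets

variable {m n : ℕ} {α : ℝ} {T : EReal}

/-- The space `C_0^∞((-∞, T) × ℝ^d)^n`. -/
def testSpace (m n : ℕ) (T : EReal) : Submodule ℝ (ℝ × Sp m → Val n) where
  carrier := {φ | IsTest (timeRay T ×ˢ univ) φ}
  add_mem' := IsTest.add
  zero_mem' := isTest_zero
  smul_mem' c _ h := h.const_smul c

/-- The Hilbert space `L_2(ℝ × ℝ^d_+, μ)` of jet fields. -/
abbrev JetL2 (m n : ℕ) (α : ℝ) := Lp (Jet m n) 2 (muCyl m α ⊤)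

/-- Translation in time, as an isometry of `L_2`. -/
def shiftL2 (m n : ℕ) (α : ℝ) (s : ℝ) : JetL2 m n α →ₗᵢ[ℝ] JetL2 m n α :=
  Lp.compMeasurePreservingₗᵢ ℝ (timeShift m s) (measurePreserving_timeShift α s)

lemma shiftL2_toLp {w : ℝ × Sp m → Jet m n} (hw : MemLp w 2 (muCyl m α ⊤)) (s : ℝ) :
    shiftL2 m n α s (hw.toLp w)
      = (hw.comp_measurePreserving (measurePreserving_timeShift α s)).toLp _ := rfl

@[simp] lemma shiftL2_zero (w : JetL2 m n α) : shiftL2 m n α 0 w = w := by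
  rw [← Lp.toLp_coeFn w (Lp.memLp w), shiftL2_toLp]
  exact MemLp.toLp_congr _ _ (.of_forall fun z => by simp)

variable [IsLocallyFiniteMeasure (muCyl m α ⊤)]

lemma continuous_shiftL2 : Continuous fun p : JetL2 m n α × ℝ => shiftL2 m n α p.2 p.1 := by
  refine Continuous.compMeasurePreservingLp (μ := muCyl m α ⊤) (ν := muCyl m α ⊤)
    (f := fun p : JetL2 m n α × ℝ => p.1)
    (g := fun p => ⟨timeShift m p.2, (contDiff_timeShift p.2).continuous⟩)
    continuous_fst ?_ (fun p => measurePreserving_timeShift α p.2) (by simp)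
  refine ContinuousMap.continuous_of_continuous_uncurry _ ?_
  simp only [Function.uncurry_def, ContinuousMap.coe_mk, timeShift]
  fun_prop

lemma continuous_inner_shiftL2 (v : JetL2 m n α) :
    Continuous fun p : JetL2 m n α × ℝ => inner ℝ v (shiftL2 m n α p.2 p.1) :=
  (innerSL ℝ v).continuous.comp continuous_shiftL2

lemma continuous_inner_shiftL2_apply (v w : JetL2 m n α) :
    Continuous fun s => inner ℝ v (shiftL2 m n α s w) := by
  exact Continuous.comp (g := fun p : JetL2 m n α × ℝ => inner ℝ v (shiftL2 m n α p.2 p.1))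
    (f := fun s : ℝ => (w, s)) (continuous_inner_shiftL2 v) (by fun_prop)

/-- The map `φ ↦ (φ, Dφ)` from test functions to `L_2`. -/
def testJet (m n : ℕ) (α : ℝ) (T : EReal) [IsLocallyFiniteMeasure (muCyl m α ⊤)] :
    testSpace m n T →ₗ[ℝ] JetL2 m n α where
  toFun φ := (IsTest.memLp_jet (muCyl m α ⊤) φ.2).toLp _
  map_add' φ ψ := by
    rw [← MemLp.toLp_add]
    exact MemLp.toLp_congr _ _ (by
      rw [Submodule.coe_add, jet_add (IsTest.differentiable φ.2) (IsTest.differentiable ψ.2)])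
  map_smul' c φ := by
    rw [RingHom.id_apply, ← MemLp.toLp_const_smul]
    exact MemLp.toLp_congr _ _ (by
      rw [Submodule.coe_smul, jet_const_smul (IsTest.differentiable φ.2)])

lemma testJet_apply (φ : testSpace m n T) :
    testJet m n α T φ = (IsTest.memLp_jet (muCyl m α ⊤) φ.2).toLp _ := rfl

end TestJets

/-! ### Differentiating along time translations -/

/-- The jet field `L` represents the distribution `x_d^α ∂_t b` on `(-∞, T) × ℝ^d`; the identity is
required of all test functions, which need not vanish at `x_d = 0`. -/
def HasTimeDeriv {m n : ℕ} (α : ℝ) (T : EReal) (b : ℝ × Sp m → Val n)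
    (L : ℝ × Sp m → Jet m n) : Prop :=
  ∀ φ : ℝ × Sp m → Val n, IsTest (timeRay T ×ˢ univ) φ →
    - ∫ z, inner ℝ (b z) (dt φ z) ∂(muCyl m α T) = ∫ z, inner ℝ (L z) (jet φ z) ∂(muCyl m α T)

/-- The jet field with zeroth component `b` and vanishing gradient components. -/
def liftJet {m n : ℕ} (b : ℝ × Sp m → Val n) : ℝ × Sp m → Jet m n :=
  mkJet b fun _ _ => 0

section TimeDerivative

variable {m n : ℕ} {α : ℝ} {T : EReal} {b : ℝ × Sp m → Val n} {L : ℝ × Sp m → Jet m n}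

lemma memLp_liftJet {μ : Measure (ℝ × Sp m)} {p : ℝ≥0∞} (hb : MemLp b p μ) :
    MemLp (liftJet b) p μ :=
  memLp_mkJet hb fun _ => MemLp.zero

@[simp] lemma inner_liftJet (b : ℝ × Sp m → Val n) (z : ℝ × Sp m) (w : Jet m n) :
    inner ℝ (liftJet b z) w = inner ℝ (b z) (w none) := by
  simp [inner_jet, liftJet]

lemma HasTimeDeriv.integral_top (hbL : HasTimeDeriv α T b L) {φ : ℝ × Sp m → Val n}
    (hφ : IsTest (timeRay T ×ˢ univ) φ) :
    - ∫ z, inner ℝ (b z) (dt φ z) ∂(muCyl m α ⊤)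
      = ∫ z, inner ℝ (L z) (jet φ z) ∂(muCyl m α ⊤) := by
  rw [integral_muCyl_of_le le_top fun z hz => by rw [hφ.dt_eq_zero hz, inner_zero_right],
    integral_muCyl_of_le le_top fun z hz => by rw [hφ.jet_eq_zero hz, inner_zero_right]]
  exact hbL φ hφ

lemma hasDerivAt_comp_timeShift {V : Type*} [NormedAddCommGroup V] [NormedSpace ℝ V]
    {φ : ℝ × Sp m → V} (hφ : Differentiable ℝ φ) (z : ℝ × Sp m) (s : ℝ) :
    HasDerivAt (fun s => φ (timeShift m s z)) (dt φ (timeShift m s z)) s := by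
  have hline : HasDerivAt (fun s => timeShift m s z) ((1 : ℝ), (0 : Sp m)) s :=
    ((hasDerivAt_id s).const_add z.1).prodMk (hasDerivAt_const s z.2)
  exact (hφ (timeShift m s z)).hasFDerivAt.comp_hasDerivAt s hline

variable [IsLocallyFiniteMeasure (muCyl m α ⊤)]

lemma exists_memLp_bound_dt_comp_timeShift {V : Type*} [NormedAddCommGroup V] [NormedSpace ℝ V]
    {O : Set (ℝ × Sp m)} {φ : ℝ × Sp m → V} (hφ : IsTest O φ) (s₀ : ℝ) :
    ∃ B : ℝ × Sp m → ℝ, MemLp B 2 (muCyl m α ⊤) ∧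
      ∀ z, ∀ s ∈ Metric.ball s₀ 1, ‖dt φ (timeShift m s z)‖ ≤ B z := by
  obtain ⟨C, hC⟩ := (hφ.continuous_fderiv_apply (1, 0)).bounded_above_of_compact_support
    (hφ.2.1.fderiv_apply ℝ (1, 0))
  let K : Set (ℝ × Sp m) :=
    (fun p : (ℝ × Sp m) × ℝ => timeShift m (-p.2) p.1) '' (tsupport φ ×ˢ Icc (s₀ - 1) (s₀ + 1))
  have hK : IsCompact K :=
    (hφ.2.1.isCompact.prod isCompact_Icc).image (by unfold timeShift; fun_prop)
  refine ⟨K.indicator fun _ => C,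
    memLp_indicator_const 2 hK.measurableSet C (Or.inr hK.measure_lt_top.ne), fun z s hs => ?_⟩
  by_cases hz : z ∈ K
  · rw [indicator_of_mem hz]
    exact hC _
  · have hzs : timeShift m s z ∉ tsupport φ := fun h => by
      rw [Real.ball_eq_Ioo] at hs
      exact hz ⟨(timeShift m s z, s), ⟨h, hs.1.le, hs.2.le⟩, by simp⟩
    rw [indicator_of_notMem hz, dt, fderiv_apply_eq_zero_of_notMem_tsupport hzs, norm_zero]

lemma hasDerivAt_integral_timeShift (hb : MemLp b 2 (muCyl m α ⊤)) {O : Set (ℝ × Sp m)}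
    {φ : ℝ × Sp m → Val n} (hφ : IsTest O φ) (s₀ : ℝ) :
    HasDerivAt (fun s => ∫ z, inner ℝ (b z) (φ (timeShift m s z)) ∂(muCyl m α ⊤))
      (∫ z, inner ℝ (b z) (dt φ (timeShift m s₀ z)) ∂(muCyl m α ⊤)) s₀ := by
  obtain ⟨B, hB, hφB⟩ := exists_memLp_bound_dt_comp_timeShift (α := α) hφ s₀
  have hφs : ∀ s, Integrable (fun z => inner ℝ (b z) (φ (timeShift m s z))) (muCyl m α ⊤) :=
    fun s => integrable_inner_of_memLp hb
      ((hφ.memLp _).comp_measurePreserving (measurePreserving_timeShift α s))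
  have hdtφ : Integrable (fun z => inner ℝ (b z) (dt φ (timeShift m s₀ z))) (muCyl m α ⊤) :=
    integrable_inner_of_memLp hb
      ((hφ.memLp_dt _).comp_measurePreserving (measurePreserving_timeShift α s₀))
  refine (hasDerivAt_integral_of_dominated_loc_of_deriv_le
    (F := fun s z => inner ℝ (b z) (φ (timeShift m s z)))
    (F' := fun s z => inner ℝ (b z) (dt φ (timeShift m s z)))
    (bound := fun z => ‖b z‖ * B z) (Metric.ball_mem_nhds s₀ one_pos)
    (.of_forall fun s => (hφs s).aestronglyMeasurable) (hφs s₀) hdtφ.aestronglyMeasurable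
    (.of_forall fun z s hs => ?_) (hb.norm.integrable_mul hB) (.of_forall fun z s _ => ?_)).2
  · calc ‖inner ℝ (b z) (dt φ (timeShift m s z))‖
        ≤ ‖b z‖ * ‖dt φ (timeShift m s z)‖ := norm_inner_le_norm _ _
      _ ≤ ‖b z‖ * B z := by gcongr; exact hφB z s hs
  · exact (innerSL ℝ (b z)).hasFDerivAt.comp_hasDerivAt s
      (hasDerivAt_comp_timeShift hφ.differentiable z s)

lemma inner_liftJet_shiftL2_testJet (hb : MemLp b 2 (muCyl m α ⊤)) (φ : testSpace m n T) (s : ℝ) :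
    inner ℝ ((memLp_liftJet hb).toLp _) (shiftL2 m n α s (testJet m n α T φ))
      = ∫ z, inner ℝ (b z) ((φ : ℝ × Sp m → Val n) (timeShift m s z)) ∂(muCyl m α ⊤) := by
  rw [testJet_apply, shiftL2_toLp, inner_toLp]
  simp

lemma hasDerivAt_inner_shiftL2_testJet (hb : MemLp b 2 (muCyl m α ⊤)) (hL : MemLp L 2 (muCyl m α ⊤))
    (hbL : HasTimeDeriv α T b L) (φ : testSpace m n T) {s : ℝ} (hs : 0 ≤ s) :
    HasDerivAt (fun s => inner ℝ ((memLp_liftJet hb).toLp _) (shiftL2 m n α s (testJet m n α T φ)))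
      (- inner ℝ (hL.toLp L) (shiftL2 m n α s (testJet m n α T φ))) s := by
  have hφ : IsTest (timeRay T ×ˢ univ) (φ : ℝ × Sp m → Val n) := φ.2
  have hpair := hbL.integral_top (hφ.comp_timeShift hs)
  simp only [dt_comp_timeShift, jet_comp_timeShift] at hpair
  simp only [inner_liftJet_shiftL2_testJet hb φ]
  convert hasDerivAt_integral_timeShift hb hφ s using 1
  rw [testJet_apply, shiftL2_toLp, inner_toLp, ← hpair, neg_neg]

lemma inner_liftJet_shiftL2 (hb : MemLp b 2 (muCyl m α ⊤)) (hL : MemLp L 2 (muCyl m α ⊤))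
    (hbL : HasTimeDeriv α T b L) {w : JetL2 m n α} (hw : w ∈ closure (range (testJet m n α T)))
    {h : ℝ} (hh : 0 ≤ h) :
    inner ℝ ((memLp_liftJet hb).toLp _) (shiftL2 m n α h w)
      = inner ℝ ((memLp_liftJet hb).toLp _) w
        - ∫ s in (0 : ℝ)..h, inner ℝ (hL.toLp L) (shiftL2 m n α s w) := by
  have hclosed : IsClosed {v : JetL2 m n α |
      inner ℝ ((memLp_liftJet hb).toLp _) (shiftL2 m n α h v)
        = inner ℝ ((memLp_liftJet hb).toLp _) v
          - ∫ s in (0 : ℝ)..h, inner ℝ (hL.toLp L) (shiftL2 m n α s v)} :=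
    isClosed_eq ((innerSL ℝ _).continuous.comp (shiftL2 m n α h).continuous)
      ((innerSL ℝ _).continuous.sub
        (intervalIntegral.continuous_parametric_intervalIntegral_of_continuous'
          (continuous_inner_shiftL2 _) 0 h))
  refine closure_minimal ?_ hclosed hw
  rintro _ ⟨φ, rfl⟩
  have hftc := intervalIntegral.integral_eq_sub_of_hasDerivAt
    (fun s hs => hasDerivAt_inner_shiftL2_testJet hb hL hbL φ (uIcc_of_le hh ▸ hs).1)
    ((continuous_inner_shiftL2_apply _ _).neg.intervalIntegrable 0 h)
  rw [intervalIntegral.integral_neg, shiftL2_zero] at hftc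
  rw [mem_ofPred_eq]
  linarith

theorem hasDerivWithinAt_inner_shiftL2 (hb : MemLp b 2 (muCyl m α ⊤))
    (hL : MemLp L 2 (muCyl m α ⊤)) (hbL : HasTimeDeriv α T b L) {w : JetL2 m n α}
    (hw : w ∈ closure (range (testJet m n α T))) :
    HasDerivWithinAt (fun s => inner ℝ ((memLp_liftJet hb).toLp _) (shiftL2 m n α s w))
      (- inner ℝ (hL.toLp L) w) (Ici 0) 0 := by
  have hcont := continuous_inner_shiftL2_apply (hL.toLp L) w
  have hftc := (intervalIntegral.integral_hasDerivAt_right (hcont.intervalIntegrable 0 0)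
    (hcont.stronglyMeasurableAtFilter _ _) hcont.continuousAt).const_sub
      (inner ℝ ((memLp_liftJet hb).toLp _) w)
  rw [shiftL2_zero] at hftc
  exact hftc.hasDerivWithinAt.congr (fun s hs => inner_liftJet_shiftL2 hb hL hbL hw hs)
    (inner_liftJet_shiftL2 hb hL hbL hw le_rfl)

end TimeDerivative

/-! ### One-sided mollification -/

/-- The centre of the mollification kernel: convolution looks into the past and away from the
boundary of the half-space. -/
def kernelCenter (m : ℕ) : ℝ × Sp m := (2, EuclideanSpace.single (Fin.last m) (-2))

/-- The bump function that underlies the mollification kernel. -/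
def kernelBump (m : ℕ) : ContDiffBump (kernelCenter m) := ⟨1 / 2, 1, by norm_num, by norm_num⟩

/-- A smooth probability density supported in the unit ball about `kernelCenter`. -/
def kernel (m : ℕ) : ℝ × Sp m → ℝ := (kernelBump m).normed volume

/-- The probability measure with density `kernel`. -/
def kernelMeasure (m : ℕ) : Measure (ℝ × Sp m) :=
  volume.withDensity fun η => ENNReal.ofReal (kernel m η)

/-- The Lebesgue density of `muCyl`, extended by zero to all of space-time. -/
def weight (m : ℕ) (α : ℝ) (T : EReal) : ℝ × Sp m → ℝ≥0∞ :=
  (cyl m T).indicator fun z => ENNReal.ofReal (z.2 (Fin.last m) ^ α)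

/-- One-sided mollification at scale `ε`. -/
def mollify {m : ℕ} {E : Type*} [NormedAddCommGroup E] [NormedSpace ℝ E] (ε : ℝ)
    (v : ℝ × Sp m → E) (z : ℝ × Sp m) : E :=
  ∫ η, v (z - ε • η) ∂(kernelMeasure m)

section Kernel

variable {m : ℕ} {η : ℝ × Sp m}

instance instIsAddHaarMeasureVolume (m : ℕ) :
    (volume : Measure (ℝ × Sp m)).IsAddHaarMeasure := by
  rw [Measure.volume_eq_prod]
  infer_instance

lemma continuous_kernel : Continuous (kernel m) := (kernelBump m).continuous_normed

lemma kernel_nonneg (η : ℝ × Sp m) : 0 ≤ kernel m η := (kernelBump m).nonneg_normed η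

lemma measurable_ofReal_kernel : Measurable fun η => ENNReal.ofReal (kernel m η) :=
  continuous_kernel.measurable.ennreal_ofReal

instance instIsProbabilityMeasureKernel (m : ℕ) : IsProbabilityMeasure (kernelMeasure m) := by
  refine ⟨?_⟩
  rw [kernelMeasure, withDensity_apply _ MeasurableSet.univ, Measure.restrict_univ,
    ← ofReal_integral_eq_lintegral_ofReal (f := kernel m) (kernelBump m).integrable_normed
      (.of_forall kernel_nonneg)]
  simp [kernel, (kernelBump m).integral_normed]

lemma support_kernel (m : ℕ) :
    Function.support (kernel m) = Metric.ball (kernelCenter m) 1 :=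
  (kernelBump m).support_normed_eq

lemma ae_kernelMeasure_mem_ball : ∀ᵐ η ∂(kernelMeasure m), η ∈ Metric.ball (kernelCenter m) 1 := by
  rw [kernelMeasure, ae_withDensity_iff measurable_ofReal_kernel]
  refine .of_forall fun η hη => ?_
  rw [← support_kernel]
  exact fun h => hη (by simp [h])

lemma fst_mem_of_mem_ball (h : η ∈ Metric.ball (kernelCenter m) 1) : 1 < η.1 ∧ η.1 < 3 := by
  rw [Metric.mem_ball, Prod.dist_eq, max_lt_iff, Real.dist_eq, abs_lt] at h
  simp only [kernelCenter] at h
  constructor <;> linarith [h.1.1, h.1.2]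

lemma last_mem_of_mem_ball (h : η ∈ Metric.ball (kernelCenter m) 1) :
    -3 < η.2 (Fin.last m) ∧ η.2 (Fin.last m) < -1 := by
  rw [Metric.mem_ball, Prod.dist_eq, max_lt_iff, dist_eq_norm η.2] at h
  have hcoord : ‖(η.2 - (kernelCenter m).2) (Fin.last m)‖ < 1 :=
    (PiLp.norm_apply_le _ _).trans_lt h.2
  rw [Real.norm_eq_abs, abs_lt] at hcoord
  simp only [kernelCenter, PiLp.sub_apply, PiLp.single_apply, if_true] at hcoord
  constructor <;> linarith

lemma norm_lt_of_mem_ball (h : η ∈ Metric.ball (kernelCenter m) 1) : ‖η‖ < 3 := by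
  have hcenter : ‖kernelCenter m‖ ≤ 2 := by simp [kernelCenter, Prod.norm_def]
  have hdist : ‖η - kernelCenter m‖ < 1 := mem_ball_iff_norm.1 h
  linarith [norm_le_norm_add_norm_sub' η (kernelCenter m)]

end Kernel

section Weight

variable {m : ℕ} {α : ℝ} {T : EReal}

lemma measurable_weight (m : ℕ) (α : ℝ) (T : EReal) : Measurable (weight m α T) :=
  ((measurable_ofReal_last_rpow m α).comp measurable_snd).indicator (isOpen_cyl m T).measurableSet

lemma muCyl_eq_withDensity (m : ℕ) (α : ℝ) (T : EReal) :
    muCyl m α T = volume.withDensity (weight m α T) := by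
  rw [weight, withDensity_indicator (isOpen_cyl m T).measurableSet]
  rfl

lemma rpow_le_of_comparable {a b : ℝ} (ha : 0 < a) (hb : 0 < b) (hab : a ≤ 6 * b)
    (hba : b ≤ 6 * a) : a ^ α ≤ 6 ^ |α| * b ^ α := by
  rcases le_or_gt 0 α with h | h
  · rw [abs_of_nonneg h, ← Real.mul_rpow (by norm_num) hb.le]
    exact Real.rpow_le_rpow ha.le hab h
  · rw [abs_of_neg h, Real.rpow_neg (by norm_num), ← Real.inv_rpow (by norm_num),
      ← Real.mul_rpow (by norm_num) hb.le]
    exact Real.rpow_le_rpow_of_nonpos (by positivity) (by linarith) h.le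

/-- The point of space-time at height `r` over the origin. -/
def heightPoint (m : ℕ) (r : ℝ) : ℝ × Sp m := (0, EuclideanSpace.single (Fin.last m) r)

lemma weight_top_add_heightPoint (η : ℝ × Sp m) (r : ℝ) :
    weight m α ⊤ (η + heightPoint m r)
      = if 0 < r + η.2 (Fin.last m) then ENNReal.ofReal ((r + η.2 (Fin.last m)) ^ α) else 0 := by
  classical
  rw [weight, indicator_apply]
  simp [cyl, halfSpace, heightPoint, add_comm]

lemma weight_add_smul_le {ε : ℝ} (hε : 0 < ε) (y η : ℝ × Sp m) :
    weight m α T (y + ε • η) ≤ ENNReal.ofReal (ε ^ α)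
      * weight m α ⊤ (η + heightPoint m (y.2 (Fin.last m) / ε)) := by
  by_cases h : y + ε • η ∈ cyl m T
  · have hpos : 0 < y.2 (Fin.last m) + ε * η.2 (Fin.last m) := h.2
    have hscale : ε * (y.2 (Fin.last m) / ε + η.2 (Fin.last m))
        = y.2 (Fin.last m) + ε * η.2 (Fin.last m) := by field_simp
    have hpos' : 0 < y.2 (Fin.last m) / ε + η.2 (Fin.last m) :=
      pos_of_mul_pos_right (hscale ▸ hpos) hε.le
    rw [weight_top_add_heightPoint, if_pos hpos', ← ENNReal.ofReal_mul (by positivity),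
      ← Real.mul_rpow hε.le hpos'.le, hscale, weight, indicator_of_mem h]
    rfl
  · rw [weight, indicator_of_notMem h]
    exact zero_le

lemma mem_cyl_of_add_smul_mem {ε : ℝ} (hε : 0 ≤ ε) {y η : ℝ × Sp m}
    (hη : η ∈ Metric.ball (kernelCenter m) 1) (h : y + ε • η ∈ cyl m T) : y ∈ cyl m T := by
  obtain ⟨htime, hspace⟩ := h
  have hη₁ := fst_mem_of_mem_ball hη
  have hη₂ := last_mem_of_mem_ball hη
  constructor
  · refine lt_of_le_of_lt (EReal.coe_le_coe_iff.2 ?_) htime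
    simp only [Prod.fst_add, Prod.smul_fst, smul_eq_mul]
    nlinarith
  · have hspace : 0 < y.2 (Fin.last m) + ε * η.2 (Fin.last m) := hspace
    change 0 < y.2 (Fin.last m)
    nlinarith

lemma exists_lintegral_weight_translate_le [IsLocallyFiniteMeasure (muCyl m α ⊤)] (R : ℝ) :
    ∃ C : ℝ≥0∞, C ≠ ⊤ ∧ ∀ p : ℝ × Sp m, ‖p‖ ≤ R →
      ∫⁻ η, weight m α ⊤ (η + p) ∂(kernelMeasure m) ≤ C := by
  obtain ⟨C₀, hC₀⟩ := (continuous_kernel (m := m)).bounded_above_of_compact_support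
    (kernelBump m).hasCompactSupport_normed
  let B : Set (ℝ × Sp m) := Metric.closedBall 0 (3 + R)
  have hB : MeasurableSet B := Metric.isClosed_closedBall.measurableSet
  let w := B.indicator (weight m α ⊤)
  have hw : Measurable w := (measurable_weight m α ⊤).indicator hB
  refine ⟨ENNReal.ofReal C₀ * muCyl m α ⊤ B, ENNReal.mul_ne_top ENNReal.ofReal_ne_top
    (isCompact_closedBall _ _).measure_lt_top.ne, fun p hp => ?_⟩
  have hwp : Measurable fun η => w (η + p) := hw.comp (measurable_add_const p)
  calc ∫⁻ η, weight m α ⊤ (η + p) ∂(kernelMeasure m)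
      = ∫⁻ η, w (η + p) ∂(kernelMeasure m) := by
        refine lintegral_congr_ae ?_
        filter_upwards [ae_kernelMeasure_mem_ball] with η hη
        refine (indicator_of_mem (mem_closedBall_zero_iff.2 ?_) _).symm
        linarith [norm_add_le η p, norm_lt_of_mem_ball hη]
    _ = ∫⁻ η, ENNReal.ofReal (kernel m η) * w (η + p) := by
        rw [kernelMeasure, lintegral_withDensity_eq_lintegral_mul _ measurable_ofReal_kernel hwp]
        rfl
    _ ≤ ∫⁻ η, ENNReal.ofReal C₀ * w (η + p) := by
        gcongr with η
        exact (le_abs_self _).trans (hC₀ η)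
    _ = ENNReal.ofReal C₀ * muCyl m α ⊤ B := by
        rw [lintegral_const_mul _ hwp, lintegral_add_right_eq_self w p, lintegral_indicator hB,
          muCyl_eq_withDensity, withDensity_apply _ hB]

lemma exists_lintegral_weight_heightPoint_le [IsLocallyFiniteMeasure (muCyl m α ⊤)] :
    ∃ C : ℝ≥0∞, C ≠ ⊤ ∧ ∀ r : ℝ, 0 < r →
      ∫⁻ η, weight m α ⊤ (η + heightPoint m r) ∂(kernelMeasure m)
        ≤ C * ENNReal.ofReal (r ^ α) := by
  obtain ⟨C, hC, hle⟩ := exists_lintegral_weight_translate_le (m := m) (α := α) 6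
  refine ⟨(1 + C) * ENNReal.ofReal (6 ^ |α|), by finiteness, fun r hr => ?_⟩
  have hcomp : ∀ a : ℝ, 0 < a → a ≤ 6 * r → r ≤ 6 * a →
      ENNReal.ofReal (a ^ α) ≤ ENNReal.ofReal (6 ^ |α|) * ENNReal.ofReal (r ^ α) := by
    intro a ha har hra
    rw [← ENNReal.ofReal_mul (by positivity)]
    exact ENNReal.ofReal_le_ofReal (rpow_le_of_comparable ha hr har hra)
  rw [mul_assoc]
  rcases le_or_gt r 1 with hr1 | hr1
  · have hzero : ∀ᵐ η ∂(kernelMeasure m), weight m α ⊤ (η + heightPoint m r) = 0 := by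
      filter_upwards [ae_kernelMeasure_mem_ball] with η hη
      rw [weight_top_add_heightPoint, if_neg (by linarith [last_mem_of_mem_ball hη])]
    rw [lintegral_congr_ae hzero, lintegral_zero]
    exact zero_le
  rcases le_or_gt r 6 with hr6 | hr6
  · have hone : 1 ≤ ENNReal.ofReal (6 ^ |α|) * ENNReal.ofReal (r ^ α) := by
      simpa using hcomp 1 one_pos (by linarith) (by linarith)
    calc ∫⁻ η, weight m α ⊤ (η + heightPoint m r) ∂(kernelMeasure m)
        ≤ C := hle _ (by simpa [heightPoint, Prod.norm_def, abs_of_pos hr] using hr6)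
      _ ≤ (1 + C) * 1 := by rw [mul_one]; exact le_add_self
      _ ≤ _ := by gcongr
  · calc ∫⁻ η, weight m α ⊤ (η + heightPoint m r) ∂(kernelMeasure m)
        ≤ ∫⁻ _, ENNReal.ofReal (6 ^ |α|) * ENNReal.ofReal (r ^ α) ∂(kernelMeasure m) := by
          refine lintegral_mono_ae ?_
          filter_upwards [ae_kernelMeasure_mem_ball] with η hη
          obtain ⟨hη₁, hη₂⟩ := last_mem_of_mem_ball hη
          rw [weight_top_add_heightPoint, if_pos (by linarith)]
          exact hcomp _ (by linarith) (by linarith) (by linarith)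
      _ = 1 * (ENNReal.ofReal (6 ^ |α|) * ENNReal.ofReal (r ^ α)) := by simp
      _ ≤ _ := by gcongr; exact le_self_add

/-- For `α < 0` a translate of the weight is not bounded by a multiple of it; averaging over the
kernel is what makes the bound true. -/
lemma exists_lintegral_weight_le [IsLocallyFiniteMeasure (muCyl m α ⊤)] :
    ∃ C : ℝ≥0∞, C ≠ ⊤ ∧ ∀ (ε : ℝ) (_ : 0 < ε) (T : EReal) (y : ℝ × Sp m),
      ∫⁻ η, weight m α T (y + ε • η) ∂(kernelMeasure m) ≤ C * weight m α T y := by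
  obtain ⟨C, hC, hle⟩ := exists_lintegral_weight_heightPoint_le (m := m) (α := α)
  refine ⟨C, hC, fun ε hε T y => ?_⟩
  by_cases hy : y ∈ cyl m T
  · have hy₀ : 0 < y.2 (Fin.last m) := hy.2
    have hmeas : Measurable fun η => weight m α ⊤ (η + heightPoint m (y.2 (Fin.last m) / ε)) :=
      (measurable_weight m α ⊤).comp (measurable_add_const _)
    calc ∫⁻ η, weight m α T (y + ε • η) ∂(kernelMeasure m)
        ≤ ∫⁻ η, ENNReal.ofReal (ε ^ α)
            * weight m α ⊤ (η + heightPoint m (y.2 (Fin.last m) / ε)) ∂(kernelMeasure m) :=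
          lintegral_mono fun η => weight_add_smul_le hε y η
      _ ≤ ENNReal.ofReal (ε ^ α) * (C * ENNReal.ofReal ((y.2 (Fin.last m) / ε) ^ α)) := by
          rw [lintegral_const_mul _ hmeas]
          gcongr
          exact hle _ (by positivity)
      _ = C * weight m α T y := by
          rw [mul_left_comm, ← ENNReal.ofReal_mul (by positivity),
            ← Real.mul_rpow hε.le (by positivity), mul_div_cancel₀ _ hε.ne', weight,
            indicator_of_mem hy]
  · have hzero : ∀ᵐ η ∂(kernelMeasure m), weight m α T (y + ε • η) = 0 := by
      filter_upwards [ae_kernelMeasure_mem_ball] with η hη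
      exact indicator_of_notMem (fun h => hy (mem_cyl_of_add_smul_mem hε.le hη h)) _
    rw [lintegral_congr_ae hzero, lintegral_zero]
    exact zero_le

end Weight

section MollifyL2

variable {m : ℕ} {α : ℝ} {T : EReal} {E : Type*} [NormedAddCommGroup E] {v g : ℝ × Sp m → E}
  {ε : ℝ}

lemma sq_lintegral_le {X : Type*} [MeasurableSpace X] {P : Measure X} [IsProbabilityMeasure P]
    {f : X → ℝ≥0∞} (hf : AEMeasurable f P) : (∫⁻ x, f x ∂P) ^ 2 ≤ ∫⁻ x, f x ^ 2 ∂P := by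
  have h := eLpNorm_le_eLpNorm_of_exponent_le (p := 1) (q := 2) (μ := P) (f := f) (by norm_num)
    hf.aestronglyMeasurable
  rw [eLpNorm_one_eq_lintegral_enorm,
    eLpNorm_eq_lintegral_rpow_enorm_toReal (by simp) (by simp)] at h
  simp only [enorm_eq_self, ENNReal.toReal_ofNat, ENNReal.rpow_ofNat] at h
  calc (∫⁻ x, f x ∂P) ^ 2 ≤ ((∫⁻ x, f x ^ 2 ∂P) ^ ((1 : ℝ) / 2)) ^ 2 := by gcongr
    _ = ∫⁻ x, f x ^ 2 ∂P := by rw [← ENNReal.rpow_natCast, ← ENNReal.rpow_mul]; simp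

lemma eLpNorm_two_eq {X : Type*} [MeasurableSpace X] {μ : Measure X} (f : X → E) :
    eLpNorm f 2 μ = (∫⁻ x, ‖f x‖ₑ ^ 2 ∂μ) ^ ((1 : ℝ) / 2) := by
  rw [eLpNorm_eq_lintegral_rpow_enorm_toReal (by simp) (by simp)]
  simp

lemma lintegral_sq_lt_top {X : Type*} [MeasurableSpace X] {μ : Measure X} {f : X → E}
    (hf : MemLp f 2 μ) : ∫⁻ x, ‖f x‖ₑ ^ 2 ∂μ < ⊤ := by
  simpa using lintegral_rpow_enorm_lt_top_of_eLpNorm_lt_top (p := 2) (by simp) (by simp) hf.2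

lemma tendsto_eLpNorm_two_zero_of_dominated {ι X : Type*} [MeasurableSpace X] {μ : Measure X}
    {l : Filter ι} [l.IsCountablyGenerated] {F : ι → X → E} {bound : X → ℝ}
    (hF : ∀ i, AEStronglyMeasurable (F i) μ) (hbound : MemLp bound 2 μ)
    (hle : ∀ᶠ i in l, ∀ᵐ x ∂μ, ‖F i x‖ ≤ bound x)
    (hlim : ∀ᵐ x ∂μ, Tendsto (fun i => F i x) l (𝓝 0)) :
    Tendsto (fun i => eLpNorm (F i) 2 μ) l (𝓝 0) := by
  have hsq : Tendsto (fun i => ∫⁻ x, ‖F i x‖ₑ ^ 2 ∂μ) l (𝓝 (∫⁻ _, 0 ∂μ)) := by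
    refine tendsto_lintegral_filter_of_dominated_convergence' (fun x => ‖bound x‖ₑ ^ 2)
      (.of_forall fun i => (hF i).enorm.pow_const 2) ?_ (lintegral_sq_lt_top hbound).ne ?_
    · filter_upwards [hle] with i hi
      filter_upwards [hi] with x hx
      gcongr
      exact enorm_le_iff_norm_le.2 (hx.trans (le_abs_self _))
    · filter_upwards [hlim] with x hx
      simpa [Function.comp_def] using ((ENNReal.continuous_pow 2).tendsto _).comp hx.enorm
  simp_rw [eLpNorm_two_eq]
  simpa using hsq.ennrpow_const (1 / 2)

lemma measurable_enorm_translate (hv : StronglyMeasurable v) (ε : ℝ) :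
    Measurable fun p : (ℝ × Sp m) × (ℝ × Sp m) => ‖v (p.1 - ε • p.2)‖ₑ :=
  hv.enorm.comp (by fun_prop)

/-- The bound of `exists_lintegral_weight_le`; its square root bounds mollification on `L_2`. -/
def mollifyConst (m : ℕ) (α : ℝ) [IsLocallyFiniteMeasure (muCyl m α ⊤)] : ℝ≥0∞ :=
  (exists_lintegral_weight_le (m := m) (α := α)).choose

variable [IsLocallyFiniteMeasure (muCyl m α ⊤)]

lemma mollifyConst_ne_top : mollifyConst m α ≠ ⊤ :=
  (exists_lintegral_weight_le (m := m) (α := α)).choose_spec.1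

lemma lintegral_weight_le (hε : 0 < ε) (T : EReal) (y : ℝ × Sp m) :
    ∫⁻ η, weight m α T (y + ε • η) ∂(kernelMeasure m) ≤ mollifyConst m α * weight m α T y :=
  (exists_lintegral_weight_le (m := m) (α := α)).choose_spec.2 ε hε T y

lemma lintegral_lintegral_translate_le {f : ℝ × Sp m → ℝ≥0∞} (hf : Measurable f) (hε : 0 < ε) :
    ∫⁻ z, ∫⁻ η, f (z - ε • η) ∂(kernelMeasure m) ∂(muCyl m α T)
      ≤ mollifyConst m α * ∫⁻ z, f z ∂(muCyl m α T) := by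
  have hw := measurable_weight m α T
  have hfsub : Measurable fun p : (ℝ × Sp m) × (ℝ × Sp m) => f (p.1 - ε • p.2) :=
    hf.comp (by fun_prop)
  calc ∫⁻ z, ∫⁻ η, f (z - ε • η) ∂(kernelMeasure m) ∂(muCyl m α T)
      = ∫⁻ z, ∫⁻ η, weight m α T z * f (z - ε • η) ∂(kernelMeasure m) := by
        rw [muCyl_eq_withDensity,
          lintegral_withDensity_eq_lintegral_mul _ hw hfsub.lintegral_prod_right']
        exact lintegral_congr fun z =>
          (lintegral_const_mul _ (hfsub.comp measurable_prodMk_left)).symm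
    _ = ∫⁻ η, ∫⁻ z, weight m α T z * f (z - ε • η) ∂volume ∂(kernelMeasure m) :=
        lintegral_lintegral_swap ((hw.comp measurable_fst).mul hfsub).aemeasurable
    _ = ∫⁻ η, ∫⁻ y, weight m α T (y + ε • η) * f y ∂volume ∂(kernelMeasure m) := by
        refine lintegral_congr fun η => ?_
        rw [← lintegral_add_right_eq_self _ (ε • η)]
        simp only [add_sub_cancel_right]
    _ = ∫⁻ y, ∫⁻ η, weight m α T (y + ε • η) * f y ∂(kernelMeasure m) :=
        lintegral_lintegral_swap
          ((hw.comp (by fun_prop)).mul (hf.comp measurable_snd)).aemeasurable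
    _ ≤ ∫⁻ y, mollifyConst m α * (weight m α T y * f y) := by
        refine lintegral_mono fun y => ?_
        have hwy : Measurable fun η => weight m α T (y + ε • η) := hw.comp (by fun_prop)
        rw [lintegral_mul_const _ hwy, ← mul_assoc]
        gcongr
        exact lintegral_weight_le hε T y
    _ = mollifyConst m α * ∫⁻ z, f z ∂(muCyl m α T) := by
        rw [muCyl_eq_withDensity, lintegral_withDensity_eq_lintegral_mul _ hw hf]
        exact lintegral_const_mul _ (hw.mul hf)

lemma ae_integrable_translate (hv : StronglyMeasurable v) (hv₂ : MemLp v 2 (muCyl m α T))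
    (hε : 0 < ε) :
    ∀ᵐ z ∂(muCyl m α T), Integrable (fun η => v (z - ε • η)) (kernelMeasure m) := by
  have hfin : ∫⁻ z, ∫⁻ η, ‖v (z - ε • η)‖ₑ ^ 2 ∂(kernelMeasure m) ∂(muCyl m α T) < ⊤ :=
    (lintegral_lintegral_translate_le (hv.enorm.pow_const 2) hε).trans_lt
      (ENNReal.mul_lt_top mollifyConst_ne_top.lt_top (lintegral_sq_lt_top hv₂))
  filter_upwards [ae_lt_top ((measurable_enorm_translate hv ε).pow_const 2).lintegral_prod_right'
    hfin.ne] with z hz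
  have hmeas : AEStronglyMeasurable (fun η => v (z - ε • η)) (kernelMeasure m) :=
    (hv.comp_measurable (by fun_prop)).aestronglyMeasurable
  refine MemLp.integrable (q := 2) (by norm_num) ⟨hmeas, ?_⟩
  rw [eLpNorm_two_eq]
  exact ENNReal.rpow_lt_top_of_nonneg (by norm_num) hz.ne

variable [NormedSpace ℝ E]

lemma eLpNorm_mollify_le (hv : StronglyMeasurable v) (hε : 0 < ε) :
    eLpNorm (mollify ε v) 2 (muCyl m α T)
      ≤ mollifyConst m α ^ ((1 : ℝ) / 2) * eLpNorm v 2 (muCyl m α T) := by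
  rw [eLpNorm_two_eq, eLpNorm_two_eq, ← ENNReal.mul_rpow_of_nonneg _ _ (by norm_num)]
  refine ENNReal.rpow_le_rpow ?_ (by norm_num)
  refine le_trans (lintegral_mono fun z => ?_)
    (lintegral_lintegral_translate_le (hv.enorm.pow_const 2) hε)
  calc ‖mollify ε v z‖ₑ ^ 2 ≤ (∫⁻ η, ‖v (z - ε • η)‖ₑ ∂(kernelMeasure m)) ^ 2 := by
        gcongr; exact enorm_integral_le_lintegral_enorm _
    _ ≤ ∫⁻ η, ‖v (z - ε • η)‖ₑ ^ 2 ∂(kernelMeasure m) := sq_lintegral_le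
      ((measurable_enorm_translate hv ε).comp measurable_prodMk_left).aemeasurable

lemma stronglyMeasurable_mollify (hv : StronglyMeasurable v) (ε : ℝ) :
    StronglyMeasurable (mollify ε v) :=
  StronglyMeasurable.integral_prod_right'
    (f := fun p : (ℝ × Sp m) × (ℝ × Sp m) => v (p.1 - ε • p.2))
    (hv.comp_measurable (by fun_prop))

lemma norm_mollify_sub_le [CompleteSpace E] (hg : Continuous g) (hgc : HasCompactSupport g)
    (hε : 0 ≤ ε) {z : ℝ × Sp m} {c : ℝ} (hc : ∀ y, dist y z ≤ 3 * ε → ‖g y - g z‖ ≤ c) :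
    ‖mollify ε g z - g z‖ ≤ c := by
  obtain ⟨B, hB⟩ := hg.bounded_above_of_compact_support hgc
  have hint : Integrable (fun η => g (z - ε • η)) (kernelMeasure m) :=
    Integrable.of_bound (hg.comp (by fun_prop)).aestronglyMeasurable B (.of_forall fun η => hB _)
  have hsub : mollify ε g z - g z = ∫ η, (g (z - ε • η) - g z) ∂(kernelMeasure m) := by
    rw [integral_sub hint (integrable_const _)]
    simp [mollify]
  rw [hsub]
  refine (norm_integral_le_of_norm_le_const (C := c) ?_).trans (by simp)
  filter_upwards [ae_kernelMeasure_mem_ball] with η hη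
  refine hc _ ?_
  rw [dist_eq_norm, sub_sub_cancel_left, norm_neg, norm_smul, Real.norm_of_nonneg hε, mul_comm]
  gcongr
  exact (norm_lt_of_mem_ball hη).le

lemma tendsto_mollify_apply [CompleteSpace E] (hg : Continuous g) (hgc : HasCompactSupport g)
    (z : ℝ × Sp m) : Tendsto (fun ε => mollify ε g z) (𝓝[>] 0) (𝓝 (g z)) := by
  rw [Metric.tendsto_nhds]
  intro c hc
  obtain ⟨r, hr, hgr⟩ := Metric.continuous_iff.1 hg z (c / 2) (half_pos hc)
  have hsmall : ∀ᶠ ε : ℝ in 𝓝[>] 0, ε < r / 3 :=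
    eventually_nhdsWithin_of_eventually_nhds (eventually_lt_nhds (by positivity))
  filter_upwards [hsmall, self_mem_nhdsWithin] with ε hεr (hε : 0 < ε)
  rw [dist_eq_norm]
  refine (norm_mollify_sub_le hg hgc hε.le fun y hy => ?_).trans_lt (half_lt_self hc)
  rw [← dist_eq_norm]
  exact (hgr y (by linarith)).le

lemma norm_mollify_sub_le_indicator [CompleteSpace E] (hg : Continuous g)
    (hgc : HasCompactSupport g) {B : ℝ} (hB : ∀ z, ‖g z‖ ≤ B) (hε : 0 ≤ ε) (hε₁ : ε ≤ 1)
    (z : ℝ × Sp m) :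
    ‖mollify ε g z - g z‖ ≤ (Metric.cthickening 3 (tsupport g)).indicator (fun _ => 2 * B) z := by
  refine norm_mollify_sub_le hg hgc hε fun y hy => ?_
  by_cases hz : z ∈ Metric.cthickening 3 (tsupport g)
  · rw [indicator_of_mem hz]
    linarith [norm_sub_le (g y) (g z), hB y, hB z]
  · have hout : ∀ y, dist y z ≤ 3 → g y = 0 := fun y hy =>
      image_eq_zero_of_notMem_tsupport fun h =>
        hz (Metric.mem_cthickening_of_dist_le z y 3 _ h (by rwa [dist_comm]))
    rw [indicator_of_notMem hz, hout y (by linarith), hout z (by simp), sub_zero, norm_zero]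

lemma tendsto_eLpNorm_mollify_sub_of_continuous [CompleteSpace E] (hg : Continuous g)
    (hgc : HasCompactSupport g) :
    Tendsto (fun ε => eLpNorm (mollify ε g - g) 2 (muCyl m α T)) (𝓝[>] 0) (𝓝 0) := by
  have hK : IsCompact (Metric.cthickening 3 (tsupport g)) := hgc.isCompact.cthickening
  obtain ⟨B, hB⟩ := hg.bounded_above_of_compact_support hgc
  refine tendsto_eLpNorm_two_zero_of_dominated
    (fun ε => ((stronglyMeasurable_mollify hg.stronglyMeasurable ε).sub
      hg.stronglyMeasurable).aestronglyMeasurable)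
    (memLp_indicator_const 2 hK.measurableSet (2 * B) (Or.inr hK.measure_lt_top.ne)) ?_
    (.of_forall fun z => by simpa using (tendsto_mollify_apply hg hgc z).sub_const (g z))
  filter_upwards [eventually_nhdsWithin_of_eventually_nhds (eventually_lt_nhds one_pos),
    self_mem_nhdsWithin] with ε hε₁ (hε : 0 < ε)
  exact .of_forall (norm_mollify_sub_le_indicator hg hgc hB hε.le hε₁.le)

lemma mollify_sub_ae_eq (hv : StronglyMeasurable v) (hv₂ : MemLp v 2 (muCyl m α T))
    (hg : StronglyMeasurable g) (hg₂ : MemLp g 2 (muCyl m α T)) (hε : 0 < ε) :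
    mollify ε (v - g) =ᵐ[muCyl m α T] mollify ε v - mollify ε g := by
  filter_upwards [ae_integrable_translate hv hv₂ hε, ae_integrable_translate hg hg₂ hε]
    with z hvz hgz
  exact integral_sub hvz hgz

lemma tendsto_eLpNorm_mollify_sub [CompleteSpace E] (hv : StronglyMeasurable v)
    (hv₂ : MemLp v 2 (muCyl m α T)) :
    Tendsto (fun ε => eLpNorm (mollify ε v - v) 2 (muCyl m α T)) (𝓝[>] 0) (𝓝 0) := by
  set C : ℝ≥0∞ := mollifyConst m α ^ ((1 : ℝ) / 2)
  have hC : C ≠ ⊤ := (ENNReal.rpow_lt_top_of_nonneg (by norm_num) mollifyConst_ne_top).ne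
  rw [ENNReal.tendsto_nhds_zero]
  intro δ hδ
  have hδ' : δ / 2 / (C + 1) ≠ 0 := by
    simp [ENNReal.div_eq_zero_iff, hδ.ne', hC]
  obtain ⟨g, hgc, hgv, hg, hg₂⟩ := hv₂.exists_hasCompactSupport_eLpNorm_sub_le (by simp) hδ'
  have hgm := hg.stronglyMeasurable
  filter_upwards [ENNReal.tendsto_nhds_zero.1 (tendsto_eLpNorm_mollify_sub_of_continuous (α := α)
    (T := T) hg hgc) (δ / 2) (ENNReal.half_pos hδ.ne'), self_mem_nhdsWithin] with ε hgε (hε : 0 < ε)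
  have hmeas : ∀ w : ℝ × Sp m → E, StronglyMeasurable w →
      AEStronglyMeasurable (mollify ε w) (muCyl m α T) := fun w hw =>
    (stronglyMeasurable_mollify hw ε).aestronglyMeasurable
  have hsplit : mollify ε v - v =ᵐ[muCyl m α T]
      (mollify ε (v - g) - (v - g)) + (mollify ε g - g) := by
    filter_upwards [mollify_sub_ae_eq hv hv₂ hgm hg₂ hε] with z hz
    simp only [Pi.add_apply, Pi.sub_apply, hz]
    abel
  rw [eLpNorm_congr_ae hsplit]
  calc eLpNorm ((mollify ε (v - g) - (v - g)) + (mollify ε g - g)) 2 (muCyl m α T)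
      ≤ (eLpNorm (mollify ε (v - g)) 2 (muCyl m α T) + eLpNorm (v - g) 2 (muCyl m α T))
        + eLpNorm (mollify ε g - g) 2 (muCyl m α T) := by
        refine (eLpNorm_add_le ((hmeas _ (hv.sub hgm)).sub (hv.sub hgm).aestronglyMeasurable)
          ((hmeas _ hgm).sub hgm.aestronglyMeasurable) (by norm_num)).trans ?_
        gcongr
        exact eLpNorm_sub_le (hmeas _ (hv.sub hgm)) (hv.sub hgm).aestronglyMeasurable (by norm_num)
    _ ≤ (C * eLpNorm (v - g) 2 (muCyl m α T) + eLpNorm (v - g) 2 (muCyl m α T)) + δ / 2 := by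
        gcongr
        exact eLpNorm_mollify_le (hv.sub hgm) hε
    _ = (C + 1) * eLpNorm (v - g) 2 (muCyl m α T) + δ / 2 := by ring
    _ ≤ (C + 1) * (δ / 2 / (C + 1)) + δ / 2 := by gcongr
    _ ≤ δ / 2 + δ / 2 := by gcongr; exact ENNReal.mul_div_le
    _ = δ := ENNReal.add_halves δ

end MollifyL2

section Smoothness

variable {m n : ℕ} {α : ℝ} {T : EReal} {ε : ℝ} {E : Type*} [NormedAddCommGroup E]

/-- The mollification kernel rescaled to the scale `ε`, of integral one. -/
def scaledKernel (m : ℕ) (ε : ℝ) (ζ : ℝ × Sp m) : ℝ :=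
  |(ε ^ Module.finrank ℝ (ℝ × Sp m))⁻¹| * kernel m (ε⁻¹ • ζ)

lemma contDiff_scaledKernel : ContDiff ℝ ∞ (scaledKernel m ε) :=
  contDiff_const.mul ((kernelBump m).contDiff_normed.comp (contDiff_const_smul _))

lemma hasCompactSupport_scaledKernel (hε : ε ≠ 0) : HasCompactSupport (scaledKernel m ε) :=
  ((kernelBump m).hasCompactSupport_normed.comp_homeomorph
    (Homeomorph.smulOfNeZero ε⁻¹ (inv_ne_zero hε))).mul_left

lemma le_of_mem_tsupport_scaledKernel (hε : 0 < ε) {ζ : ℝ × Sp m}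
    (hζ : ζ ∈ tsupport (scaledKernel m ε)) : ε ≤ ζ.1 ∧ ζ.2 (Fin.last m) ≤ -ε := by
  have hclosed : IsClosed {ζ : ℝ × Sp m | ε ≤ ζ.1 ∧ ζ.2 (Fin.last m) ≤ -ε} :=
    (isClosed_le continuous_const continuous_fst).and
      (isClosed_le (by fun_prop) continuous_const)
  refine closure_minimal (fun ξ hξ => ?_) hclosed hζ
  have hball : ε⁻¹ • ξ ∈ Metric.ball (kernelCenter m) 1 := by
    rw [← support_kernel]
    exact right_ne_zero_of_mul hξ
  have hfst : 1 < ε⁻¹ * ξ.1 := (fst_mem_of_mem_ball hball).1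
  have hlast : ε⁻¹ * ξ.2 (Fin.last m) < -1 := (last_mem_of_mem_ball hball).2
  rw [lt_inv_mul_iff₀ hε] at hfst
  rw [inv_mul_lt_iff₀ hε] at hlast
  constructor <;> linarith

lemma mollify_eq_integral_scaledKernel [NormedSpace ℝ E] (hε : ε ≠ 0) (v : ℝ × Sp m → E)
    (z : ℝ × Sp m) : mollify ε v z = ∫ t, scaledKernel m ε (z - t) • v t := by
  have hdensity : mollify ε v z = ∫ η, kernel m η • v (z - ε • η) := by
    rw [mollify, kernelMeasure, integral_withDensity_eq_integral_toReal_smul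
      measurable_ofReal_kernel (.of_forall fun _ => ENNReal.ofReal_lt_top)]
    simp [ENNReal.toReal_ofReal (kernel_nonneg _)]
  have hscale := Measure.integral_comp_smul (volume : Measure (ℝ × Sp m))
    (fun ζ => kernel m (ε⁻¹ • ζ) • v (z - ζ)) ε
  simp only [inv_smul_smul₀ hε] at hscale
  rw [hdensity, hscale, ← integral_smul,
    ← integral_sub_left_eq_self (fun t => scaledKernel m ε (z - t) • v t) volume z]
  simp [scaledKernel, mul_smul]

/-- The part of the cylinder at height more than `ε`, where the weight is locally bounded
below. -/
def innerCyl (m : ℕ) (T : EReal) (ε : ℝ) : Set (ℝ × Sp m) :=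
  cyl m T ∩ {z | ε < z.2 (Fin.last m)}

lemma isOpen_innerCyl : IsOpen (innerCyl m T ε) :=
  (isOpen_cyl m T).inter (isOpen_lt continuous_const (by fun_prop))

lemma mem_innerCyl_of_sub_mem_tsupport (hε : 0 < ε) {z t : ℝ × Sp m} (hz : z ∈ cyl m T)
    (ht : z - t ∈ tsupport (scaledKernel m ε)) : t ∈ innerCyl m T ε := by
  obtain ⟨hfst, hlast⟩ := le_of_mem_tsupport_scaledKernel hε ht
  simp only [Prod.fst_sub, Prod.snd_sub, PiLp.sub_apply] at hfst hlast
  have hpos : 0 < z.2 (Fin.last m) := hz.2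
  have hheight : ε < t.2 (Fin.last m) := by linarith
  exact ⟨⟨(EReal.coe_le_coe_iff.2 (by linarith)).trans_lt hz.1, hε.trans hheight⟩, hheight⟩

lemma restrict_innerCyl_le (hε : 0 < ε) {R : ℝ} (hR : 0 < R) :
    volume.restrict (innerCyl m T ε ∩ {z | z.2 (Fin.last m) ≤ R})
      ≤ (ENNReal.ofReal (min (ε ^ α) (R ^ α)))⁻¹ • muCyl m α T := by
  set S := innerCyl m T ε ∩ {z : ℝ × Sp m | z.2 (Fin.last m) ≤ R}
  have hS : MeasurableSet S := isOpen_innerCyl.measurableSet.inter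
    (isClosed_le (by fun_prop) continuous_const).measurableSet
  have hmin : 0 < min (ε ^ α) (R ^ α) := by positivity
  have hweight : ∀ z ∈ S, ENNReal.ofReal (min (ε ^ α) (R ^ α)) ≤ weight m α T z := by
    rintro z ⟨⟨hz, hεz⟩, hzR⟩
    rw [weight, indicator_of_mem hz]
    refine ENNReal.ofReal_le_ofReal ?_
    rcases le_or_gt 0 α with h | h
    · exact min_le_of_left_le (Real.rpow_le_rpow hε.le hεz.le h)
    · exact min_le_of_right_le (Real.rpow_le_rpow_of_nonpos (hε.trans hεz) hzR h.le)
  rw [muCyl_eq_withDensity, ← withDensity_smul _ (measurable_weight m α T),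
    ← withDensity_indicator_one hS]
  refine withDensity_mono (.of_forall <| indicator_le fun z hz => ?_)
  rw [Pi.one_apply, Pi.smul_apply, smul_eq_mul, mul_comm, ← div_eq_mul_inv]
  exact (ENNReal.le_div_iff_mul_le
    (.inl (ENNReal.ofReal_pos.2 hmin).ne') (by simp)).2 (by simpa using hweight z hz)

lemma locallyIntegrable_indicator_innerCyl (hε : 0 < ε) {v : ℝ × Sp m → E}
    (hv : MemLp v 2 (muCyl m α T)) :
    LocallyIntegrable ((innerCyl m T ε).indicator v) volume := by
  rw [locallyIntegrable_iff]
  intro K hK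
  obtain ⟨R, hR, hKR⟩ := hK.isBounded.exists_pos_norm_le
  have hsub : innerCyl m T ε ∩ K ⊆ innerCyl m T ε ∩ {z | z.2 (Fin.last m) ≤ R} := by
    refine inter_subset_inter_right _ fun z hz => ?_
    exact (le_abs_self _).trans ((PiLp.norm_apply_le z.2 (Fin.last m)).trans
      ((norm_snd_le z).trans (hKR z hz)))
  have hmemLp : MemLp v 2 (volume.restrict (innerCyl m T ε ∩ K)) :=
    hv.of_measure_le_smul (by simp [hε, hR, Real.rpow_pos_of_pos])
      ((Measure.restrict_mono hsub le_rfl).trans (restrict_innerCyl_le hε hR))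
  have : IsFiniteMeasure (volume.restrict (innerCyl m T ε ∩ K)) :=
    ⟨by simpa using (measure_mono inter_subset_right).trans_lt hK.measure_lt_top⟩
  rw [IntegrableOn, integrable_indicator_iff isOpen_innerCyl.measurableSet, IntegrableOn,
    Measure.restrict_restrict isOpen_innerCyl.measurableSet]
  exact hmemLp.integrable one_le_two

variable [NormedSpace ℝ E]

lemma smul_indicator_innerCyl (hε : 0 < ε) {ρ : ℝ × Sp m → ℝ}
    (hρ : Function.support ρ ⊆ tsupport (scaledKernel m ε)) {z : ℝ × Sp m} (hz : z ∈ cyl m T)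
    (v : ℝ × Sp m → E) (t : ℝ × Sp m) :
    ρ (z - t) • (innerCyl m T ε).indicator v t = ρ (z - t) • v t := by
  by_cases ht : ρ (z - t) = 0
  · simp only [ht, zero_smul]
  · rw [indicator_of_mem (mem_innerCyl_of_sub_mem_tsupport hε hz (hρ ht))]

/-- A smooth function on the whole of space-time that agrees with `mollify ε v` on `Ω_T`. -/
def smoothMollify (T : EReal) (ε : ℝ) (v : ℝ × Sp m → E) : ℝ × Sp m → E :=
  convolution ((innerCyl m T ε).indicator v) (scaledKernel m ε)
    (ContinuousLinearMap.lsmul ℝ ℝ).flip volume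

lemma contDiff_smoothMollify (hε : 0 < ε) {v : ℝ × Sp m → E} (hv : MemLp v 2 (muCyl m α T)) :
    ContDiff ℝ ∞ (smoothMollify T ε v) :=
  (hasCompactSupport_scaledKernel hε.ne').contDiff_convolution_right _
    (locallyIntegrable_indicator_innerCyl hε hv) contDiff_scaledKernel

lemma smoothMollify_eq_mollify (hε : 0 < ε) (v : ℝ × Sp m → E) {z : ℝ × Sp m}
    (hz : z ∈ cyl m T) : smoothMollify T ε v z = mollify ε v z := by
  rw [mollify_eq_integral_scaledKernel hε.ne']
  exact integral_congr_ae
    (.of_forall (smul_indicator_innerCyl hε (subset_tsupport _) hz v))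

lemma isTest_scaledKernel_sub (hε : 0 < ε) {z : ℝ × Sp m} (hz : z ∈ cyl m T) :
    IsTest (cyl m T) (fun t => scaledKernel m ε (z - t)) := by
  refine ⟨contDiff_scaledKernel.comp (contDiff_const.sub contDiff_id),
    (hasCompactSupport_scaledKernel hε.ne').comp_homeomorph (Homeomorph.subLeft z), fun t ht => ?_⟩
  exact (mem_innerCyl_of_sub_mem_tsupport hε hz
    (tsupport_comp_subset_preimage _ (f := fun t => z - t) (by fun_prop) ht)).1

lemma dx_comp_sub_left {ρ : ℝ × Sp m → ℝ} (hρ : Differentiable ℝ ρ) (i : Fin (m + 1))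
    (z t : ℝ × Sp m) : dx i (fun t => ρ (z - t)) t = -dx i ρ (z - t) := by
  rw [dx, fderiv_fun_comp (g := ρ) t (hρ _) (by fun_prop), fderiv_const_sub]
  simp [dx]

lemma dx_smoothMollify (hε : 0 < ε) {u : ℝ × Sp m → Val n}
    {Du : Fin (m + 1) → ℝ × Sp m → Val n} (hu : MemLp u 2 (muCyl m α T))
    (hgrad : HasWeakGrad T u Du) {z : ℝ × Sp m} (hz : z ∈ cyl m T) (i : Fin (m + 1)) :
    dx i (smoothMollify T ε u) z = mollify ε (Du i) z := by
  set k := scaledKernel m ε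
  have hk : ContDiff ℝ ∞ k := contDiff_scaledKernel
  have hkc : HasCompactSupport k := hasCompactSupport_scaledKernel hε.ne'
  have hdiff : Differentiable ℝ k := hk.differentiable (by simp)
  have hloc := locallyIntegrable_indicator_innerCyl hε hu
  have hψ : IsTest (cyl m T) fun t => k (z - t) := isTest_scaledKernel_sub hε hz
  have hconv : dx i (smoothMollify T ε u) z = ∫ t, dx i k (z - t) • u t := by
    rw [dx, smoothMollify,
      (hkc.hasFDerivAt_convolution_right _ hloc (hk.of_le (by simp)) z).fderiv,
      convolution_precompR_apply _ hloc (hkc.fderiv ℝ) (hk.continuous_fderiv (by simp))]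
    exact integral_congr_ae (.of_forall
      (smul_indicator_innerCyl hε
        ((subset_tsupport _).trans (tsupport_fderiv_apply_subset ℝ _)) hz u))
  have hparts := hgrad i _ hψ
  rw [setIntegral_eq_integral_of_forall_compl_eq_zero fun t ht => by
      rw [hψ.dx_eq_zero i ht, zero_smul],
    setIntegral_eq_integral_of_forall_compl_eq_zero fun t ht => by
      rw [hψ.eq_zero_of_notMem ht, zero_smul]] at hparts
  simp only [dx_comp_sub_left hdiff, neg_smul, integral_neg,
    neg_inj] at hparts
  rw [hconv, hparts, mollify_eq_integral_scaledKernel hε.ne']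

lemma exists_jet_eq_mollify [IsLocallyFiniteMeasure (muCyl m α ⊤)] {w : ℝ × Sp m → Jet m n}
    (hw : StronglyMeasurable w) (hw₂ : MemLp w 2 (muCyl m α T))
    (hgrad : HasWeakGrad T (fun z => w z none) fun i z => w z (some i)) (hε : 0 < ε) :
    ∃ φ : ℝ × Sp m → Val n, ContDiff ℝ ∞ φ ∧ jet φ =ᵐ[muCyl m α T] mollify ε w := by
  have hw₀ : MemLp (fun z => w z none) 2 (muCyl m α T) := MemLp.eval_piLp hw₂ none
  refine ⟨smoothMollify T ε fun z => w z none, contDiff_smoothMollify hε hw₀, ?_⟩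
  filter_upwards [ae_mem_cyl m α T, ae_integrable_translate hw hw₂ hε] with z hz hint
  ext1 o
  have hcoord : mollify ε w z o = mollify ε (fun z => w z o) z :=
    eval_integral_piLp (fun o => hint.eval_piLp o) o
  rw [hcoord]
  cases o with
  | none => exact smoothMollify_eq_mollify hε _ hz
  | some i => exact dx_smoothMollify hε hw₀ hgrad hz i

end Smoothness

/-! ### Cutoffs and density of test functions -/

section Cutoff

variable {m n : ℕ} {α : ℝ} {T : EReal} {b : ℕ → ℝ}

lemma exists_strictMono_seq_timeRay (hT : ⊥ < T) : ∃ b : ℕ → ℝ,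
    StrictMono b ∧ (∀ k, b k ∈ timeRay T) ∧ ∀ t ∈ timeRay T, ∀ᶠ k in atTop, t < b k := by
  obtain ⟨a, ha, haT, hlim⟩ := exists_seq_strictMono_tendsto' hT
  have hcoe : ∀ k, ((a k).toReal : EReal) = a k := fun k =>
    EReal.coe_toReal (haT k).2.ne_top (haT k).1.ne'
  refine ⟨fun k => (a k).toReal, fun k l hkl => ?_, fun k => ?_, fun t ht => ?_⟩
  · simpa only [← EReal.coe_lt_coe_iff, hcoe] using ha hkl
  · simpa only [timeRay, mem_ofPred_eq, hcoe] using (haT k).2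
  · filter_upwards [hlim.eventually_const_lt ht] with k hk
    simpa only [← EReal.coe_lt_coe_iff, hcoe] using hk

/-- The centre of `timeBump`. -/
def timeCenter (b : ℕ → ℝ) (k : ℕ) : ℝ := (b k + (b 0 - k - 1)) / 2

/-- A bump function in time, equal to one on `[b 0 - k - 1, b k]` and vanishing after
`b (k + 1)`. -/
def timeBump (hb : StrictMono b) (k : ℕ) : ContDiffBump (timeCenter b k) where
  rIn := b k - timeCenter b k
  rOut := b (k + 1) - timeCenter b k
  rIn_pos := by
    have hmono := hb.monotone k.zero_le
    rw [timeCenter]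
    linarith [(Nat.cast_nonneg k : (0 : ℝ) ≤ k)]
  rIn_lt_rOut := sub_lt_sub_right (hb k.lt_succ_self) _

/-- A bump function in space, equal to one on the unit ball. -/
def spaceBump (m : ℕ) : ContDiffBump (0 : Sp m) := ⟨1, 2, one_pos, one_lt_two⟩

/-- A cutoff function at scale `k + 1` in space. -/
def cutoff (m : ℕ) (hb : StrictMono b) (k : ℕ) (z : ℝ × Sp m) : ℝ :=
  timeBump hb k z.1 * spaceBump m (((k : ℝ) + 1)⁻¹ • z.2)

lemma isTest_mul_fst_snd {θ : ℝ → ℝ} {β : Sp m → ℝ} (hθ : ContDiff ℝ ∞ θ)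
    (hθc : HasCompactSupport θ) (hθT : tsupport θ ⊆ timeRay T) (hβ : ContDiff ℝ ∞ β)
    (hβc : HasCompactSupport β) :
    IsTest (timeRay T ×ˢ univ) fun z : ℝ × Sp m => θ z.1 * β z.2 := by
  have hsub : tsupport (fun z : ℝ × Sp m => θ z.1 * β z.2) ⊆ tsupport θ ×ˢ tsupport β :=
    fun z hz => ⟨tsupport_comp_subset_preimage θ continuous_fst (tsupport_mul_subset_left hz),
      tsupport_comp_subset_preimage β continuous_snd (tsupport_mul_subset_right hz)⟩
  exact ⟨(hθ.comp contDiff_fst).mul (hβ.comp contDiff_snd),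
    (hθc.isCompact.prod hβc.isCompact).of_isClosed_subset (isClosed_tsupport _) hsub,
    hsub.trans (prod_mono hθT (subset_univ _))⟩

lemma dx_mul_fst_snd {θ : ℝ → ℝ} {β : Sp m → ℝ} (hθ : Differentiable ℝ θ)
    (hβ : Differentiable ℝ β) (i : Fin (m + 1)) (z : ℝ × Sp m) :
    dx i (fun z => θ z.1 * β z.2) z
      = θ z.1 * fderiv ℝ β z.2 (EuclideanSpace.single i 1) := by
  have hfst : HasFDerivAt (fun z : ℝ × Sp m => θ z.1)
      ((fderiv ℝ θ z.1).comp (ContinuousLinearMap.fst ℝ ℝ (Sp m))) z :=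
    (hθ z.1).hasFDerivAt.comp z hasFDerivAt_fst
  have hsnd : HasFDerivAt (fun z : ℝ × Sp m => β z.2)
      ((fderiv ℝ β z.2).comp (ContinuousLinearMap.snd ℝ ℝ (Sp m))) z :=
    (hβ z.2).hasFDerivAt.comp z hasFDerivAt_snd
  rw [dx, (hfst.fun_mul hsnd).fderiv]
  simp

lemma isTest_cutoff (hb : StrictMono b) (hbT : ∀ k, b k ∈ timeRay T) (k : ℕ) :
    IsTest (timeRay T ×ˢ univ) (cutoff m hb k) := by
  refine isTest_mul_fst_snd (timeBump hb k).contDiff (timeBump hb k).hasCompactSupport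
    (fun t ht => ?_) ((spaceBump m).contDiff.comp (contDiff_const_smul _))
    ((spaceBump m).hasCompactSupport.comp_homeomorph
      (Homeomorph.smulOfNeZero ((k : ℝ) + 1)⁻¹ (by positivity)))
  rw [(timeBump hb k).tsupport_eq, Metric.mem_closedBall, Real.dist_eq] at ht
  exact (EReal.coe_le_coe_iff.2 (sub_le_sub_iff_right _ |>.1 ((le_abs_self _).trans ht))).trans_lt
    (hbT (k + 1))

lemma cutoff_nonneg (hb : StrictMono b) (k : ℕ) (z : ℝ × Sp m) : 0 ≤ cutoff m hb k z :=
  mul_nonneg (timeBump hb k).nonneg (spaceBump m).nonneg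

lemma cutoff_le_one (hb : StrictMono b) (k : ℕ) (z : ℝ × Sp m) : cutoff m hb k z ≤ 1 :=
  mul_le_one₀ (timeBump hb k).le_one (spaceBump m).nonneg (spaceBump m).le_one

lemma exists_abs_dx_cutoff_le (m : ℕ) (hb : StrictMono b) :
    ∃ D, ∀ k i (z : ℝ × Sp m), |dx i (cutoff m hb k) z| ≤ D / (k + 1) := by
  obtain ⟨D, hD⟩ := (((spaceBump m).contDiff (n := 1)).continuous_fderiv
    one_ne_zero).bounded_above_of_compact_support ((spaceBump m).hasCompactSupport.fderiv ℝ)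
  refine ⟨D, fun k i z => ?_⟩
  have hdx : dx i (cutoff m hb k) z = timeBump hb k z.1 * (((k : ℝ) + 1)⁻¹
      * fderiv ℝ (spaceBump m) (((k : ℝ) + 1)⁻¹ • z.2) (EuclideanSpace.single i 1)) := by
    refine (dx_mul_fst_snd (β := fun x => spaceBump m (((k : ℝ) + 1)⁻¹ • x))
      ((timeBump hb k).contDiff.differentiable one_ne_zero)
      (((spaceBump m).contDiff.comp (contDiff_const_smul _)).differentiable one_ne_zero)
      i z).trans ?_
    rw [fderiv_comp_smul]
    simp
  have hderiv :
      |fderiv ℝ (spaceBump m) (((k : ℝ) + 1)⁻¹ • z.2) (EuclideanSpace.single i 1)| ≤ D := by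
    simpa using ContinuousLinearMap.le_of_opNorm_le _ (hD (((k : ℝ) + 1)⁻¹ • z.2))
      (EuclideanSpace.single i (1 : ℝ))
  rw [hdx, abs_mul, abs_mul, abs_of_nonneg (timeBump hb k).nonneg,
    abs_of_pos (by positivity : (0 : ℝ) < ((k : ℝ) + 1)⁻¹), div_eq_inv_mul]
  refine (mul_le_of_le_one_left (by positivity) (timeBump hb k).le_one).trans ?_
  gcongr

lemma eventually_cutoff_eq_one (hb : StrictMono b) {z : ℝ × Sp m}
    (hz : ∀ᶠ k in atTop, z.1 < b k) : ∀ᶠ k in atTop, cutoff m hb k z = 1 := by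
  filter_upwards [hz, eventually_ge_atTop ⌈b 0 - z.1⌉₊, eventually_ge_atTop ⌈‖z.2‖⌉₊]
    with k hbk htime hspace
  rw [Nat.ceil_le] at htime hspace
  have htime_one : timeBump hb k z.1 = 1 := by
    refine (timeBump hb k).one_of_mem_closedBall ?_
    rw [Metric.mem_closedBall, Real.dist_eq, abs_le]
    simp only [timeBump, timeCenter]
    constructor <;> linarith
  have hspace_one : spaceBump m (((k : ℝ) + 1)⁻¹ • z.2) = 1 := by
    refine (spaceBump m).one_of_mem_closedBall ?_
    rw [mem_closedBall_zero_iff, norm_smul, norm_inv, Real.norm_of_nonneg (by positivity)]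
    exact inv_mul_le_one_of_le₀ (by linarith) (by positivity)
  rw [cutoff, htime_one, hspace_one, one_mul]

lemma continuous_jet {φ : ℝ × Sp m → Val n} (hφ : ContDiff ℝ 1 φ) : Continuous (jet φ) := by
  refine (PiLp.continuous_toLp 2 _).comp (continuous_pi fun o => ?_)
  cases o with
  | none => exact hφ.continuous
  | some i => exact (hφ.continuous_fderiv one_ne_zero).clm_apply continuous_const

lemma norm_jet_smul_sub_le {χ : ℝ × Sp m → ℝ} {φ : ℝ × Sp m → Val n} {z : ℝ × Sp m} {D : ℝ}
    (hχ : DifferentiableAt ℝ χ z) (hφ : DifferentiableAt ℝ φ z) (hD : ∀ i, |dx i χ z| ≤ D) :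
    ‖jet (fun z => χ z • φ z) z - jet φ z‖ ≤ (|χ z - 1| + (m + 1) * D) * ‖jet φ z‖ := by
  have hD₀ : 0 ≤ D := (abs_nonneg _).trans (hD 0)
  set r : Jet m n := mkJet (fun _ => 0) (fun i z => dx i χ z • φ z) z
  have hleibniz : jet (fun z => χ z • φ z) z - jet φ z = (χ z - 1) • jet φ z + r := by
    ext1 o
    cases o with
    | none => simp [r, sub_smul]
    | some i =>
      have hdx : dx i (fun z => χ z • φ z) z = χ z • dx i φ z + dx i χ z • φ z := by
        rw [dx, fderiv_fun_smul hχ hφ]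
        simp [dx]
      simp only [PiLp.sub_apply, PiLp.add_apply, PiLp.smul_apply, jet_some, mkJet_some, r, hdx,
        sub_smul, one_smul]
      abel
  have hr : ‖r‖ ≤ (m + 1) * D * ‖φ z‖ := by
    refine le_of_sq_le_sq ?_ (by positivity)
    rw [norm_sq_jet]
    simp only [r, mkJet_some, mkJet_none, norm_zero, ne_eq, OfNat.ofNat_ne_zero,
      not_false_eq_true, zero_pow, add_zero, norm_smul, Real.norm_eq_abs]
    calc ∑ i, (|dx i χ z| * ‖φ z‖) ^ 2 ≤ ∑ _i : Fin (m + 1), (D * ‖φ z‖) ^ 2 := by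
          gcongr with i
          exact hD i
      _ = (m + 1) * (D * ‖φ z‖) ^ 2 := by simp
      _ ≤ (m + 1) ^ 2 * (D * ‖φ z‖) ^ 2 := by
          gcongr
          exact le_self_pow₀ (by linarith [(Nat.cast_nonneg m : (0 : ℝ) ≤ m)]) two_ne_zero
      _ = ((m + 1) * D * ‖φ z‖) ^ 2 := by ring
  have hφjet : ‖φ z‖ ≤ ‖jet φ z‖ := PiLp.norm_apply_le (jet φ z) none
  rw [hleibniz, add_mul]
  refine norm_add_le_of_le (norm_smul_le _ _) (hr.trans ?_)
  gcongr

lemma tendsto_eLpNorm_jet_cutoff_smul_sub (hb : StrictMono b) (hbT : ∀ k, b k ∈ timeRay T)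
    (hlim : ∀ t ∈ timeRay T, ∀ᶠ k in atTop, t < b k) {φ : ℝ × Sp m → Val n}
    (hφ : ContDiff ℝ ∞ φ) (hφ₂ : MemLp (jet φ) 2 (muCyl m α T)) :
    Tendsto (fun k => eLpNorm (jet (fun z => cutoff m hb k z • φ z) - jet φ) 2 (muCyl m α T))
      atTop (𝓝 0) := by
  obtain ⟨D, hD⟩ := exists_abs_dx_cutoff_le m hb
  have hD₀ : 0 ≤ D := by simpa using (abs_nonneg _).trans (hD 0 0 0)
  have hφ₁ : ContDiff ℝ 1 φ := hφ.of_le (by simp)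
  have hχ : ∀ k, ContDiff ℝ 1 (cutoff m hb k) := fun k =>
    (isTest_cutoff hb hbT k).1.of_le (by simp)
  have hle : ∀ k z, ‖(jet (fun z => cutoff m hb k z • φ z) - jet φ) z‖
      ≤ (|cutoff m hb k z - 1| + (m + 1) * (D / (k + 1))) * ‖jet φ z‖ := fun k z =>
    norm_jet_smul_sub_le ((hχ k).differentiable one_ne_zero z) (hφ₁.differentiable one_ne_zero z)
      fun i => hD k i z
  refine tendsto_eLpNorm_two_zero_of_dominated
    (bound := fun z => (1 + (m + 1) * D) * ‖jet φ z‖)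
    (fun k => ((continuous_jet ((hχ k).smul hφ₁)).sub (continuous_jet hφ₁)).aestronglyMeasurable)
    (hφ₂.norm.const_mul _) (.of_forall fun k => .of_forall fun z => (hle k z).trans ?_) ?_
  · have hχ₀ := cutoff_nonneg hb k z
    have hχ₁ := cutoff_le_one hb k z
    gcongr
    · rw [abs_le]
      constructor <;> linarith
    · exact div_le_self hD₀ (by linarith [(Nat.cast_nonneg k : (0 : ℝ) ≤ k)])
  · filter_upwards [ae_mem_cyl m α T] with z hz
    refine squeeze_zero_norm (fun k => hle k z) ?_
    have hone : Tendsto (fun k => |cutoff m hb k z - 1|) atTop (𝓝 0) := by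
      refine tendsto_const_nhds.congr' ?_
      filter_upwards [eventually_cutoff_eq_one hb (hlim z.1 hz.1)] with k hk
      rw [hk, sub_self, abs_zero]
    have hderiv : Tendsto (fun k : ℕ => D / ((k : ℝ) + 1)) atTop (𝓝 0) :=
      tendsto_const_nhds.div_atTop (tendsto_natCast_atTop_atTop.atTop_add tendsto_const_nhds)
    simpa using (hone.add (hderiv.const_mul ((m : ℝ) + 1))).mul_const ‖jet φ z‖

end Cutoff

section Density

variable {m n : ℕ} {α : ℝ} {T : EReal}

lemma HasWeakGrad.congr {u v : ℝ × Sp m → Val n} {Du Dv : Fin (m + 1) → ℝ × Sp m → Val n}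
    (h : HasWeakGrad T u Du) (huv : u =ᵐ[volume.restrict (cyl m T)] v)
    (hDuv : ∀ i, Du i =ᵐ[volume.restrict (cyl m T)] Dv i) : HasWeakGrad T v Dv := by
  intro i ψ hψ
  rw [← integral_congr_ae (huv.mono fun z hz => congrArg (dx i ψ z • ·) hz),
    ← integral_congr_ae ((hDuv i).mono fun z hz => congrArg (ψ z • ·) hz)]
  exact h i ψ hψ

lemma exists_test_eLpNorm_sub_le_of_contDiff (hT : ⊥ < T) {φ : ℝ × Sp m → Val n}
    (hφ : ContDiff ℝ ∞ φ) (hφ₂ : MemLp (jet φ) 2 (muCyl m α T)) {δ : ℝ≥0∞} (hδ : 0 < δ) :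
    ∃ ψ : ℝ × Sp m → Val n, IsTest (timeRay T ×ˢ univ) ψ ∧
      eLpNorm (jet ψ - jet φ) 2 (muCyl m α T) ≤ δ := by
  obtain ⟨b, hb, hbT, hlim⟩ := exists_strictMono_seq_timeRay hT
  obtain ⟨k, hk⟩ := (ENNReal.tendsto_nhds_zero.1
    (tendsto_eLpNorm_jet_cutoff_smul_sub hb hbT hlim hφ hφ₂) δ hδ).exists
  exact ⟨_, (isTest_cutoff hb hbT k).smul hφ, hk⟩

variable [IsLocallyFiniteMeasure (muCyl m α ⊤)]

lemma exists_test_eLpNorm_sub_le (hT : ⊥ < T) {w : ℝ × Sp m → Jet m n}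
    (hw : MemLp w 2 (muCyl m α T))
    (hgrad : HasWeakGrad T (fun z => w z none) fun i z => w z (some i)) {δ : ℝ≥0∞} (hδ : δ ≠ 0) :
    ∃ φ : ℝ × Sp m → Val n, IsTest (timeRay T ×ˢ univ) φ ∧
      eLpNorm (jet φ - w) 2 (muCyl m α T) ≤ δ := by
  obtain ⟨w', hw'm, hww'⟩ := hw.1
  have hw' : MemLp w' 2 (muCyl m α T) := hw.ae_eq hww'
  have hae : w =ᵐ[volume.restrict (cyl m T)] w' :=
    (volume_absolutelyContinuous_muCyl m α T).ae_le hww'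
  have hgrad' : HasWeakGrad T (fun z => w' z none) fun i z => w' z (some i) :=
    hgrad.congr (hae.mono fun z hz => congrArg (· none) hz)
      fun i => hae.mono fun z hz => congrArg (· (some i)) hz
  have hδ₂ : 0 < δ / 2 := ENNReal.half_pos hδ
  obtain ⟨ε, hεw, hε⟩ := ((ENNReal.tendsto_nhds_zero.1
    (tendsto_eLpNorm_mollify_sub hw'm hw') _ hδ₂).and eventually_mem_nhdsWithin).exists
  obtain ⟨φ, hφ, hφw⟩ := exists_jet_eq_mollify hw'm hw' hgrad' hε
  have hmollify : MemLp (mollify ε w') 2 (muCyl m α T) :=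
    ⟨(stronglyMeasurable_mollify hw'm ε).aestronglyMeasurable,
      (eLpNorm_mollify_le hw'm hε).trans_lt (ENNReal.mul_lt_top
        (ENNReal.rpow_lt_top_of_nonneg (by norm_num) mollifyConst_ne_top) hw'.2)⟩
  have hφ₂ : MemLp (jet φ) 2 (muCyl m α T) := hmollify.ae_eq hφw.symm
  obtain ⟨ψ, hψ, hψφ⟩ := exists_test_eLpNorm_sub_le_of_contDiff hT hφ hφ₂ hδ₂
  refine ⟨ψ, hψ, ?_⟩
  calc eLpNorm (jet ψ - w) 2 (muCyl m α T)
      = eLpNorm ((jet ψ - jet φ) + (jet φ - w)) 2 (muCyl m α T) := by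
        rw [sub_add_sub_cancel]
    _ ≤ eLpNorm (jet ψ - jet φ) 2 (muCyl m α T) + eLpNorm (jet φ - w) 2 (muCyl m α T) :=
        eLpNorm_add_le ((hψ.memLp_jet _).1.sub hφ₂.1) (hφ₂.1.sub hw.1) one_le_two
    _ ≤ δ / 2 + δ / 2 := by
        rw [eLpNorm_congr_ae (hφw.sub hww')]
        exact add_le_add hψφ hεw
    _ = δ := ENNReal.add_halves δ

lemma IsTest.extendZero_jet {φ : ℝ × Sp m → Val n} (hφ : IsTest (timeRay T ×ˢ univ) φ) :
    extendZero T (jet φ) = jet φ :=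
  indicator_eq_self.2 fun z hz => by
    by_contra h
    exact hz (hφ.jet_eq_zero fun ht => h ⟨ht, mem_univ _⟩)

lemma toLp_extendZero_mem_closure (hT : ⊥ < T) {w : ℝ × Sp m → Jet m n}
    (hw : MemLp w 2 (muCyl m α T))
    (hgrad : HasWeakGrad T (fun z => w z none) fun i z => w z (some i)) :
    (memLp_extendZero hw).toLp _ ∈ closure (range (testJet m n α T)) := by
  rw [EMetric.mem_closure_iff]
  intro δ hδ
  obtain ⟨ρ, hρ, hρδ⟩ := exists_between hδ
  obtain ⟨φ, hφ, hφw⟩ := exists_test_eLpNorm_sub_le hT hw hgrad hρ.ne'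
  refine ⟨_, ⟨⟨φ, hφ⟩, rfl⟩, ?_⟩
  rw [testJet_apply, edist_comm, Lp.edist_toLp_toLp]
  refine lt_of_eq_of_lt ?_ (hφw.trans_lt hρδ)
  rw [muCyl_eq_restrict m α T,
    ← eLpNorm_indicator_eq_eLpNorm_restrict (measurableSet_timeRay_prod_univ m T), indicator_sub']
  exact congrArg (fun v => eLpNorm (v - _) 2 _) hφ.extendZero_jet.symm

end Density

/-! ### Matrix fields -/

section Matrices

variable {n : ℕ} (M : Matrix (Fin n) (Fin n) ℝ) (v w : Val n)

lemma mdot_eq_inner : mdot M v w = inner ℝ (M.toEuclideanLin v) w := by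
  rw [EuclideanSpace.inner_eq_star_dotProduct, mdot, dotProduct_comm]
  simp

lemma mdot_zero_right : mdot M v 0 = 0 := by
  rw [mdot_eq_inner, inner_zero_right]

lemma mdot_comm (h : Mᵀ = M) : mdot M v w = mdot M w v := by
  rw [mdot, mdot, ← Matrix.vecMul_transpose, h, ← Matrix.dotProduct_mulVec, dotProduct_comm]

lemma norm_toEuclideanLin_le : ‖M.toEuclideanLin v‖ ≤ matAbs M * ‖v‖ := by
  rw [EuclideanSpace.norm_eq, EuclideanSpace.norm_eq, matAbs, ← Real.sqrt_mul (by positivity),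
    Finset.sum_mul]
  refine Real.sqrt_le_sqrt (Finset.sum_le_sum fun k _ => ?_)
  simp only [Matrix.toLpLin_apply, Matrix.mulVec, dotProduct, Real.norm_eq_abs, sq_abs]
  exact Finset.sum_mul_sq_le_sq_mul_sq _ _ _

end Matrices

section MatrixFields

variable {X : Type*} [MeasurableSpace X] {μ : Measure X} {n : ℕ} {K : ℝ}
  {M : X → Matrix (Fin n) (Fin n) ℝ} {u : X → Val n}

lemma aestronglyMeasurable_toEuclideanLin (hM : ∀ k l, AEMeasurable (fun x => M x k l) μ)
    (hu : AEStronglyMeasurable u μ) :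
    AEStronglyMeasurable (fun x => (M x).toEuclideanLin (u x)) μ := by
  refine (PiLp.continuous_toLp 2 _).comp_aestronglyMeasurable
    (AEMeasurable.aestronglyMeasurable (aemeasurable_pi_lambda _ fun k => ?_))
  change AEMeasurable (fun x => ∑ l, M x k l * u x l) μ
  refine Finset.aemeasurable_fun_sum _ fun l _ => (hM k l).mul ?_
  have : Continuous fun v : Val n => v l := by fun_prop
  exact (this.comp_aestronglyMeasurable hu).aemeasurable

lemma memLp_toEuclideanLin (hM : ∀ k l, AEMeasurable (fun x => M x k l) μ)
    (hK : ∀ᵐ x ∂μ, matAbs (M x) ≤ K) {p : ℝ≥0∞} (hu : MemLp u p μ) :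
    MemLp (fun x => (M x).toEuclideanLin (u x)) p μ := by
  refine MemLp.of_le_mul hu (aestronglyMeasurable_toEuclideanLin hM hu.1) (c := K) ?_
  filter_upwards [hK] with x hx
  exact (norm_toEuclideanLin_le _ _).trans (by gcongr)

end MatrixFields

/-- A time-independent coefficient matrix that is measurable, bounded, symmetric and positive
definite with constant `κ`, up to null sets of the weighted measure. -/
structure SymCoeff {m n : ℕ} (α κ : ℝ) (a₀ : Sp m → Matrix (Fin n) (Fin n) ℝ) : Prop where
  meas : ∀ k l, AEMeasurable (fun x => a₀ x k l) (muSpace m α)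
  posdef : ∀ᵐ x ∂(muSpace m α), ∀ ξ : Val n, κ * ‖ξ‖ ^ 2 ≤ mdot (a₀ x) ξ ξ
  bounded : ∀ᵐ x ∂(muSpace m α), matAbs (a₀ x) ≤ κ⁻¹
  symm : ∀ᵐ x ∂(muSpace m α), (a₀ x)ᵀ = a₀ x

/-- The increment `u(t, x) - u(t + s, x)` over the time step `s`. -/
def timeIncrement {m n : ℕ} (s : ℝ) (u : ℝ × Sp m → Val n) (z : ℝ × Sp m) : Val n :=
  u z - u (timeShift m s z)

/-- The energy `∫ a₀ u · u dμ` over all times. -/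
def energy {m n : ℕ} (α : ℝ) (a₀ : Sp m → Matrix (Fin n) (Fin n) ℝ) (u : ℝ × Sp m → Val n) : ℝ :=
  ∫ z, mdot (a₀ z.2) (u z) (u z) ∂(muCyl m α ⊤)

section SymCoeff

variable {m n : ℕ} {α κ : ℝ} {T : EReal} {a₀ : Sp m → Matrix (Fin n) (Fin n) ℝ}
  {u v : ℝ × Sp m → Val n}

lemma NondegCoeff.symCoeff (h : NondegCoeff κ (halfSpace m) a₀)
    (hs : ∀ᵐ x ∂(volume.restrict (halfSpace m)), (a₀ x)ᵀ = a₀ x) : SymCoeff α κ a₀ where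
  meas k l := (h.meas k l).mono_ac (muSpace_absolutelyContinuous m α)
  posdef := (muSpace_absolutelyContinuous m α).ae_le h.posdef
  bounded := (muSpace_absolutelyContinuous m α).ae_le h.bounded
  symm := (muSpace_absolutelyContinuous m α).ae_le hs

lemma SymCoeff.meas_cyl (h : SymCoeff α κ a₀) (k l : Fin n) :
    AEMeasurable (fun z : ℝ × Sp m => a₀ z.2 k l) (muCyl m α T) :=
  (h.meas k l).comp_quasiMeasurePreserving (quasiMeasurePreserving_snd m α T)

lemma SymCoeff.bounded_cyl (h : SymCoeff α κ a₀) :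
    ∀ᵐ z ∂(muCyl m α T), matAbs (a₀ z.2) ≤ κ⁻¹ :=
  (quasiMeasurePreserving_snd m α T).ae h.bounded

lemma SymCoeff.symm_cyl (h : SymCoeff α κ a₀) : ∀ᵐ z ∂(muCyl m α T), (a₀ z.2)ᵀ = a₀ z.2 :=
  (quasiMeasurePreserving_snd m α T).ae h.symm

lemma SymCoeff.mdot_nonneg_cyl (h : SymCoeff α κ a₀) (hκ : 0 ≤ κ) :
    ∀ᵐ z ∂(muCyl m α T), ∀ ξ : Val n, 0 ≤ mdot (a₀ z.2) ξ ξ := by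
  filter_upwards [(quasiMeasurePreserving_snd m α T).ae h.posdef] with z hz ξ
  exact le_trans (by positivity) (hz ξ)

lemma SymCoeff.memLp_toEuclideanLin (h : SymCoeff α κ a₀) (hu : MemLp u 2 (muCyl m α T)) :
    MemLp (fun z => (a₀ z.2).toEuclideanLin (u z)) 2 (muCyl m α T) :=
  WeightedParabolic.memLp_toEuclideanLin h.meas_cyl h.bounded_cyl hu

lemma SymCoeff.integrable_mdot (h : SymCoeff α κ a₀) (hu : MemLp u 2 (muCyl m α T))
    (hv : MemLp v 2 (muCyl m α T)) :
    Integrable (fun z => mdot (a₀ z.2) (u z) (v z)) (muCyl m α T) := by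
  simp_rw [mdot_eq_inner]
  exact integrable_inner_of_memLp (h.memLp_toEuclideanLin hu) hv

lemma memLp_timeIncrement (hu : MemLp u 2 (muCyl m α ⊤)) (s : ℝ) :
    MemLp (timeIncrement s u) 2 (muCyl m α ⊤) :=
  hu.sub (hu.comp_measurePreserving (measurePreserving_timeShift α s))

lemma energy_timeIncrement_zero (α : ℝ) (a₀ : Sp m → Matrix (Fin n) (Fin n) ℝ)
    (u : ℝ × Sp m → Val n) : energy α a₀ (timeIncrement 0 u) = 0 := by
  simp [energy, timeIncrement, mdot_zero_right]

lemma energy_comp_timeShift (α : ℝ) (a₀ : Sp m → Matrix (Fin n) (Fin n) ℝ)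
    (u : ℝ × Sp m → Val n) (s : ℝ) :
    energy α a₀ (fun z => u (timeShift m s z)) = energy α a₀ u :=
  (measurePreserving_timeShift α s).integral_comp (measurableEmbedding_timeShift s)
    fun z => mdot (a₀ z.2) (u z) (u z)

lemma SymCoeff.energy_nonneg (h : SymCoeff α κ a₀) (hκ : 0 ≤ κ) (u : ℝ × Sp m → Val n) :
    0 ≤ energy α a₀ u := by
  refine integral_nonneg_of_ae ?_
  filter_upwards [h.mdot_nonneg_cyl hκ] with z hz
  exact hz _

lemma SymCoeff.energy_timeIncrement (h : SymCoeff α κ a₀) (hu : MemLp u 2 (muCyl m α ⊤)) (s : ℝ) :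
    energy α a₀ (timeIncrement s u) = 2 * (energy α a₀ u
      - ∫ z, mdot (a₀ z.2) (u z) (u (timeShift m s z)) ∂(muCyl m α ⊤)) := by
  have hus : MemLp (fun z => u (timeShift m s z)) 2 (muCyl m α ⊤) :=
    hu.comp_measurePreserving (measurePreserving_timeShift α s)
  have hexpand : energy α a₀ (timeIncrement s u)
      = ∫ z, (mdot (a₀ z.2) (u z) (u z) + mdot (a₀ z.2) (u (timeShift m s z)) (u (timeShift m s z))
        - 2 * mdot (a₀ z.2) (u z) (u (timeShift m s z))) ∂(muCyl m α ⊤) := by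
    refine integral_congr_ae ?_
    filter_upwards [h.symm_cyl] with z hz
    have hcomm := mdot_comm _ (u z) (u (timeShift m s z)) hz
    simp only [timeIncrement, mdot_eq_inner, map_sub, inner_sub_left, inner_sub_right] at hcomm ⊢
    linarith
  have hdiag : Integrable (fun z => mdot (a₀ z.2) (u z) (u z)
      + mdot (a₀ z.2) (u (timeShift m s z)) (u (timeShift m s z))) (muCyl m α ⊤) :=
    (h.integrable_mdot hu hu).add (h.integrable_mdot hus hus)
  rw [hexpand, integral_sub hdiag ((h.integrable_mdot hu hus).const_mul 2),
    integral_add (h.integrable_mdot hu hu) (h.integrable_mdot hus hus), integral_const_mul]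
  change energy α a₀ u + energy α a₀ (fun z => u (timeShift m s z)) - _ = _
  rw [energy_comp_timeShift]
  ring

end SymCoeff

/-! ### The energy inequality -/

/-- The jet field `w = (u, Du)` is square integrable on `Ω_T`, `Du` is the weak gradient of `u`, and
`L ∈ L_2` represents the distribution `x_d^α a_0 u_t`. -/
structure EnergyData {m n : ℕ} (α : ℝ) (T : EReal) (a₀ : Sp m → Matrix (Fin n) (Fin n) ℝ)
    (w L : ℝ × Sp m → Jet m n) : Prop where
  memLp : MemLp w 2 (muCyl m α T)
  memLp_source : MemLp L 2 (muCyl m α T)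
  weakGrad : HasWeakGrad T (fun z => w z none) fun i z => w z (some i)
  timeDeriv : HasTimeDeriv α T (fun z => (a₀ z.2).toEuclideanLin (w z none)) L

lemma le_of_hasDerivWithinAt_of_le {f g : ℝ → ℝ} {a b x : ℝ} (hf : HasDerivWithinAt f a (Ici x) x)
    (hg : HasDerivWithinAt g b (Ici x) x) (hx : f x = g x) (hfg : ∀ y > x, f y ≤ g y) :
    a ≤ b := by
  have hf' := (hasDerivWithinAt_iff_tendsto_slope' self_notMem_Ioi).1 (hf.mono Ioi_subset_Ici_self)
  have hg' := (hasDerivWithinAt_iff_tendsto_slope' self_notMem_Ioi).1 (hg.mono Ioi_subset_Ici_self)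
  refine le_of_tendsto_of_tendsto hf' hg' ?_
  filter_upwards [self_mem_nhdsWithin] with y hy
  have hxy : 0 < y - x := sub_pos.2 hy
  simp only [slope_def_field, hx]
  gcongr
  exact hfg y hy

lemma hasDerivWithinAt_integral_sub_const {f : ℝ → ℝ} {τ : ℝ}
    (hf : HasDerivAt (fun x => ∫ t in τ..x, f t) (f τ) τ) :
    HasDerivWithinAt (fun h => ∫ t in (τ - h)..τ, f t) (f τ) (Ici 0) 0 := by
  have hsub : HasDerivAt (fun h : ℝ => τ - h) (-1) 0 := by
    simpa using (hasDerivAt_id (0 : ℝ)).const_sub τ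
  have hcomp : HasDerivAt (fun h : ℝ => ∫ t in τ..(τ - h), f t) (f τ * -1) 0 :=
    HasDerivAt.comp (h₂ := fun x => ∫ t in τ..x, f t) (h := fun h : ℝ => τ - h) 0
      (by simpa using hf) hsub
  simp_rw [fun h : ℝ => intervalIntegral.integral_symm (f := f) (μ := volume) τ (τ - h)]
  simpa using hcomp.fun_neg.hasDerivWithinAt

section Energy

variable {m n : ℕ} {α κ : ℝ} {S T : EReal} {a₀ : Sp m → Matrix (Fin n) (Fin n) ℝ}
  {w L : ℝ × Sp m → Jet m n}

lemma HasTimeDeriv.congr {b b' : ℝ × Sp m → Val n} {L' : ℝ × Sp m → Jet m n}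
    (h : HasTimeDeriv α T b L) (hb : b =ᵐ[muCyl m α T] b') (hL : L =ᵐ[muCyl m α T] L') :
    HasTimeDeriv α T b' L' := by
  intro φ hφ
  have hleft : ∫ z, inner ℝ (b z) (dt φ z) ∂(muCyl m α T)
      = ∫ z, inner ℝ (b' z) (dt φ z) ∂(muCyl m α T) :=
    integral_congr_ae (hb.mono fun z hz => by simp only [hz])
  have hright : ∫ z, inner ℝ (L z) (jet φ z) ∂(muCyl m α T)
      = ∫ z, inner ℝ (L' z) (jet φ z) ∂(muCyl m α T) :=
    integral_congr_ae (hL.mono fun z hz => by simp only [hz])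
  rw [← hleft, ← hright, h φ hφ]

lemma HasTimeDeriv.mono {b : ℝ × Sp m → Val n} (h : HasTimeDeriv α T b L) (hST : S ≤ T) :
    HasTimeDeriv α S b L := by
  intro φ hφ
  have hT := h φ (hφ.mono (prod_mono (timeRay_mono hST) subset_rfl))
  rwa [integral_muCyl_of_le hST fun z hz => by rw [hφ.dt_eq_zero hz, inner_zero_right],
    integral_muCyl_of_le hST fun z hz => by rw [hφ.jet_eq_zero hz, inner_zero_right]] at hT

lemma HasWeakGrad.mono {u : ℝ × Sp m → Val n} {Du : Fin (m + 1) → ℝ × Sp m → Val n}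
    (h : HasWeakGrad T u Du) (hST : S ≤ T) : HasWeakGrad S u Du := by
  intro i ψ hψ
  have hT := h i ψ (hψ.mono (cyl_mono hST))
  have hmeas := (isOpen_cyl m T).measurableSet
  rwa [← setIntegral_eq_of_subset_of_forall_sdiff_eq_zero hmeas (cyl_mono hST)
      fun z hz => by rw [hψ.dx_eq_zero i hz.2, zero_smul],
    ← setIntegral_eq_of_subset_of_forall_sdiff_eq_zero hmeas (cyl_mono hST)
      fun z hz => by rw [hψ.eq_zero_of_notMem hz.2, zero_smul]]

lemma EnergyData.mono (hd : EnergyData α T a₀ w L) (hST : S ≤ T) : EnergyData α S a₀ w L where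
  memLp := hd.memLp.mono_measure (muCyl_mono hST)
  memLp_source := hd.memLp_source.mono_measure (muCyl_mono hST)
  weakGrad := hd.weakGrad.mono hST
  timeDeriv := hd.timeDeriv.mono hST

lemma memLp_extendZero_none (hw : MemLp w 2 (muCyl m α T)) :
    MemLp (extendZero T fun z => w z none) 2 (muCyl m α ⊤) :=
  memLp_extendZero (MemLp.eval_piLp hw none)

lemma extendZero_extendZero (hST : S ≤ T) (u : ℝ × Sp m → Val n) :
    extendZero S (extendZero T u) = extendZero S u := by
  rw [extendZero, extendZero, extendZero, indicator_indicator,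
    inter_eq_self_of_subset_left (prod_mono_left (timeRay_mono hST))]

/-- A field vanishing after time `τ` loses all of its values on `(τ - h, τ)` when translated by
`h`, so its increment has at least the energy of that slab. -/
lemma SymCoeff.integral_slab_le_energy (ha : SymCoeff α κ a₀) (hκ : 0 ≤ κ)
    {u : ℝ × Sp m → Val n} (hu : MemLp u 2 (muCyl m α ⊤)) (τ : ℝ) {h : ℝ} (hh : 0 ≤ h) :
    ∫ t in (τ - h)..τ, ∫ x, mdot (a₀ x) (u (t, x)) (u (t, x)) ∂(muSpace m α)
      ≤ energy α a₀ (timeIncrement h (extendZero τ u)) := by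
  set v : ℝ × Sp m → Val n := extendZero τ u
  have hv : MemLp v 2 (muCyl m α ⊤) := memLp_extendZero (hu.mono_measure (muCyl_mono le_top))
  have hint : Integrable (fun z : ℝ × Sp m => mdot (a₀ z.2) (u z) (u z))
      (volume.prod (muSpace m α)) := by
    rw [← muCyl_top]
    exact ha.integrable_mdot hu hu
  have hslab : ∀ z ∈ Ioo (τ - h) τ ×ˢ (univ : Set (Sp m)), timeIncrement h v z = u z := by
    intro z hz
    have hz1 : τ - h < z.1 ∧ z.1 < τ := hz.1
    have hzero : v (timeShift m h z) = 0 := extendZero_of_notMem (by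
      simp only [timeShift, timeRay_coe, mem_Iio, not_lt]
      linarith)
    rw [timeIncrement, hzero, sub_zero]
    exact extendZero_of_mem (by simpa using hz1.2)
  calc ∫ t in (τ - h)..τ, ∫ x, mdot (a₀ x) (u (t, x)) (u (t, x)) ∂(muSpace m α)
      = ∫ z in Ioo (τ - h) τ ×ˢ univ, mdot (a₀ z.2) (u z) (u z) ∂(muCyl m α ⊤) := by
        rw [intervalIntegral.integral_of_le (by linarith), integral_Ioc_eq_integral_Ioo, muCyl_top,
          setIntegral_prod _ hint.integrableOn]
        simp
    _ = ∫ z in Ioo (τ - h) τ ×ˢ univ, mdot (a₀ z.2) (timeIncrement h v z) (timeIncrement h v z)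
          ∂(muCyl m α ⊤) :=
        setIntegral_congr_fun (measurableSet_Ioo.prod .univ) fun z hz => by
          simp only [hslab z hz]
    _ ≤ energy α a₀ (timeIncrement h v) := by
        refine setIntegral_le_integral
          (ha.integrable_mdot (memLp_timeIncrement hv h) (memLp_timeIncrement hv h)) ?_
        filter_upwards [ha.mdot_nonneg_cyl hκ] with z hz
        exact hz _

variable [IsLocallyFiniteMeasure (muCyl m α ⊤)]

lemma EnergyData.hasDerivWithinAt_integral_timeShift (hd : EnergyData α T a₀ w L)
    (ha : SymCoeff α κ a₀) (hT : ⊥ < T) :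
    HasDerivWithinAt (fun s => ∫ z, mdot (a₀ z.2) (extendZero T (fun z => w z none) z)
        (extendZero T (fun z => w z none) (timeShift m s z)) ∂(muCyl m α ⊤))
      (- ∫ z, inner ℝ (L z) (w z) ∂(muCyl m α T)) (Ici 0) 0 := by
  set u : ℝ × Sp m → Val n := extendZero T fun z => w z none with hu_def
  have hb := ha.memLp_toEuclideanLin (memLp_extendZero_none hd.memLp)
  have hL := memLp_extendZero hd.memLp_source
  have hw := memLp_extendZero hd.memLp
  have hbL : HasTimeDeriv α T (fun z => (a₀ z.2).toEuclideanLin (u z)) (extendZero T L) := by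
    refine hd.timeDeriv.congr ?_ (extendZero_ae_eq L).symm
    filter_upwards [extendZero_ae_eq (α := α) (T := T) fun z => w z none] with z hz
    rw [hu_def, hz]
  have hLw : ∫ z, inner ℝ (L z) (extendZero T w z) ∂(muCyl m α T)
      = ∫ z, inner ℝ (L z) (w z) ∂(muCyl m α T) := by
    refine integral_congr_ae ?_
    filter_upwards [extendZero_ae_eq (α := α) (T := T) w] with z hz
    rw [hz]
  have huw : u = fun z => extendZero T w z none :=
    extendZero_comp (g := fun v : Jet m n => v none) rfl w
  have hderiv := hasDerivWithinAt_inner_shiftL2 hb hL hbL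
    (toLp_extendZero_mem_closure hT hd.memLp hd.weakGrad)
  rw [inner_toLp, integral_inner_extendZero, hLw] at hderiv
  have hfun (s : ℝ) : ∫ z, mdot (a₀ z.2) (u z) (u (timeShift m s z)) ∂(muCyl m α ⊤)
      = inner ℝ ((memLp_liftJet hb).toLp _) (shiftL2 m n α s (hw.toLp _)) := by
    rw [shiftL2_toLp, inner_toLp]
    simp only [inner_liftJet, mdot_eq_inner, Function.comp_apply, ← hu_def, huw]
  simpa only [hfun] using hderiv

lemma EnergyData.hasDerivWithinAt_energy_timeIncrement (hd : EnergyData α T a₀ w L)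
    (ha : SymCoeff α κ a₀) (hT : ⊥ < T) :
    HasDerivWithinAt
      (fun s => energy α a₀ (timeIncrement s (extendZero T fun z => w z none)))
      (2 * ∫ z, inner ℝ (L z) (w z) ∂(muCyl m α T)) (Ici 0) 0 := by
  simp_rw [ha.energy_timeIncrement (memLp_extendZero_none hd.memLp)]
  simpa using ((hd.hasDerivWithinAt_integral_timeShift ha hT).const_sub _).const_mul 2

theorem EnergyData.integral_inner_nonneg (hd : EnergyData α T a₀ w L) (ha : SymCoeff α κ a₀)
    (hκ : 0 ≤ κ) (hT : ⊥ < T) : 0 ≤ ∫ z, inner ℝ (L z) (w z) ∂(muCyl m α T) := by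
  have h := le_of_hasDerivWithinAt_of_le (hasDerivWithinAt_const 0 (Ici 0) (0 : ℝ))
    (hd.hasDerivWithinAt_energy_timeIncrement ha hT) (energy_timeIncrement_zero ..).symm
    fun s _ => ha.energy_nonneg hκ _
  linarith

theorem EnergyData.ae_energy_le (hd : EnergyData α T a₀ w L) (ha : SymCoeff α κ a₀)
    (hκ : 0 ≤ κ) :
    ∀ᵐ τ : ℝ, τ ∈ timeRay T →
      ∫ x, mdot (a₀ x) (w (τ, x) none) (w (τ, x) none) ∂(muSpace m α)
        ≤ 2 * ∫ z, inner ℝ (L z) (w z) ∂(muCyl m α (τ : EReal)) := by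
  set u : ℝ × Sp m → Val n := extendZero T fun z => w z none
  have hu : MemLp u 2 (muCyl m α ⊤) := memLp_extendZero_none hd.memLp
  set Q : ℝ → ℝ := fun t => ∫ x, mdot (a₀ x) (u (t, x)) (u (t, x)) ∂(muSpace m α)
  have hQ : Integrable Q volume := by
    have := ha.integrable_mdot hu hu
    rw [muCyl_top] at this
    exact this.integral_prod_left
  filter_upwards [LocallyIntegrable.ae_hasDerivAt_integral hQ.locallyIntegrable] with τ hτ hτT
  have hτT' : (τ : EReal) ≤ T := le_of_lt hτT
  have hQτ : Q τ = ∫ x, mdot (a₀ x) (w (τ, x) none) (w (τ, x) none) ∂(muSpace m α) :=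
    integral_congr_ae (.of_forall fun x => by
      have hux : u (τ, x) = w (τ, x) none := extendZero_of_mem hτT
      simp only [hux])
  rw [← hQτ]
  refine le_of_hasDerivWithinAt_of_le (hasDerivWithinAt_integral_sub_const (hτ τ))
    ((hd.mono hτT').hasDerivWithinAt_energy_timeIncrement ha (EReal.bot_lt_coe τ)) ?_ fun h hh => ?_
  · rw [sub_zero, intervalIntegral.integral_same, energy_timeIncrement_zero]
  · rw [← extendZero_extendZero hτT']
    exact ha.integral_slab_le_energy hκ hu τ (le_of_lt hh)

end Energy

/-! ### Differences and time translates of energy data -/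

/-- The density of Lebesgue measure with respect to the weighted measure. -/
def invWeight (m : ℕ) (α : ℝ) (z : ℝ × Sp m) : ℝ := z.2 (Fin.last m) ^ (-α)

section LocalPairing

variable {m n : ℕ} {α : ℝ} {T : EReal} {E : Type*} [NormedAddCommGroup E] {g : ℝ × Sp m → ℝ}
  {y : ℝ × Sp m → E}

lemma measurable_ofReal_snd_last_rpow (m : ℕ) (α : ℝ) :
    Measurable fun z : ℝ × Sp m => ENNReal.ofReal (z.2 (Fin.last m) ^ α) :=
  (measurable_ofReal_last_rpow m α).comp measurable_snd

lemma toReal_ofReal_smul_invWeight_smul_ae_eq [NormedSpace ℝ E] (α : ℝ) (T : EReal)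
    (g : ℝ × Sp m → ℝ) (y : ℝ × Sp m → E) :
    (fun z : ℝ × Sp m => (ENNReal.ofReal (z.2 (Fin.last m) ^ α)).toReal •
      ((invWeight m α z * g z) • y z)) =ᵐ[volume.restrict (cyl m T)] fun z => g z • y z := by
  filter_upwards [ae_restrict_mem (isOpen_cyl m T).measurableSet] with z hz
  have hlast : 0 < z.2 (Fin.last m) := hz.2
  rw [ENNReal.toReal_ofReal (by positivity), smul_smul, invWeight, Real.rpow_neg hlast.le,
    mul_inv_cancel_left₀ (by positivity)]

lemma setIntegral_cyl_smul [NormedSpace ℝ E] (α : ℝ) (T : EReal) (g : ℝ × Sp m → ℝ)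
    (y : ℝ × Sp m → E) :
    ∫ z in cyl m T, g z • y z = ∫ z, (invWeight m α z * g z) • y z ∂(muCyl m α T) := by
  rw [muCyl, integral_withDensity_eq_integral_toReal_smul
    (measurable_ofReal_snd_last_rpow m α)
    (.of_forall fun _ => ENNReal.ofReal_lt_top)]
  exact (integral_congr_ae (toReal_ofReal_smul_invWeight_smul_ae_eq α T g y)).symm

variable [IsLocallyFiniteMeasure (muCyl m α ⊤)]

lemma memLp_invWeight_mul (hg : Continuous g) (hgc : HasCompactSupport g)
    (hgT : tsupport g ⊆ cyl m T) : MemLp (fun z => invWeight m α z * g z) 2 (muCyl m α T) := by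
  have hcont : ContinuousOn (fun z => invWeight m α z * g z) (tsupport g) := by
    refine ContinuousOn.mul (ContinuousOn.rpow_const (by fun_prop) fun z hz => Or.inl ?_)
      hg.continuousOn
    exact ne_of_gt (hgT hz).2
  have hmeas : Measurable fun z => invWeight m α z * g z := by
    have : Measurable fun z : ℝ × Sp m => z.2 (Fin.last m) := by fun_prop
    exact (this.pow_const _).mul hg.measurable
  obtain ⟨C, hC⟩ := hgc.isCompact.exists_bound_of_continuousOn hcont
  refine MemLp.of_le (memLp_indicator_const 2 hgc.isCompact.measurableSet C
    (Or.inr hgc.isCompact.measure_lt_top.ne)) hmeas.aestronglyMeasurable (.of_forall fun z => ?_)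
  by_cases hz : z ∈ tsupport g
  · rw [indicator_of_mem hz]
    exact (hC z hz).trans (le_abs_self C)
  · simp [image_eq_zero_of_notMem_tsupport hz]

lemma integrableOn_cyl_smul [NormedSpace ℝ E] (hg : Continuous g) (hgc : HasCompactSupport g)
    (hgT : tsupport g ⊆ cyl m T) (hy : MemLp y 2 (muCyl m α T)) :
    IntegrableOn (fun z => g z • y z) (cyl m T) := by
  have hint : Integrable (fun z => (invWeight m α z * g z) • y z) (muCyl m α T) :=
    memLp_one_iff_integrable.1 (hy.smul (memLp_invWeight_mul hg hgc hgT))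
  rw [muCyl, integrable_withDensity_iff_integrable_smul'
    (measurable_ofReal_snd_last_rpow m α)
    (.of_forall fun _ => ENNReal.ofReal_lt_top)] at hint
  exact hint.congr (toReal_ofReal_smul_invWeight_smul_ae_eq α T g y)

lemma IsTest.integrableOn_cyl_smul [NormedSpace ℝ E] (hg : IsTest (cyl m T) g)
    (hy : MemLp y 2 (muCyl m α T)) : IntegrableOn (fun z => g z • y z) (cyl m T) :=
  WeightedParabolic.integrableOn_cyl_smul hg.1.continuous hg.2.1 hg.2.2 hy

lemma IsTest.integrableOn_cyl_dx_smul [NormedSpace ℝ E] (hg : IsTest (cyl m T) g)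
    (i : Fin (m + 1)) (hy : MemLp y 2 (muCyl m α T)) :
    IntegrableOn (fun z => dx i g z • y z) (cyl m T) :=
  WeightedParabolic.integrableOn_cyl_smul (hg.continuous_fderiv_apply _) (hg.2.1.fderiv_apply ℝ _)
    ((tsupport_fderiv_apply_subset ℝ _).trans hg.2.2) hy

lemma HasWeakGrad.sub {u v : ℝ × Sp m → Val n} {Du Dv : Fin (m + 1) → ℝ × Sp m → Val n}
    (hu : HasWeakGrad T u Du) (hv : HasWeakGrad T v Dv)
    (hu₂ : MemLp u 2 (muCyl m α T)) (hv₂ : MemLp v 2 (muCyl m α T))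
    (hDu : ∀ i, MemLp (Du i) 2 (muCyl m α T)) (hDv : ∀ i, MemLp (Dv i) 2 (muCyl m α T)) :
    HasWeakGrad T (fun z => u z - v z) fun i z => Du i z - Dv i z := by
  intro i ψ hψ
  simp_rw [smul_sub]
  rw [integral_sub (hψ.integrableOn_cyl_dx_smul i hu₂) (hψ.integrableOn_cyl_dx_smul i hv₂),
    integral_sub (hψ.integrableOn_cyl_smul (hDu i)) (hψ.integrableOn_cyl_smul (hDv i)),
    hu i ψ hψ, hv i ψ hψ]
  abel

end LocalPairing

section Translates

variable {m n : ℕ} {α κ : ℝ} {T : EReal} {a₀ : Sp m → Matrix (Fin n) (Fin n) ℝ}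
  {w w' L L' : ℝ × Sp m → Jet m n} {b b' : ℝ × Sp m → Val n} {s : ℝ}

lemma memLp_comp_timeShift_neg {E : Type*} [NormedAddCommGroup E] {p : ℝ≥0∞} {f : ℝ × Sp m → E}
    (hs : 0 ≤ s) (hf : MemLp f p (muCyl m α T)) :
    MemLp (fun z => f (timeShift m (-s) z)) p (muCyl m α T) := by
  refine (((memLp_extendZero hf).comp_measurePreserving
    (measurePreserving_timeShift α (-s))).mono_measure (muCyl_mono le_top)).ae_eq ?_
  filter_upwards [ae_mem_cyl m α T] with z hz
  exact extendZero_of_mem (timeShift_neg_fst_mem hs hz.1)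

lemma IsTest.comp_timeShift_cyl {V : Type*} [NormedAddCommGroup V] [NormedSpace ℝ V]
    {ψ : ℝ × Sp m → V} (hψ : IsTest (cyl m T) ψ) (hs : 0 ≤ s) :
    IsTest (cyl m T) (ψ ∘ timeShift m s) := by
  obtain ⟨hsmooth, hcompact, hsupp⟩ :=
    (hψ.mono (prod_mono subset_rfl (subset_univ _))).comp_timeShift hs
  exact ⟨hsmooth, hcompact, fun z hz => ⟨(hsupp hz).1,
    (hψ.2.2 (tsupport_comp_subset_preimage ψ (contDiff_timeShift s).continuous hz)).2⟩⟩

lemma HasWeakGrad.comp_timeShift_neg {u : ℝ × Sp m → Val n}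
    {Du : Fin (m + 1) → ℝ × Sp m → Val n} (hu : HasWeakGrad T u Du) (hs : 0 ≤ s) :
    HasWeakGrad T (fun z => u (timeShift m (-s) z)) fun i z => Du i (timeShift m (-s) z) := by
  intro i ψ hψ
  have hψs := hψ.comp_timeShift_cyl hs
  have hu_s := hu i _ hψs
  rw [setIntegral_eq_integral_of_forall_compl_eq_zero fun z hz => by
      rw [hψs.dx_eq_zero i hz, zero_smul],
    setIntegral_eq_integral_of_forall_compl_eq_zero fun z hz => by
      rw [hψs.eq_zero_of_notMem hz, zero_smul]] at hu_s
  rw [setIntegral_eq_integral_of_forall_compl_eq_zero fun z hz => by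
      rw [hψ.dx_eq_zero i hz, zero_smul],
    setIntegral_eq_integral_of_forall_compl_eq_zero fun z hz => by
      rw [hψ.eq_zero_of_notMem hz, zero_smul],
    ← integral_add_right_eq_self _ ((s, 0) : ℝ × Sp m),
    ← integral_add_right_eq_self (fun z => ψ z • Du i (timeShift m (-s) z)) ((s, 0) : ℝ × Sp m)]
  simpa only [← timeShift_eq_add, timeShift_timeShift_neg, dx_comp_timeShift,
    Function.comp_apply] using hu_s

lemma HasTimeDeriv.comp_timeShift_neg (h : HasTimeDeriv α T b L) (hs : 0 ≤ s) :
    HasTimeDeriv α T (fun z => b (timeShift m (-s) z)) fun z => L (timeShift m (-s) z) := by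
  intro φ hφ
  have hφs := h.integral_top (hφ.comp_timeShift hs)
  rw [← integral_muCyl_of_le (S := T) le_top fun z hz => by
      rw [hφ.dt_eq_zero hz, inner_zero_right],
    ← integral_muCyl_of_le (S := T) le_top fun z hz => by rw [hφ.jet_eq_zero hz, inner_zero_right],
    ← (measurePreserving_timeShift α s).integral_comp (measurableEmbedding_timeShift s),
    ← (measurePreserving_timeShift α s).integral_comp (measurableEmbedding_timeShift s)
      fun z => inner ℝ (L (timeShift m (-s) z)) (jet φ z)]
  simpa only [timeShift_timeShift_neg, dt_comp_timeShift, jet_comp_timeShift,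
    Function.comp_apply] using hφs

lemma EnergyData.comp_timeShift_neg (hd : EnergyData α T a₀ w L) (hs : 0 ≤ s) :
    EnergyData α T a₀ (fun z => w (timeShift m (-s) z)) fun z => L (timeShift m (-s) z) where
  memLp := memLp_comp_timeShift_neg hs hd.memLp
  memLp_source := memLp_comp_timeShift_neg hs hd.memLp_source
  weakGrad := hd.weakGrad.comp_timeShift_neg hs
  timeDeriv := hd.timeDeriv.comp_timeShift_neg hs

variable [IsLocallyFiniteMeasure (muCyl m α ⊤)]

lemma HasTimeDeriv.sub (h : HasTimeDeriv α T b L) (h' : HasTimeDeriv α T b' L')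
    (hb : MemLp b 2 (muCyl m α T)) (hb' : MemLp b' 2 (muCyl m α T))
    (hL : MemLp L 2 (muCyl m α T)) (hL' : MemLp L' 2 (muCyl m α T)) :
    HasTimeDeriv α T (fun z => b z - b' z) fun z => L z - L' z := by
  intro φ hφ
  have hdt := hφ.memLp_dt (muCyl m α T)
  have hjet := hφ.memLp_jet (muCyl m α T)
  simp_rw [inner_sub_left]
  rw [integral_sub (integrable_inner_of_memLp hb hdt) (integrable_inner_of_memLp hb' hdt),
    integral_sub (integrable_inner_of_memLp hL hjet) (integrable_inner_of_memLp hL' hjet),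
    ← h φ hφ, ← h' φ hφ]
  ring

lemma EnergyData.sub (ha : SymCoeff α κ a₀) (hd : EnergyData α T a₀ w L)
    (hd' : EnergyData α T a₀ w' L') :
    EnergyData α T a₀ (fun z => w z - w' z) fun z => L z - L' z where
  memLp := hd.memLp.sub hd'.memLp
  memLp_source := hd.memLp_source.sub hd'.memLp_source
  weakGrad := hd.weakGrad.sub hd'.weakGrad (hd.memLp.eval_piLp _) (hd'.memLp.eval_piLp _)
    (fun _ => hd.memLp.eval_piLp _) fun _ => hd'.memLp.eval_piLp _
  timeDeriv := by
    simpa only [PiLp.sub_apply, map_sub] using hd.timeDeriv.sub hd'.timeDeriv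
      (ha.memLp_toEuclideanLin (hd.memLp.eval_piLp none))
      (ha.memLp_toEuclideanLin (hd'.memLp.eval_piLp none)) hd.memLp_source hd'.memLp_source

end Translates

/-! ### Time regularity -/

section Modulus

variable {m n : ℕ} {α κ : ℝ} {S T : EReal} {a₀ : Sp m → Matrix (Fin n) (Fin n) ℝ}
  {w L : ℝ × Sp m → Jet m n}

lemma ae_memLp_prodMk {X Y E : Type*} [MeasurableSpace X] [MeasurableSpace Y] {μ : Measure X}
    {ν : Measure Y} [SFinite μ] [SFinite ν] [NormedAddCommGroup E] {f : Y × X → E} {p : ℝ≥0∞}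
    (hp₀ : p ≠ 0) (hp : p ≠ ⊤) (hf : MemLp f p (ν.prod μ)) :
    ∀ᵐ y ∂ν, MemLp (fun x => f (y, x)) p μ := by
  filter_upwards [hf.1.prodMk_left, (hf.integrable_norm_rpow hp₀ hp).prod_right_ae] with y hfy hint
  exact (integrable_norm_rpow_iff hfy hp₀ hp).1 hint

lemma integral_inner_le {X E : Type*} [MeasurableSpace X] {μ : Measure X} [NormedAddCommGroup E]
    [InnerProductSpace ℝ E] {f g : X → E} (hf : MemLp f 2 μ) (hg : MemLp g 2 μ) :
    ∫ x, inner ℝ (f x) (g x) ∂μ ≤ (eLpNorm f 2 μ).toReal * (eLpNorm g 2 μ).toReal := by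
  rw [← inner_toLp hf hg, ← Lp.norm_toLp f hf, ← Lp.norm_toLp g hg]
  exact real_inner_le_norm _ _

lemma SymCoeff.eLpNorm_le (ha : SymCoeff α κ a₀) (hκ : 0 < κ) {v : Sp m → Val n}
    (hv : MemLp v 2 (muSpace m α)) {R : ℝ}
    (hR : ∫ x, mdot (a₀ x) (v x) (v x) ∂(muSpace m α) ≤ R) :
    eLpNorm v 2 (muSpace m α) ≤ ENNReal.ofReal (√(R / κ)) := by
  have hint : Integrable (fun x => mdot (a₀ x) (v x) (v x)) (muSpace m α) := by
    simp_rw [mdot_eq_inner]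
    exact integrable_inner_of_memLp
      (WeightedParabolic.memLp_toEuclideanLin ha.meas ha.bounded hv) hv
  have hcoercive : κ * ‖hv.toLp v‖ ^ 2 ≤ R := by
    rw [norm_sq_toLp, ← integral_const_mul]
    refine (integral_mono_ae ((hv.integrable_norm_pow (by simp)).const_mul κ) hint ?_).trans hR
    filter_upwards [ha.posdef] with x hx using hx _
  have hnorm : ‖hv.toLp v‖ ≤ √(R / κ) :=
    Real.le_sqrt_of_sq_le ((le_div_iff₀' hκ).2 hcoercive)
  rw [Lp.norm_toLp] at hnorm
  rw [← ENNReal.ofReal_toReal hv.2.ne]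
  exact ENNReal.ofReal_le_ofReal hnorm

lemma toReal_eLpNorm_sub_timeShift_neg_le {f : ℝ × Sp m → Jet m n}
    (hf : MemLp f 2 (muCyl m α T)) (hST : S ≤ T) {h : ℝ} (hh : 0 ≤ h) :
    (eLpNorm (fun z => f z - f (timeShift m (-h) z)) 2 (muCyl m α S)).toReal
      ≤ ‖(memLp_extendZero hf).toLp _ - shiftL2 m n α (-h) ((memLp_extendZero hf).toLp _)‖ := by
  have hF := memLp_extendZero hf
  have hFh := hF.comp_measurePreserving (measurePreserving_timeShift α (-h))
  rw [shiftL2_toLp, ← MemLp.toLp_sub hF hFh, Lp.norm_toLp]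
  refine ENNReal.toReal_mono (hF.sub hFh).2.ne (le_trans (eLpNorm_congr_ae ?_).le
    (eLpNorm_mono_measure _ (muCyl_mono le_top)))
  filter_upwards [ae_mem_cyl m α S] with z hz
  have hzT := timeRay_mono hST hz.1
  rw [Pi.sub_apply, Function.comp_apply, extendZero_of_mem hzT,
    extendZero_of_mem (timeShift_neg_fst_mem hh hzT)]

lemma continuous_norm_sub_shiftL2_neg [IsLocallyFiniteMeasure (muCyl m α ⊤)] (v : JetL2 m n α) :
    Continuous fun h : ℝ => ‖v - shiftL2 m n α (-h) v‖ := by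
  have : Continuous fun h : ℝ => shiftL2 m n α (-h) v :=
    continuous_shiftL2.comp (by fun_prop : Continuous fun h : ℝ => (v, -h))
  exact (continuous_const.sub this).norm

/-- The increments `w - w(· - h)` again form energy data, so the energy inequality bounds them by
an `L_2` pairing of increments of `L` and `w`, which tends to zero uniformly in time. -/
theorem EnergyData.exists_modulus [IsLocallyFiniteMeasure (muCyl m α ⊤)]
    (hd : EnergyData α T a₀ w L) (ha : SymCoeff α κ a₀) (hκ : 0 < κ) :
    ∃ ρ : ℝ → ℝ≥0∞, Continuous ρ ∧ ρ 0 = 0 ∧ ∀ h ≥ 0, ∀ᵐ τ : ℝ, τ ∈ timeRay T →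
      eLpNorm (fun x => w (τ, x) none - w (τ - h, x) none) 2 (muSpace m α) ≤ ρ h := by
  set W := (memLp_extendZero hd.memLp).toLp _
  set Λ := (memLp_extendZero hd.memLp_source).toLp _
  refine ⟨fun h => ENNReal.ofReal
    (√(2 * (‖Λ - shiftL2 m n α (-h) Λ‖ * ‖W - shiftL2 m n α (-h) W‖) / κ)), ?_, by simp,
    fun h hh => ?_⟩
  · exact ENNReal.continuous_ofReal.comp ((((continuous_norm_sub_shiftL2_neg Λ).mul
      (continuous_norm_sub_shiftL2_neg W)).const_mul 2).div_const κ).sqrt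
  have hinc := hd.sub ha (hd.comp_timeShift_neg hh)
  have hslice : ∀ᵐ τ : ℝ, τ ∈ timeRay T →
      MemLp (fun x => (w (τ, x) - w (timeShift m (-h) (τ, x))) none) 2 (muSpace m α) := by
    have hmem := hinc.memLp.eval_piLp none
    rw [muCyl_eq_prod] at hmem
    rw [← ae_restrict_iff' (isOpen_timeRay T).measurableSet]
    exact ae_memLp_prodMk two_ne_zero ENNReal.ofNat_ne_top hmem
  filter_upwards [hinc.ae_energy_le ha hκ.le, hslice] with τ henergy hmem hτ
  have hτT : (τ : EReal) ≤ T := le_of_lt hτ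
  refine ha.eLpNorm_le hκ (hmem hτ) ((henergy hτ).trans ?_)
  gcongr
  calc _ ≤ _ := integral_inner_le (hinc.mono hτT).memLp_source (hinc.mono hτT).memLp
    _ ≤ ‖Λ - shiftL2 m n α (-h) Λ‖ * ‖W - shiftL2 m n α (-h) W‖ := by
      gcongr
      · exact toReal_eLpNorm_sub_timeShift_neg_le hd.memLp_source hτT hh
      · exact toReal_eLpNorm_sub_timeShift_neg_le hd.memLp hτT hh

end Modulus

/-! ### Continuous versions -/

section Version

variable {X E : Type*} [MeasurableSpace X] {μ : Measure X} [NormedAddCommGroup E] {p : ℝ≥0∞}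
  {s : Set ℝ} {v : ℝ × X → E} {ρ : ℝ → ℝ≥0∞}

open Classical in
/-- The time slice `v(t, ·)` as an element of `L_p(μ)`, with the value `0` when the slice is not
in `L_p(μ)`. -/
def sliceLp (p : ℝ≥0∞) (μ : Measure X) (v : ℝ × X → E) (t : ℝ) : Lp E p μ :=
  if h : MemLp (fun x => v (t, x)) p μ then h.toLp _ else 0

lemma sliceLp_of_memLp {t : ℝ} (h : MemLp (fun x => v (t, x)) p μ) :
    sliceLp p μ v t = h.toLp _ :=
  dif_pos h

lemma edist_sliceLp {t t' : ℝ} (h : MemLp (fun x => v (t, x)) p μ)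
    (h' : MemLp (fun x => v (t', x)) p μ) :
    edist (sliceLp p μ v t) (sliceLp p μ v t') = eLpNorm (fun x => v (t, x) - v (t', x)) p μ := by
  rw [sliceLp_of_memLp h, sliceLp_of_memLp h', Lp.edist_toLp_toLp]
  rfl

lemma measurable_eLpNorm_prodMk {Y : Type*} [MeasurableSpace Y] [SFinite μ] {f : Y × X → E}
    (hf : StronglyMeasurable f) (hp₀ : p ≠ 0) (hp : p ≠ ⊤) :
    Measurable fun y => eLpNorm (fun x => f (y, x)) p μ := by
  simp_rw [eLpNorm_eq_lintegral_rpow_enorm_toReal hp₀ hp]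
  exact ((hf.enorm.pow_const _).lintegral_prod_right').pow_const _

lemma ae_ae_eLpNorm_sub_le_of_stronglyMeasurable [SFinite μ] (hs : MeasurableSet s) (hp₀ : p ≠ 0)
    (hp : p ≠ ⊤) (hv : StronglyMeasurable v) (hρ : Measurable ρ)
    (hmod : ∀ h ≥ 0, ∀ᵐ t : ℝ, t ∈ s → eLpNorm (fun x => v (t, x) - v (t - h, x)) p μ ≤ ρ h) :
    ∀ᵐ t : ℝ, ∀ᵐ h : ℝ, t ∈ s → 0 ≤ h →
      eLpNorm (fun x => v (t, x) - v (t - h, x)) p μ ≤ ρ h := by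
  have hmeas : Measurable fun q : ℝ × ℝ =>
      eLpNorm (fun x => v (q.1, x) - v (q.1 - q.2, x)) p μ :=
    measurable_eLpNorm_prodMk (f := fun q : (ℝ × ℝ) × X => v (q.1.1, q.2) - v (q.1.1 - q.1.2, q.2))
      ((hv.comp_measurable (by fun_prop)).sub (hv.comp_measurable (by fun_prop))) hp₀ hp
  have hset : MeasurableSet {q : ℝ × ℝ | q.1 ∈ s → 0 ≤ q.2 →
      eLpNorm (fun x => v (q.1, x) - v (q.1 - q.2, x)) p μ ≤ ρ q.2} :=
    (hs.preimage measurable_fst).imp ((measurableSet_le measurable_const measurable_snd).imp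
      (measurableSet_le hmeas (hρ.comp measurable_snd)))
  refine (Measure.ae_ae_comm hset).2 (.of_forall fun h => ?_)
  by_cases hh : 0 ≤ h
  · filter_upwards [hmod h hh] with t ht hts _ using ht hts
  · exact .of_forall fun t _ hh' => absurd hh' hh

lemma ae_ae_eLpNorm_sub_le [SFinite μ] (hs : IsLowerSet s) (hso : IsOpen s) (hp₀ : p ≠ 0)
    (hp : p ≠ ⊤) (hv : AEStronglyMeasurable v ((volume.restrict s).prod μ)) (hρ : Measurable ρ)
    (hmod : ∀ h ≥ 0, ∀ᵐ t : ℝ, t ∈ s → eLpNorm (fun x => v (t, x) - v (t - h, x)) p μ ≤ ρ h) :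
    ∀ᵐ t : ℝ, t ∈ s → ∀ᵐ h : ℝ, 0 ≤ h →
      eLpNorm (fun x => v (t, x) - v (t - h, x)) p μ ≤ ρ h := by
  obtain ⟨u, hu, hvu⟩ := hv
  have hslice : ∀ᵐ t : ℝ, t ∈ s → (fun x => v (t, x)) =ᵐ[μ] fun x => u (t, x) := by
    rw [← ae_restrict_iff' hso.measurableSet]
    exact Measure.ae_ae_of_ae_prod hvu
  have hu_mod : ∀ h ≥ 0, ∀ᵐ t : ℝ, t ∈ s →
      eLpNorm (fun x => u (t, x) - u (t - h, x)) p μ ≤ ρ h := by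
    intro h hh
    filter_upwards [hmod h hh, hslice, (measurePreserving_sub_right
      volume h).quasiMeasurePreserving.ae hslice] with t ht htu htu' hts
    have hcongr := (htu hts).sub (htu' (hs (sub_le_self t hh) hts))
    exact (eLpNorm_congr_ae hcongr.symm).trans_le (ht hts)
  filter_upwards [ae_ae_eLpNorm_sub_le_of_stronglyMeasurable hso.measurableSet hp₀ hp hu hρ hu_mod,
    hslice] with t ht htu hts
  filter_upwards [ht, (Measure.measurePreserving_sub_left volume t).quasiMeasurePreserving.ae
    hslice] with h hth htu' hh
  have hcongr := (htu hts).sub (htu' (hs (sub_le_self t hh) hts))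
  exact (eLpNorm_congr_ae hcongr).trans_le (hth hts hh)

lemma uniformContinuousOn_of_ae_edist_sub_le {F : Type*} [PseudoEMetricSpace F] {f : ℝ → F}
    (hρ : Tendsto ρ (𝓝 0) (𝓝 0))
    (hf : ∀ t ∈ s, ∀ᵐ h : ℝ, 0 ≤ h → edist (f t) (f (t - h)) ≤ ρ h) :
    UniformContinuousOn f s := by
  rw [EMetric.uniformContinuousOn_iff]
  intro ε hε
  obtain ⟨δ, hδ, hρδ⟩ := Metric.eventually_nhds_iff.1
    (hρ.eventually (gt_mem_nhds (ENNReal.half_pos hε.ne')))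
  have hback : ∀ t ∈ s, ∀ᵐ r : ℝ, r ≤ t → t - r < δ → edist (f t) (f r) < ε / 2 := by
    intro t ht
    filter_upwards [(Measure.measurePreserving_sub_left volume t).quasiMeasurePreserving.ae
      (hf t ht)] with r hr hrt hrδ
    rw [sub_sub_cancel] at hr
    refine (hr (sub_nonneg.2 hrt)).trans_lt (hρδ ?_)
    rwa [Real.dist_0_eq_abs, abs_of_nonneg (sub_nonneg.2 hrt)]
  refine ⟨ENNReal.ofReal (δ / 2), by simpa using hδ, fun {t} ht {t'} ht' htt' => ?_⟩
  rw [edist_dist, ENNReal.ofReal_lt_ofReal_iff (by positivity), Real.dist_eq, abs_lt] at htt'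
  obtain ⟨r, ⟨hr, hr'⟩, hrI⟩ := (Measure.dense_of_ae ((hback t ht).and
    (hback t' ht'))).exists_mem_open isOpen_Ioo
      (nonempty_Ioo.2 (sub_lt_self (min t t') (half_pos hδ)))
  have hrt : r < t := hrI.2.trans_le (min_le_left t t')
  have hrt' : r < t' := hrI.2.trans_le (min_le_right t t')
  have hmin : t - δ / 2 < min t t' ∧ t' - δ / 2 < min t t' := by
    constructor <;> apply lt_min <;> linarith
  calc edist (f t) (f t') ≤ edist (f t) (f r) + edist (f t') (f r) := edist_triangle_right ..
    _ < ε / 2 + ε / 2 := ENNReal.add_lt_add (hr hrt.le (by linarith [hrI.1]))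
        (hr' hrt'.le (by linarith [hrI.1]))
    _ = ε := ENNReal.add_halves ε

lemma exists_boundedContinuous_extension {Y F : Type*} [UniformSpace Y] [NormedAddCommGroup F]
    [CompleteSpace F] {f : Y → F} {𝒯 K : Set Y} {R : ℝ} (hf : UniformContinuousOn f 𝒯)
    (hR : ∀ t ∈ 𝒯, ‖f t‖ ≤ R) (hK : K ⊆ closure 𝒯) :
    ∃ U : K →ᵇ F, (∀ t : K, (t : Y) ∈ 𝒯 → U t = f t) ∧ ∀ t, ‖U t‖ ≤ R := by
  have hlim : ∀ x ∈ K, ∃ y, Tendsto f (𝓝[𝒯] x) (𝓝 y) := by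
    intro x hx
    have : (𝓝[𝒯] x).NeBot := mem_closure_iff_nhdsWithin_neBot.1 (hK hx)
    exact cauchy_iff_exists_le_nhds.1 ((cauchy_nhds.mono nhdsWithin_le_nhds).map_of_le hf
      (le_principal_iff.2 self_mem_nhdsWithin))
  have hnorm : ∀ x ∈ K, ‖extendFrom 𝒯 f x‖ ≤ R := by
    intro x hx
    obtain ⟨y, hy⟩ := hlim x hx
    have : (𝓝[𝒯] x).NeBot := mem_closure_iff_nhdsWithin_neBot.1 (hK hx)
    rw [extendFrom_eq (hK hx) hy]
    refine le_of_tendsto hy.norm ?_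
    filter_upwards [self_mem_nhdsWithin] with t ht using hR t ht
  refine ⟨.ofNormedAddCommGroup (fun t : K => extendFrom 𝒯 f t)
    (continuousOn_iff_continuous_domRestrict.1 (continuousOn_extendFrom hK hlim)) R
    fun t => hnorm t t.2, fun t ht => ?_, fun t => hnorm t t.2⟩
  exact extendFrom_eq (subset_closure ht) (hf.continuousOn t ht)

theorem exists_boundedContinuous_version [CompleteSpace E] [SFinite μ] [Fact (1 ≤ p)] (hp : p ≠ ⊤)
    (hs : IsLowerSet s) (hso : IsOpen s) (hv : MemLp v p ((volume.restrict s).prod μ))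
    (hρ : Continuous ρ) (hρ₀ : ρ 0 = 0)
    (hmod : ∀ h ≥ 0, ∀ᵐ t : ℝ, t ∈ s → eLpNorm (fun x => v (t, x) - v (t - h, x)) p μ ≤ ρ h)
    {R : ℝ} (hR : 0 ≤ R)
    (hbound : ∀ᵐ t : ℝ, t ∈ s → eLpNorm (fun x => v (t, x)) p μ ≤ ENNReal.ofReal R) :
    ∃ U : closure s →ᵇ Lp E p μ,
      (∀ᵐ t : ℝ, ∀ ht : t ∈ s, U ⟨t, subset_closure ht⟩ =ᵐ[μ] fun x => v (t, x)) ∧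
      ∀ t, ‖U t‖ ≤ R := by
  have hp₀ : p ≠ 0 := (zero_lt_one.trans_le Fact.out).ne'
  set 𝒯 : Set ℝ := {t | MemLp (fun x => v (t, x)) p μ ∧ ‖sliceLp p μ v t‖ ≤ R ∧
    ∀ᵐ h : ℝ, 0 ≤ h → edist (sliceLp p μ v t) (sliceLp p μ v (t - h)) ≤ ρ h}
  have hmem : ∀ᵐ t : ℝ, t ∈ s → MemLp (fun x => v (t, x)) p μ := by
    rw [← ae_restrict_iff' hso.measurableSet]
    exact ae_memLp_prodMk hp₀ hp hv
  have h𝒯 : ∀ᵐ t : ℝ, t ∈ s → t ∈ 𝒯 := by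
    filter_upwards [ae_ae_eLpNorm_sub_le hs hso hp₀ hp hv.1 hρ.measurable hmod, hmem, hbound]
      with t ht htv htR hts
    refine ⟨htv hts, ?_, ?_⟩
    · rw [sliceLp_of_memLp (htv hts), Lp.norm_toLp]
      exact ENNReal.toReal_le_of_le_ofReal hR (htR hts)
    · filter_upwards [ht hts, (Measure.measurePreserving_sub_left
        volume t).quasiMeasurePreserving.ae hmem] with h hth hh hh₀
      rw [edist_sliceLp (htv hts) (hh (hs (sub_le_self t hh₀) hts))]
      exact hth hh₀
  have hdense : closure s ⊆ closure 𝒯 := closure_minimal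
    (((Measure.dense_of_ae h𝒯).open_subset_closure_inter hso).trans
      (closure_mono fun t ht => ht.2 ht.1)) isClosed_closure
  have hunif : UniformContinuousOn (sliceLp p μ v) 𝒯 :=
    uniformContinuousOn_of_ae_edist_sub_le (hρ₀ ▸ hρ.tendsto 0) fun t ht => ht.2.2
  obtain ⟨U, hU, hUR⟩ := exists_boundedContinuous_extension hunif (fun t ht => ht.2.1) hdense
  refine ⟨U, ?_, hUR⟩
  filter_upwards [h𝒯] with t ht hts
  rw [hU ⟨t, subset_closure hts⟩ (ht hts), sliceLp_of_memLp (ht hts).1]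
  exact (ht hts).1.coeFn_toLp

end Version

/-! ### Coefficients and weak solutions -/

/-- The linear map `(u, Du) ↦ (λ C₀ u, A^{ij} D_j u)` on jets at the point `z`. -/
def coeffField {m n : ℕ} (lam : ℝ)
    (A : Fin (m + 1) → Fin (m + 1) → ℝ × Sp m → Matrix (Fin n) (Fin n) ℝ)
    (C₀ : ℝ × Sp m → Matrix (Fin n) (Fin n) ℝ) (z : ℝ × Sp m) : Jet m n →ₗ[ℝ] Jet m n :=
  (WithLp.linearEquiv 2 ℝ (Option (Fin (m + 1)) → Val n)).symm.toLinearMap ∘ₗ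
    LinearMap.pi fun o => o.elim (lam • (C₀ z).toEuclideanLin ∘ₗ PiLp.projₗ 2 _ none)
      fun i => ∑ j, (A i j z).toEuclideanLin ∘ₗ PiLp.projₗ 2 _ (some j)

/-- The jet field `(√λ f, F)` of the right-hand side of the equation. -/
def sourceJet {m n : ℕ} (lam : ℝ) (F : Fin (m + 1) → ℝ × Sp m → Val n) (f : ℝ × Sp m → Val n) :
    ℝ × Sp m → Jet m n :=
  mkJet (fun z => √lam • f z) F

/-- The jet field `(√λ f - λ C₀ u, F^i - A^{ij} D_j u)`, which for a weak solution `u` with jet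
`w = (u, Du)` represents the distribution `x_d^α a_0 u_t`. -/
def residualJet {m n : ℕ} (lam : ℝ)
    (A : Fin (m + 1) → Fin (m + 1) → ℝ × Sp m → Matrix (Fin n) (Fin n) ℝ)
    (C₀ : ℝ × Sp m → Matrix (Fin n) (Fin n) ℝ) (F : Fin (m + 1) → ℝ × Sp m → Val n)
    (f : ℝ × Sp m → Val n) (w : ℝ × Sp m → Jet m n) (z : ℝ × Sp m) : Jet m n :=
  sourceJet lam F f z - coeffField lam A C₀ z (w z)

section Transpose

variable {n : ℕ} (M : Matrix (Fin n) (Fin n) ℝ)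

lemma matAbs_transpose : matAbs Mᵀ = matAbs M := by
  rw [matAbs, matAbs, Finset.sum_comm]
  rfl

lemma mdot_transpose (v w : Val n) : mdot Mᵀ v w = mdot M w v := by
  rw [mdot, mdot, Matrix.mulVec_transpose, ← Matrix.dotProduct_mulVec, dotProduct_comm]

end Transpose

section Coefficients

variable {m n : ℕ} {α κ lam : ℝ} {T : EReal}
  {A : Fin (m + 1) → Fin (m + 1) → ℝ × Sp m → Matrix (Fin n) (Fin n) ℝ}
  {C₀ : ℝ × Sp m → Matrix (Fin n) (Fin n) ℝ}

lemma EllipticCoeff.transpose (hA : EllipticCoeff κ T A) :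
    EllipticCoeff κ T fun i j z => (A j i z)ᵀ where
  meas i j k l := hA.meas j i l k
  elliptic := by
    filter_upwards [hA.elliptic] with z hz ξ
    rw [Finset.sum_comm]
    simpa only [mdot_transpose] using hz ξ
  bounded := by
    filter_upwards [hA.bounded] with z hz i j
    simpa only [matAbs_transpose] using hz j i

lemma NondegCoeff.transpose {X : Type*} [MeasureSpace X] {O : Set X}
    {M : X → Matrix (Fin n) (Fin n) ℝ} (hM : NondegCoeff κ O M) :
    NondegCoeff κ O fun x => (M x)ᵀ where
  meas k l := hM.meas l k
  posdef := by simpa only [mdot_transpose] using hM.posdef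
  bounded := by simpa only [matAbs_transpose] using hM.bounded

@[simp]
lemma coeffField_none (z : ℝ × Sp m) (v : Jet m n) :
    coeffField lam A C₀ z v none = lam • (C₀ z).toEuclideanLin (v none) := rfl

@[simp]
lemma coeffField_some (z : ℝ × Sp m) (v : Jet m n) (i : Fin (m + 1)) :
    coeffField lam A C₀ z v (some i) = ∑ j, (A i j z).toEuclideanLin (v (some j)) := by
  simp [coeffField]

lemma inner_coeffField (z : ℝ × Sp m) (v w : Jet m n) :
    inner ℝ (coeffField lam A C₀ z v) w
      = (∑ i, ∑ j, mdot (A i j z) (v (some j)) (w (some i)))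
        + lam * mdot (C₀ z) (v none) (w none) := by
  simp [inner_jet, mdot_eq_inner, sum_inner, inner_smul_left]

lemma inner_coeffField_transpose (z : ℝ × Sp m) (v w : Jet m n) :
    inner ℝ (coeffField lam (fun i j z => (A j i z)ᵀ) (fun z => (C₀ z)ᵀ) z v) w
      = inner ℝ (coeffField lam A C₀ z w) v := by
  rw [inner_coeffField, inner_coeffField, Finset.sum_comm]
  simp only [mdot_transpose]

lemma memLp_coeffField (hA : EllipticCoeff κ T A) (hC : NondegCoeff κ (cyl m T) C₀) (lam : ℝ)
    {w : ℝ × Sp m → Jet m n} (hw : MemLp w 2 (muCyl m α T)) :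
    MemLp (fun z => coeffField lam A C₀ z (w z)) 2 (muCyl m α T) := by
  have hac := muCyl_absolutelyContinuous m α T
  refine MemLp.of_eval_piLp fun o => ?_
  cases o with
  | none =>
    exact (memLp_toEuclideanLin (fun k l => (hC.meas k l).mono_ac hac) (hac.ae_le hC.bounded)
      (hw.eval_piLp none)).const_smul lam
  | some i =>
    simp only [coeffField_some]
    exact memLp_finsetSum Finset.univ fun j _ =>
      memLp_toEuclideanLin (fun k l => (hA.meas i j k l).mono_ac hac)
        (hac.ae_le (hA.bounded.mono fun z hz => hz i j)) (hw.eval_piLp (some j))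

lemma ae_le_inner_coeffField (hA : EllipticCoeff κ T A) (hC : NondegCoeff κ (cyl m T) C₀)
    (hlam : 0 ≤ lam) :
    ∀ᵐ z ∂(muCyl m α T), ∀ v : Jet m n,
      κ * ((∑ i, ‖v (some i)‖ ^ 2) + lam * ‖v none‖ ^ 2) ≤ inner ℝ (coeffField lam A C₀ z v) v := by
  have hac := muCyl_absolutelyContinuous m α T
  filter_upwards [hac.ae_le hA.elliptic, hac.ae_le hC.posdef] with z hell hpos v
  rw [inner_coeffField]
  linarith [hell fun i => v (some i), mul_le_mul_of_nonneg_left (hpos (v none)) hlam]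

end Coefficients

section WeakSolutions

variable {m n : ℕ} {α κ lam : ℝ} {T : EReal} {a₀ : Sp m → Matrix (Fin n) (Fin n) ℝ}
  {A : Fin (m + 1) → Fin (m + 1) → ℝ × Sp m → Matrix (Fin n) (Fin n) ℝ}
  {C₀ : ℝ × Sp m → Matrix (Fin n) (Fin n) ℝ}
  {F : Fin (m + 1) → ℝ × Sp m → Val n} {f : ℝ × Sp m → Val n}
  {u : ℝ × Sp m → Val n} {Du : Fin (m + 1) → ℝ × Sp m → Val n} {w : ℝ × Sp m → Jet m n}

lemma memLp_sourceJet (lam : ℝ) (hF : ∀ i, MemLp (F i) 2 (muCyl m α T))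
    (hf : MemLp f 2 (muCyl m α T)) : MemLp (sourceJet lam F f) 2 (muCyl m α T) :=
  memLp_mkJet (hf.const_smul (√lam)) hF

lemma memLp_residualJet (hA : EllipticCoeff κ T A) (hC : NondegCoeff κ (cyl m T) C₀) (lam : ℝ)
    (hF : ∀ i, MemLp (F i) 2 (muCyl m α T)) (hf : MemLp f 2 (muCyl m α T))
    (hw : MemLp w 2 (muCyl m α T)) :
    MemLp (residualJet lam A C₀ F f w) 2 (muCyl m α T) :=
  (memLp_sourceJet lam hF hf).sub (memLp_coeffField hA hC lam hw)

lemma inner_sourceJet (z : ℝ × Sp m) (v : Jet m n) :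
    inner ℝ (sourceJet lam F f z) v
      = (∑ i, inner ℝ (F i z) (v (some i))) + √lam * inner ℝ (f z) (v none) := by
  simp [inner_jet, sourceJet, inner_smul_left]

lemma isWeakSol_iff [IsLocallyFiniteMeasure (muCyl m α ⊤)] (ha : SymCoeff α κ a₀)
    (hA : EllipticCoeff κ T A) (hC : NondegCoeff κ (cyl m T) C₀)
    (hF : ∀ i, MemLp (F i) 2 (muCyl m α T)) (hf : MemLp f 2 (muCyl m α T))
    (hu : MemLp u 2 (muCyl m α T)) (hDu : ∀ i, MemLp (Du i) 2 (muCyl m α T)) :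
    IsWeakSol α T lam a₀ A C₀ F f u Du ↔
      HasTimeDeriv α T (fun z => (a₀ z.2).toEuclideanLin (u z))
        (residualJet lam A C₀ F f (mkJet u Du)) := by
  refine forall₂_congr fun φ hφ => ?_
  have hj := hφ.memLp_jet (muCyl m α T)
  have htime := ha.integrable_mdot hu (hφ.memLp_dt (muCyl m α T))
  have hcoeff := integrable_inner_of_memLp (memLp_coeffField hA hC lam (memLp_mkJet hu hDu)) hj
  have hsource := integrable_inner_of_memLp (memLp_sourceJet lam hF hf) hj
  have hleft : ∫ z, (- mdot (a₀ z.2) (u z) (dt φ z)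
        + (∑ i, ∑ j, mdot (A i j z) (Du j z) (dx i φ z))
        + lam * mdot (C₀ z) (u z) (φ z)) ∂(muCyl m α T)
      = - ∫ z, mdot (a₀ z.2) (u z) (dt φ z) ∂(muCyl m α T)
        + ∫ z, inner ℝ (coeffField lam A C₀ z (mkJet u Du z)) (jet φ z) ∂(muCyl m α T) := by
    rw [← integral_neg, ← integral_add htime.fun_neg hcoeff]
    simp only [inner_coeffField, mkJet_some, mkJet_none, jet_some, jet_none, add_assoc]
  have hright : ∫ z, ((∑ i, inner ℝ (F i z) (dx i φ z)) + √lam * inner ℝ (f z) (φ z))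
        ∂(muCyl m α T)
      = ∫ z, inner ℝ (sourceJet lam F f z) (jet φ z) ∂(muCyl m α T) := by
    simp only [inner_sourceJet, jet_some, jet_none]
  rw [hleft, hright]
  simp_rw [residualJet, inner_sub_left, ← mdot_eq_inner]
  rw [integral_sub hsource hcoeff, eq_sub_iff_add_eq]

lemma IsWeakSol.energyData [IsLocallyFiniteMeasure (muCyl m α ⊤)]
    (hsol : IsWeakSol α T lam a₀ A C₀ F f u Du) (ha : SymCoeff α κ a₀)
    (hA : EllipticCoeff κ T A) (hC : NondegCoeff κ (cyl m T) C₀)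
    (hF : ∀ i, MemLp (F i) 2 (muCyl m α T)) (hf : MemLp f 2 (muCyl m α T))
    (hu : MemH1 α T a₀ u Du) :
    EnergyData α T a₀ (mkJet u Du) (residualJet lam A C₀ F f (mkJet u Du)) where
  memLp := memLp_mkJet hu.memLp hu.grad_memLp
  memLp_source := memLp_residualJet hA hC lam hF hf (memLp_mkJet hu.memLp hu.grad_memLp)
  weakGrad := hu.weakGrad
  timeDeriv := (isWeakSol_iff ha hA hC hF hf hu.memLp hu.grad_memLp).1 hsol

end WeakSolutions

/-! ### The energy estimate and uniqueness -/

lemma two_mul_inner_le_inv_mul_add {V : Type*} [NormedAddCommGroup V] [InnerProductSpace ℝ V]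
    {κ : ℝ} (hκ : 0 < κ) (v w : V) : 2 * inner ℝ v w ≤ κ⁻¹ * ‖v‖ ^ 2 + κ * ‖w‖ ^ 2 := by
  have hsq : κ⁻¹ * ‖v‖ ^ 2 + κ * ‖w‖ ^ 2 - 2 * (‖v‖ * ‖w‖) = κ⁻¹ * (‖v‖ - κ * ‖w‖) ^ 2 := by
    field_simp
    ring
  have hnonneg : 0 ≤ κ⁻¹ * (‖v‖ - κ * ‖w‖) ^ 2 := by positivity
  linarith [real_inner_le_norm v w]

section Estimate

variable {m n : ℕ} {α κ lam : ℝ} {S T : EReal} {a₀ : Sp m → Matrix (Fin n) (Fin n) ℝ}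
  {A : Fin (m + 1) → Fin (m + 1) → ℝ × Sp m → Matrix (Fin n) (Fin n) ℝ}
  {C₀ : ℝ × Sp m → Matrix (Fin n) (Fin n) ℝ}
  {F : Fin (m + 1) → ℝ × Sp m → Val n} {f : ℝ × Sp m → Val n}
  {u v : ℝ × Sp m → Val n} {Du Dv : Fin (m + 1) → ℝ × Sp m → Val n} {w : ℝ × Sp m → Jet m n}

lemma two_mul_inner_sourceJet_le (hκ : 0 < κ) (hlam : 0 ≤ lam) (z : ℝ × Sp m) (v : Jet m n) :
    2 * inner ℝ (sourceJet lam F f z) v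
      ≤ κ⁻¹ * ((∑ i, ‖F i z‖ ^ 2) + ‖f z‖ ^ 2)
        + κ * ((∑ i, ‖v (some i)‖ ^ 2) + lam * ‖v none‖ ^ 2) := by
  have hnone : 2 * (√lam * inner ℝ (f z) (v none))
      ≤ κ⁻¹ * ‖f z‖ ^ 2 + κ * (lam * ‖v none‖ ^ 2) := by
    simpa only [inner_smul_right, norm_smul, mul_pow, Real.norm_eq_abs, sq_abs,
      Real.sq_sqrt hlam] using two_mul_inner_le_inv_mul_add hκ (f z) (√lam • v none)
  have hsome : 2 * ∑ i, inner ℝ (F i z) (v (some i))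
      ≤ κ⁻¹ * (∑ i, ‖F i z‖ ^ 2) + κ * ∑ i, ‖v (some i)‖ ^ 2 := by
    simp_rw [Finset.mul_sum, ← Finset.sum_add_distrib]
    exact Finset.sum_le_sum fun i _ => two_mul_inner_le_inv_mul_add hκ _ _
  rw [inner_sourceJet]
  linarith

lemma ae_two_mul_inner_residualJet_le (hA : EllipticCoeff κ T A)
    (hC : NondegCoeff κ (cyl m T) C₀) (hκ : 0 < κ) (hlam : 0 ≤ lam) :
    ∀ᵐ z ∂(muCyl m α T),
      2 * inner ℝ (residualJet lam A C₀ F f w z) (w z)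
        ≤ κ⁻¹ * ((∑ i, ‖F i z‖ ^ 2) + ‖f z‖ ^ 2)
          - κ * ((∑ i, ‖w z (some i)‖ ^ 2) + lam * ‖w z none‖ ^ 2) := by
  filter_upwards [ae_le_inner_coeffField (α := α) hA hC hlam] with z hz
  rw [residualJet, inner_sub_left]
  linarith [hz (w z), two_mul_inner_sourceJet_le (F := F) (f := f) hκ hlam z (w z)]

lemma integrable_sum_norm_sq {X : Type*} [MeasurableSpace X] {μ : Measure X} {ι : Type*} [Fintype ι]
    {V : Type*} [NormedAddCommGroup V] {G : ι → X → V} (hG : ∀ i, MemLp (G i) 2 μ) :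
    Integrable (fun z => ∑ i, ‖G i z‖ ^ 2) μ :=
  integrable_finsetSum _ fun i _ => (hG i).integrable_norm_pow two_ne_zero

lemma two_mul_integral_inner_residualJet_le (hA : EllipticCoeff κ T A)
    (hC : NondegCoeff κ (cyl m T) C₀) (hκ : 0 < κ) (hlam : 0 ≤ lam)
    (hF : ∀ i, MemLp (F i) 2 (muCyl m α T)) (hf : MemLp f 2 (muCyl m α T))
    (hw : MemLp w 2 (muCyl m α T)) (hS : S ≤ T) :
    2 * ∫ z, inner ℝ (residualJet lam A C₀ F f w z) (w z) ∂(muCyl m α S)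
      ≤ κ⁻¹ * ∫ z, ((∑ i, ‖F i z‖ ^ 2) + ‖f z‖ ^ 2) ∂(muCyl m α T)
        - κ * ∫ z, ((∑ i, ‖w z (some i)‖ ^ 2) + lam * ‖w z none‖ ^ 2) ∂(muCyl m α S) := by
  have hle := muCyl_mono (m := m) (α := α) hS
  have hdata : Integrable (fun z => (∑ i, ‖F i z‖ ^ 2) + ‖f z‖ ^ 2) (muCyl m α T) :=
    (integrable_sum_norm_sq hF).add (hf.integrable_norm_pow two_ne_zero)
  have hdiss : Integrable (fun z => (∑ i, ‖w z (some i)‖ ^ 2) + lam * ‖w z none‖ ^ 2)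
      (muCyl m α S) :=
    ((integrable_sum_norm_sq fun i => hw.eval_piLp (some i)).add
      (((hw.eval_piLp none).integrable_norm_pow two_ne_zero).const_mul lam)).mono_measure hle
  have hinner := (integrable_inner_of_memLp (memLp_residualJet hA hC lam hF hf hw) hw).mono_measure
    hle
  have hmono : ∫ z, ((∑ i, ‖F i z‖ ^ 2) + ‖f z‖ ^ 2) ∂(muCyl m α S)
      ≤ ∫ z, ((∑ i, ‖F i z‖ ^ 2) + ‖f z‖ ^ 2) ∂(muCyl m α T) :=
    integral_mono_measure hle (.of_forall fun z => by positivity) hdata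
  have hpt := integral_mono_ae (hinner.const_mul 2)
    (((hdata.mono_measure hle).const_mul κ⁻¹).sub (hdiss.const_mul κ))
    (ae_mono hle (ae_two_mul_inner_residualJet_le (F := F) (f := f) (w := w) hA hC hκ hlam))
  simp only [Pi.sub_apply] at hpt
  rw [integral_const_mul, integral_sub ((hdata.mono_measure hle).const_mul κ⁻¹)
    (hdiss.const_mul κ), integral_const_mul, integral_const_mul] at hpt
  refine hpt.trans ?_
  gcongr

variable [IsLocallyFiniteMeasure (muCyl m α ⊤)]

lemma IsWeakSol.ae_eLpNorm_le (hsol : IsWeakSol α T lam a₀ A C₀ F f u Du)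
    (ha : SymCoeff α κ a₀) (hA : EllipticCoeff κ T A) (hC : NondegCoeff κ (cyl m T) C₀)
    (hκ : 0 < κ) (hlam : 0 ≤ lam) (hF : ∀ i, MemLp (F i) 2 (muCyl m α T))
    (hf : MemLp f 2 (muCyl m α T)) (hu : MemH1 α T a₀ u Du) :
    ∀ᵐ τ : ℝ, τ ∈ timeRay T → eLpNorm (fun x => u (τ, x)) 2 (muSpace m α)
      ≤ ENNReal.ofReal
        (√(κ⁻¹ * (∫ z, ((∑ i, ‖F i z‖ ^ 2) + ‖f z‖ ^ 2) ∂(muCyl m α T)) / κ)) := by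
  have hd := hsol.energyData ha hA hC hF hf hu
  have hslice := ae_memLp_prodMk two_ne_zero ENNReal.ofNat_ne_top (muCyl_eq_prod m α T ▸ hu.memLp)
  filter_upwards [hd.ae_energy_le ha hκ.le, (ae_restrict_iff' (isOpen_timeRay T).measurableSet).1
    hslice] with τ henergy hmem hτ
  refine ha.eLpNorm_le hκ (hmem hτ) ((henergy hτ).trans ?_)
  have hle := two_mul_integral_inner_residualJet_le hA hC hκ hlam hF hf hd.memLp (le_of_lt hτ)
  have hdiss : 0 ≤ κ * ∫ z, ((∑ i, ‖mkJet u Du z (some i)‖ ^ 2) + lam * ‖mkJet u Du z none‖ ^ 2)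
      ∂(muCyl m α (τ : EReal)) :=
    mul_nonneg hκ.le (integral_nonneg fun z => by positivity)
  linarith

lemma IsWeakSol.integral_grad_add_le (hsol : IsWeakSol α T lam a₀ A C₀ F f u Du)
    (ha : SymCoeff α κ a₀) (hA : EllipticCoeff κ T A) (hC : NondegCoeff κ (cyl m T) C₀)
    (hκ : 0 < κ) (hT : ⊥ < T) (hlam : 0 ≤ lam) (hF : ∀ i, MemLp (F i) 2 (muCyl m α T))
    (hf : MemLp f 2 (muCyl m α T)) (hu : MemH1 α T a₀ u Du) :
    ∫ z, (∑ i, ‖Du i z‖ ^ 2) ∂(muCyl m α T) + lam * ∫ z, ‖u z‖ ^ 2 ∂(muCyl m α T)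
      ≤ κ⁻¹ * (∫ z, ((∑ i, ‖F i z‖ ^ 2) + ‖f z‖ ^ 2) ∂(muCyl m α T)) / κ := by
  have hd := hsol.energyData ha hA hC hF hf hu
  have hle := two_mul_integral_inner_residualJet_le hA hC hκ hlam hF hf hd.memLp le_rfl
  simp only [mkJet_some, mkJet_none] at hle
  rw [integral_add (integrable_sum_norm_sq hu.grad_memLp)
    ((hu.memLp.integrable_norm_pow two_ne_zero).const_mul lam), integral_const_mul] at hle
  rw [le_div_iff₀ hκ]
  linarith [hd.integral_inner_nonneg ha hκ.le hT]

theorem IsWeakSol.exists_isVersion_energy_le (hsol : IsWeakSol α T lam a₀ A C₀ F f u Du)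
    (ha : SymCoeff α κ a₀) (hA : EllipticCoeff κ T A) (hC : NondegCoeff κ (cyl m T) C₀)
    (hκ : 0 < κ) (hT : ⊥ < T) (hlam : 0 ≤ lam) (hF : ∀ i, MemLp (F i) 2 (muCyl m α T))
    (hf : MemLp f 2 (muCyl m α T)) (hu : MemH1 α T a₀ u Du) :
    ∃ U : closure (timeRay T) →ᵇ Lp (Val n) 2 (muSpace m α),
      IsVersion α T u U ∧
      (⨆ t : timeRay T, ‖U ⟨t, subset_closure t.2⟩‖ ^ 2)
          + ∫ z, (∑ i, ‖Du i z‖ ^ 2) ∂(muCyl m α T)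
          + lam * ∫ z, ‖u z‖ ^ 2 ∂(muCyl m α T)
        ≤ 2 / κ ^ 2 * ∫ z, (∑ i, ‖F i z‖ ^ 2) ∂(muCyl m α T)
          + 2 / κ ^ 2 * ∫ z, ‖f z‖ ^ 2 ∂(muCyl m α T) := by
  set E := ∫ z, ((∑ i, ‖F i z‖ ^ 2) + ‖f z‖ ^ 2) ∂(muCyl m α T) with hE
  have : 0 ≤ E := integral_nonneg fun z => by positivity
  obtain ⟨ρ, hρ, hρ₀, hmod⟩ := (hsol.energyData ha hA hC hF hf hu).exists_modulus ha hκ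
  obtain ⟨U, hU, hUE⟩ := exists_boundedContinuous_version ENNReal.ofNat_ne_top
    (isLowerSet_timeRay T) (isOpen_timeRay T) (muCyl_eq_prod m α T ▸ hu.memLp) hρ hρ₀ hmod
    (Real.sqrt_nonneg _) (hsol.ae_eLpNorm_le ha hA hC hκ hlam hF hf hu)
  refine ⟨U, hU, ?_⟩
  have : Nonempty (timeRay T) := (nonempty_timeRay hT).to_subtype
  have hsup : (⨆ t : timeRay T, ‖U ⟨t, subset_closure t.2⟩‖ ^ 2) ≤ κ⁻¹ * E / κ :=
    ciSup_le fun t => (Real.le_sqrt (norm_nonneg _) (by positivity)).1 (hUE _)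
  have hgrad := hsol.integral_grad_add_le ha hA hC hκ hT hlam hF hf hu
  have hsplit : 2 / κ ^ 2 * ∫ z, (∑ i, ‖F i z‖ ^ 2) ∂(muCyl m α T)
      + 2 / κ ^ 2 * ∫ z, ‖f z‖ ^ 2 ∂(muCyl m α T) = κ⁻¹ * E / κ + κ⁻¹ * E / κ := by
    rw [hE, integral_add (integrable_sum_norm_sq hF) (hf.integrable_norm_pow two_ne_zero)]
    field_simp
    ring
  linarith

lemma EnergyData.ae_none_eq_zero (hd : EnergyData α T a₀ w fun z => -coeffField lam A C₀ z (w z))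
    (ha : SymCoeff α κ a₀) (hA : EllipticCoeff κ T A) (hC : NondegCoeff κ (cyl m T) C₀)
    (hκ : 0 < κ) (hT : ⊥ < T) (hlam : 0 < lam) : (fun z => w z none) =ᵐ[muCyl m α T] 0 := by
  have hnonneg := hd.integral_inner_nonneg ha hκ.le hT
  have hint : Integrable (fun z => ‖w z none‖ ^ 2) (muCyl m α T) :=
    (hd.memLp.eval_piLp none).integrable_norm_pow two_ne_zero
  have hle : ∫ z, inner ℝ (-coeffField lam A C₀ z (w z)) (w z) ∂(muCyl m α T)
      ≤ ∫ z, -(κ * lam) * ‖w z none‖ ^ 2 ∂(muCyl m α T) := by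
    refine integral_mono_ae (integrable_inner_of_memLp hd.memLp_source hd.memLp)
      (hint.const_mul _) ?_
    filter_upwards [ae_le_inner_coeffField (α := α) hA hC hlam.le] with z hz
    have hgrad : 0 ≤ κ * ∑ i, ‖w z (some i)‖ ^ 2 := by positivity
    simp only [inner_neg_left]
    linarith [hz (w z)]
  rw [integral_const_mul] at hle
  have hzero : ∫ z, ‖w z none‖ ^ 2 ∂(muCyl m α T) = 0 := by
    have hκlam := mul_pos hκ hlam
    have : 0 ≤ ∫ z, ‖w z none‖ ^ 2 ∂(muCyl m α T) := integral_nonneg fun z => by positivity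
    nlinarith
  filter_upwards [(integral_eq_zero_iff_of_nonneg (fun z => by positivity) hint).1 hzero] with z hz
  simpa using hz

theorem IsWeakSol.ae_eq (hsol : IsWeakSol α T lam a₀ A C₀ F f u Du)
    (hsol' : IsWeakSol α T lam a₀ A C₀ F f v Dv) (ha : SymCoeff α κ a₀)
    (hA : EllipticCoeff κ T A) (hC : NondegCoeff κ (cyl m T) C₀) (hκ : 0 < κ) (hT : ⊥ < T)
    (hlam : 0 < lam) (hF : ∀ i, MemLp (F i) 2 (muCyl m α T)) (hf : MemLp f 2 (muCyl m α T))
    (hu : MemH1 α T a₀ u Du) (hv : MemH1 α T a₀ v Dv) : u =ᵐ[muCyl m α T] v := by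
  have hd := EnergyData.sub ha (hsol.energyData ha hA hC hF hf hu)
    (hsol'.energyData ha hA hC hF hf hv)
  have hres (z : ℝ × Sp m) : residualJet lam A C₀ F f (mkJet u Du) z
      - residualJet lam A C₀ F f (mkJet v Dv) z
        = -coeffField lam A C₀ z (mkJet u Du z - mkJet v Dv z) := by
    rw [residualJet, residualJet, sub_sub_sub_cancel_left, map_sub, neg_sub]
  simp only [hres] at hd
  filter_upwards [hd.ae_none_eq_zero ha hA hC hκ hT hlam] with z hz
  simpa [sub_eq_zero] using hz

end Estimate

/-! ### Existence -/

section Lions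

variable {Φ H : Type*} [AddCommGroup Φ] [Module ℝ Φ] [NormedAddCommGroup H] [InnerProductSpace ℝ H]

lemma norm_le_inv_mul_norm_orthogonalProjectionOnto {V : Submodule ℝ H}
    [V.HasOrthogonalProjection] {c : ℝ} (hc : 0 < c) {v k : H} (hv : v ∈ V)
    (hvk : c * ‖v‖ ^ 2 ≤ inner ℝ v k) : ‖v‖ ≤ c⁻¹ * ‖V.orthogonalProjectionOnto k‖ := by
  have hproj : c * ‖v‖ ^ 2 ≤ ‖v‖ * ‖V.orthogonalProjectionOnto k‖ := by
    rw [← Submodule.inner_orthogonalProjectionOnto_eq_of_mem_left (⟨v, hv⟩ : V)] at hvk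
    exact hvk.trans (real_inner_le_norm _ _)
  rw [inv_mul_eq_div, le_div_iff₀' hc]
  rcases (norm_nonneg v).eq_or_lt with hv₀ | hv₀
  · rw [← hv₀, mul_zero]
    positivity
  · exact le_of_mul_le_mul_left (by linarith) hv₀

variable [CompleteSpace H]

lemma exists_inner_eq_of_norm_le (K : Φ →ₗ[ℝ] H) (l : Φ →ₗ[ℝ] ℝ) {C : ℝ}
    (hl : ∀ φ, ‖l φ‖ ≤ C * ‖K φ‖) : ∃ y : H, ∀ φ, inner ℝ y (K φ) = l φ := by
  obtain ⟨σ, hσ⟩ := K.rangeRestrict.exists_rightInverse_of_surjective K.range_rangeRestrict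
  have hKσ : ∀ r : LinearMap.range K, K (σ r) = r := fun r =>
    congrArg Subtype.val (LinearMap.congr_fun hσ r)
  let lRange : LinearMap.range K →L[ℝ] ℝ :=
    (l ∘ₗ σ).mkContinuous C fun r => by
      have h := hl (σ r)
      rwa [hKσ] at h
  obtain ⟨lExt, hlExt, -⟩ := exists_extension_norm_eq _ lRange
  refine ⟨(InnerProductSpace.toDual ℝ H).symm lExt, fun φ => ?_⟩
  have hsection : l (σ (K.rangeRestrict φ)) = l φ := by
    have hker := hl (σ (K.rangeRestrict φ) - φ)
    rw [map_sub K, hKσ, LinearMap.codRestrict_apply, sub_self, norm_zero, mul_zero, map_sub] at hker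
    exact sub_eq_zero.1 (norm_le_zero_iff.1 hker)
  rw [InnerProductSpace.toDual_symm_apply, ← hsection]
  exact hlExt (K.rangeRestrict φ)

/-- J.-L. Lions' variant of the Lax–Milgram lemma: the bilinear form `y, φ ↦ ⟪y, k φ⟫` need not be
bounded in `φ`. -/
theorem exists_mem_closure_range_inner_eq (j k : Φ →ₗ[ℝ] H) {c : ℝ} (hc : 0 < c)
    (hjk : ∀ φ, c * ‖j φ‖ ^ 2 ≤ inner ℝ (j φ) (k φ)) (l : H) :
    ∃ y ∈ closure (range j), ∀ φ, inner ℝ y (k φ) = inner ℝ l (j φ) := by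
  let V : Submodule ℝ H := (LinearMap.range j).topologicalClosure
  have : CompleteSpace V := (Submodule.isClosed_topologicalClosure _).completeSpace_coe
  let K : Φ →ₗ[ℝ] V := V.orthogonalProjectionOnto.toLinearMap ∘ₗ k
  have hbound : ∀ φ, ‖(innerₛₗ ℝ l ∘ₗ j) φ‖ ≤ ‖l‖ * c⁻¹ * ‖K φ‖ := fun φ => by
    have hj : ‖j φ‖ ≤ c⁻¹ * ‖K φ‖ := norm_le_inv_mul_norm_orthogonalProjectionOnto hc
      (Submodule.le_topologicalClosure _ ⟨φ, rfl⟩) (hjk φ)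
    rw [mul_assoc]
    exact (norm_inner_le_norm l (j φ)).trans (by gcongr)
  obtain ⟨y, hy⟩ := exists_inner_eq_of_norm_le K (innerₛₗ ℝ l ∘ₗ j) hbound
  refine ⟨y, y.2, fun φ => ?_⟩
  rw [← Submodule.inner_orthogonalProjectionOnto_eq_of_mem_left]
  exact hy φ

end Lions

section WeakGradient

variable {m n : ℕ} {α : ℝ} {T : EReal}

lemma hasWeakGrad_of_isTest {O : Set (ℝ × Sp m)} {φ : ℝ × Sp m → Val n} (hφ : IsTest O φ) :
    HasWeakGrad T φ fun i => dx i φ := by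
  intro i ψ hψ
  rw [setIntegral_eq_integral_of_forall_compl_eq_zero fun z hz => by
      rw [hψ.dx_eq_zero i hz, zero_smul],
    setIntegral_eq_integral_of_forall_compl_eq_zero fun z hz => by
      rw [hψ.eq_zero_of_notMem hz, zero_smul]]
  have hparts := integral_smul_fderiv_eq_neg_fderiv_smul_of_integrable (μ := volume) (𝕜 := ℝ)
    (f := ψ) (g := φ) (v := (0, EuclideanSpace.single i 1))
    (((hψ.continuous_fderiv_apply _).smul hφ.1.continuous).integrable_of_hasCompactSupport
      hφ.2.1.smul_left)
    ((hψ.1.continuous.smul (hφ.continuous_fderiv_apply _)).integrable_of_hasCompactSupport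
      hψ.2.1.smul_right)
    ((hψ.1.continuous.smul hφ.1.continuous).integrable_of_hasCompactSupport hψ.2.1.smul_right)
    (fun z _ => hψ.differentiable z) (fun z _ => hφ.differentiable z)
  exact (neg_eq_iff_eq_neg.2 hparts).symm

lemma setIntegral_cyl_smul_eq_lpPairing {g : ℝ × Sp m → ℝ}
    (hg : MemLp (fun z => invWeight m α z * g z) 2 (muCyl m α T)) (y : JetL2 m n α)
    (o : Option (Fin (m + 1))) :
    ∫ z in cyl m T, g z • y z o
      = ((ContinuousLinearMap.lsmul ℝ ℝ).bilinearComp (.id ℝ ℝ)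
          (PiLp.proj 2 (fun _ : Option (Fin (m + 1)) => Val n) o : Jet m n →L[ℝ] Val n)).lpPairing
          (muCyl m α ⊤) 2 2 ((memLp_extendZero hg).toLp _) y := by
  rw [ContinuousLinearMap.lpPairing_eq_integral, setIntegral_cyl_smul α]
  have hextend : ∫ z, (memLp_extendZero hg).toLp _ z • y z o ∂(muCyl m α ⊤)
      = ∫ z, extendZero T (fun z => invWeight m α z * g z) z • y z o ∂(muCyl m α ⊤) :=
    integral_congr_ae (by
      filter_upwards [(memLp_extendZero hg).coeFn_toLp] with z hz; rw [hz])
  refine Eq.trans ?_ hextend.symm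
  rw [integral_muCyl_of_le (S := T) le_top fun z hz => by
    rw [extendZero_of_notMem hz, zero_smul]]
  exact integral_congr_ae (by
    filter_upwards [extendZero_ae_eq fun z => invWeight m α z * g z] with z hz; rw [hz])

variable [IsLocallyFiniteMeasure (muCyl m α ⊤)]

lemma continuous_setIntegral_cyl_smul {g : ℝ × Sp m → ℝ} (hg : Continuous g)
    (hgc : HasCompactSupport g) (hgT : tsupport g ⊆ cyl m T) (o : Option (Fin (m + 1))) :
    Continuous fun y : JetL2 m n α => ∫ z in cyl m T, g z • y z o := by
  simp only [setIntegral_cyl_smul_eq_lpPairing (memLp_invWeight_mul hg hgc hgT)]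
  fun_prop

lemma testJet_ae_eq (φ : testSpace m n T) :
    testJet m n α T φ =ᵐ[volume.restrict (cyl m T)] jet (φ : ℝ × Sp m → Val n) :=
  (volume_absolutelyContinuous_muCyl m α T).ae_le
    (ae_mono (muCyl_mono le_top) (IsTest.memLp_jet (muCyl m α ⊤) φ.2).coeFn_toLp)

lemma hasWeakGrad_of_mem_closure {y : JetL2 m n α} (hy : y ∈ closure (range (testJet m n α T))) :
    HasWeakGrad T (fun z => y z none) fun i z => y z (some i) := by
  intro i ψ hψ
  have hclosed : IsClosed {y : JetL2 m n α |
      ∫ z in cyl m T, dx i ψ z • y z none = - ∫ z in cyl m T, ψ z • y z (some i)} :=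
    isClosed_eq (continuous_setIntegral_cyl_smul (hψ.continuous_fderiv_apply _)
        (hψ.2.1.fderiv_apply ℝ _) ((tsupport_fderiv_apply_subset ℝ _).trans hψ.2.2) none)
      (continuous_setIntegral_cyl_smul hψ.1.continuous hψ.2.1 hψ.2.2 (some i)).neg
  refine closure_minimal ?_ hclosed hy
  rintro _ ⟨φ, rfl⟩
  have hvalue : ∫ z in cyl m T, dx i ψ z • testJet m n α T φ z none
      = ∫ z in cyl m T, dx i ψ z • (φ : ℝ × Sp m → Val n) z :=
    integral_congr_ae (by filter_upwards [testJet_ae_eq (α := α) φ] with z hz; rw [hz, jet_none])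
  have hgrad : ∫ z in cyl m T, ψ z • testJet m n α T φ z (some i)
      = ∫ z in cyl m T, ψ z • dx i (φ : ℝ × Sp m → Val n) z :=
    integral_congr_ae (by filter_upwards [testJet_ae_eq (α := α) φ] with z hz; rw [hz, jet_some])
  rw [mem_ofPred_eq, hvalue, hgrad]
  exact hasWeakGrad_of_isTest φ.2 i ψ hψ

end WeakGradient

/-- The jet field `(λ C₀ᵀ φ - a₀ φ_t, (A^{ji})ᵀ D_j φ)` of the formal adjoint operator. -/
def dualField {m n : ℕ} (lam : ℝ) (a₀ : Sp m → Matrix (Fin n) (Fin n) ℝ)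
    (A : Fin (m + 1) → Fin (m + 1) → ℝ × Sp m → Matrix (Fin n) (Fin n) ℝ)
    (C₀ : ℝ × Sp m → Matrix (Fin n) (Fin n) ℝ) (φ : ℝ × Sp m → Val n) (z : ℝ × Sp m) : Jet m n :=
  coeffField lam (fun i j z => (A j i z)ᵀ) (fun z => (C₀ z)ᵀ) z (jet φ z)
    - liftJet (fun z => (a₀ z.2).toEuclideanLin (dt φ z)) z

section Adjoint

variable {m n : ℕ} {α κ lam : ℝ} {T : EReal} {a₀ : Sp m → Matrix (Fin n) (Fin n) ℝ}
  {A : Fin (m + 1) → Fin (m + 1) → ℝ × Sp m → Matrix (Fin n) (Fin n) ℝ}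
  {C₀ : ℝ × Sp m → Matrix (Fin n) (Fin n) ℝ} {O : Set (ℝ × Sp m)} {φ ψ : ℝ × Sp m → Val n}

lemma liftJet_add (b c : ℝ × Sp m → Val n) (z : ℝ × Sp m) :
    liftJet (fun z => b z + c z) z = liftJet b z + liftJet c z := by
  ext1 o
  cases o <;> simp [liftJet]

lemma liftJet_const_smul (r : ℝ) (b : ℝ × Sp m → Val n) (z : ℝ × Sp m) :
    liftJet (fun z => r • b z) z = r • liftJet b z := by
  ext1 o
  cases o <;> simp [liftJet]

lemma dualField_add (hφ : Differentiable ℝ φ) (hψ : Differentiable ℝ ψ) :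
    dualField lam a₀ A C₀ (φ + ψ) = dualField lam a₀ A C₀ φ + dualField lam a₀ A C₀ ψ := by
  have hdt : ∀ z, dt (φ + ψ) z = dt φ z + dt ψ z := fun z => by
    simp [dt, fderiv_add (hφ z) (hψ z)]
  funext z
  simp only [dualField, hdt, map_add, liftJet_add, jet_add hφ hψ, Pi.add_apply]
  abel

lemma dualField_const_smul (hφ : Differentiable ℝ φ) (c : ℝ) :
    dualField lam a₀ A C₀ (c • φ) = c • dualField lam a₀ A C₀ φ := by
  have hdt : ∀ z, dt (c • φ) z = c • dt φ z := fun z => by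
    simp [dt, fderiv_const_smul (hφ z)]
  funext z
  simp only [dualField, hdt, map_smul, liftJet_const_smul, jet_const_smul hφ, Pi.smul_apply,
    smul_sub]

lemma eq_zero_of_hasDerivAt_of_even {r : ℝ → ℝ} {r' : ℝ} (hr : ∀ s, r (-s) = r s)
    (hd : HasDerivAt r r' 0) : r' = 0 := by
  have hneg : HasDerivAt (fun s => r (-s)) (-r') 0 := by
    have hd₀ : HasDerivAt r r' (-0) := by rwa [neg_zero]
    have hcomp := hd₀.comp 0 (hasDerivAt_neg (0 : ℝ))
    rwa [mul_neg_one] at hcomp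
  rw [funext hr] at hneg
  linarith [hneg.unique hd]

variable [IsLocallyFiniteMeasure (muCyl m α ⊤)]

lemma memLp_dualField (ha : SymCoeff α κ a₀) (hA : EllipticCoeff κ T A)
    (hC : NondegCoeff κ (cyl m T) C₀) (lam : ℝ) (hφ : IsTest O φ) :
    MemLp (dualField lam a₀ A C₀ φ) 2 (muCyl m α T) :=
  (memLp_coeffField hA.transpose hC.transpose lam (hφ.memLp_jet _)).sub
    (memLp_liftJet (ha.memLp_toEuclideanLin (hφ.memLp_dt _)))

/-- The formal adjoint operator as a linear map from test functions to `L_2(ℝ × ℝ^d_+, μ)`, its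
values being extended by zero from `Ω_T`. -/
def testDual (lam : ℝ) (ha : SymCoeff α κ a₀) (hA : EllipticCoeff κ T A)
    (hC : NondegCoeff κ (cyl m T) C₀) : testSpace m n T →ₗ[ℝ] JetL2 m n α where
  toFun φ := (memLp_extendZero (memLp_dualField ha hA hC lam φ.2)).toLp _
  map_add' φ ψ := by
    rw [← MemLp.toLp_add]
    refine MemLp.toLp_congr _ _ (.of_eq ?_)
    rw [Submodule.coe_add,
      dualField_add (IsTest.differentiable φ.2) (IsTest.differentiable ψ.2)]
    exact indicator_add _ _ _
  map_smul' c φ := by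
    rw [RingHom.id_apply, ← MemLp.toLp_const_smul]
    refine MemLp.toLp_congr _ _ (.of_eq ?_)
    rw [Submodule.coe_smul, dualField_const_smul (IsTest.differentiable φ.2)]
    exact indicator_const_smul _ c (dualField lam a₀ A C₀ (φ : ℝ × Sp m → Val n))

lemma integral_inner_dualField (ha : SymCoeff α κ a₀) (hA : EllipticCoeff κ T A)
    (hC : NondegCoeff κ (cyl m T) C₀) {w : ℝ × Sp m → Jet m n} (hw : MemLp w 2 (muCyl m α T))
    (hφ : IsTest O φ) :
    ∫ z, inner ℝ (dualField lam a₀ A C₀ φ z) (w z) ∂(muCyl m α T)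
      = ∫ z, inner ℝ (coeffField lam A C₀ z (w z)) (jet φ z) ∂(muCyl m α T)
        - ∫ z, mdot (a₀ z.2) (w z none) (dt φ z) ∂(muCyl m α T) := by
  rw [← integral_sub
    (integrable_inner_of_memLp (memLp_coeffField hA hC lam hw) (hφ.memLp_jet _))
    (ha.integrable_mdot (hw.eval_piLp none) (hφ.memLp_dt _))]
  refine integral_congr_ae ?_
  filter_upwards [ha.symm_cyl] with z hz
  rw [dualField, inner_sub_left, inner_liftJet, inner_coeffField_transpose, ← mdot_eq_inner,
    mdot_comm _ _ _ hz]

lemma inner_testDual (ha : SymCoeff α κ a₀) (hA : EllipticCoeff κ T A)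
    (hC : NondegCoeff κ (cyl m T) C₀) {w : ℝ × Sp m → Jet m n} (hw : MemLp w 2 (muCyl m α ⊤))
    (φ : testSpace m n T) :
    inner ℝ (hw.toLp w) (testDual lam ha hA hC φ)
      = ∫ z, inner ℝ (coeffField lam A C₀ z (w z)) (jet (φ : ℝ × Sp m → Val n) z) ∂(muCyl m α T)
        - ∫ z, mdot (a₀ z.2) (w z none) (dt (φ : ℝ × Sp m → Val n) z) ∂(muCyl m α T) := by
  rw [real_inner_comm, ← integral_inner_dualField ha hA hC
    (hw.mono_measure (muCyl_mono le_top)) φ.2, ← integral_inner_extendZero]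
  exact inner_toLp (memLp_extendZero (memLp_dualField ha hA hC lam φ.2)) hw

/-- Symmetry of `a₀` makes `s ↦ ∫ a₀ φ · φ(· + s) dμ` an even function. -/
lemma SymCoeff.integral_mdot_dt_eq_zero (ha : SymCoeff α κ a₀) (hφ : IsTest O φ) :
    ∫ z, mdot (a₀ z.2) (φ z) (dt φ z) ∂(muCyl m α ⊤) = 0 := by
  have hderiv := hasDerivAt_integral_timeShift (ha.memLp_toEuclideanLin (hφ.memLp _)) hφ 0
  simp only [← mdot_eq_inner, timeShift_zero] at hderiv
  refine eq_zero_of_hasDerivAt_of_even (fun s => ?_) hderiv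
  rw [← (measurePreserving_timeShift α s).integral_comp (measurableEmbedding_timeShift s)]
  refine integral_congr_ae ?_
  filter_upwards [ha.symm_cyl] with z hz
  rw [timeShift_timeShift_neg]
  exact mdot_comm _ _ _ hz

lemma le_inner_testJet_testDual (ha : SymCoeff α κ a₀) (hA : EllipticCoeff κ T A)
    (hC : NondegCoeff κ (cyl m T) C₀) (hκ : 0 ≤ κ) (hlam : 0 ≤ lam) (φ : testSpace m n T) :
    κ * min 1 lam * ‖testJet m n α T φ‖ ^ 2
      ≤ inner ℝ (testJet m n α T φ) (testDual lam ha hA hC φ) := by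
  have hφ : IsTest (timeRay T ×ˢ univ) (φ : ℝ × Sp m → Val n) := φ.2
  have hj := hφ.memLp_jet (muCyl m α T)
  have htime := ha.integral_mdot_dt_eq_zero hφ
  rw [integral_muCyl_of_le (S := T) le_top fun z hz => by
    rw [hφ.dt_eq_zero hz, mdot_zero_right]] at htime
  rw [testJet_apply, inner_testDual, norm_sq_toLp]
  simp only [jet_none, htime, sub_zero]
  rw [integral_muCyl_of_le (S := T) le_top fun z hz => by rw [hφ.jet_eq_zero hz]; simp,
    ← integral_const_mul]
  refine integral_mono_ae ((hj.integrable_norm_pow two_ne_zero).const_mul _)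
    (integrable_inner_of_memLp (memLp_coeffField hA hC lam hj) hj) ?_
  filter_upwards [ae_le_inner_coeffField hA hC hlam] with z hz
  refine le_trans ?_ (hz _)
  rw [norm_sq_jet, mul_assoc, mul_add]
  gcongr
  · exact mul_le_of_le_one_left (by positivity) (min_le_left _ _)
  · exact min_le_right _ _

end Adjoint

section Solution

variable {m n : ℕ} {α κ lam : ℝ} {T : EReal} {a₀ : Sp m → Matrix (Fin n) (Fin n) ℝ}
  {A : Fin (m + 1) → Fin (m + 1) → ℝ × Sp m → Matrix (Fin n) (Fin n) ℝ}
  {C₀ : ℝ × Sp m → Matrix (Fin n) (Fin n) ℝ}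
  {F : Fin (m + 1) → ℝ × Sp m → Val n} {f : ℝ × Sp m → Val n}

lemma HasTimeDeriv.timeDerivMemHMinusOne {u : ℝ × Sp m → Val n} {L : ℝ × Sp m → Jet m n}
    (h : HasTimeDeriv α T (fun z => (a₀ z.2).toEuclideanLin (u z)) L)
    (hL : MemLp L 2 (muCyl m α T)) : TimeDerivMemHMinusOne α T a₀ u := by
  refine ⟨fun i z => L z (some i), fun z => L z none, fun i => hL.eval_piLp (some i),
    hL.eval_piLp none, fun φ hφ => ?_⟩
  simpa only [mdot_eq_inner, inner_jet, jet_some, jet_none] using h φ hφ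

variable [IsLocallyFiniteMeasure (muCyl m α ⊤)]

lemma hasTimeDeriv_residualJet_of_inner_testDual (ha : SymCoeff α κ a₀)
    (hA : EllipticCoeff κ T A) (hC : NondegCoeff κ (cyl m T) C₀)
    (hsource : MemLp (sourceJet lam F f) 2 (muCyl m α T)) {y : JetL2 m n α}
    (hy : ∀ φ, inner ℝ y (testDual lam ha hA hC φ)
      = inner ℝ ((memLp_extendZero hsource).toLp _) (testJet m n α T φ)) :
    HasTimeDeriv α T (fun z => (a₀ z.2).toEuclideanLin (y z none))
      (residualJet lam A C₀ F f y) := by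
  intro φ hφ
  have hyT : MemLp y 2 (muCyl m α T) := (Lp.memLp y).mono_measure (muCyl_mono le_top)
  have hj := hφ.memLp_jet (muCyl m α T)
  have hyφ := hy ⟨φ, hφ⟩
  rw [← Lp.toLp_coeFn y (Lp.memLp y), inner_testDual, testJet_apply, inner_toLp,
    integral_inner_extendZero] at hyφ
  simp_rw [residualJet, inner_sub_left, ← mdot_eq_inner]
  rw [integral_sub (integrable_inner_of_memLp hsource hj)
    (integrable_inner_of_memLp (memLp_coeffField hA hC lam hyT) hj)]
  linarith

/-- Lions' lemma is applied to the adjoint operator on test functions, which is coercive because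
`∫ a₀ φ · φ_t dμ = 0`. -/
theorem exists_isWeakSol (ha : SymCoeff α κ a₀) (hA : EllipticCoeff κ T A)
    (hC : NondegCoeff κ (cyl m T) C₀) (hκ : 0 < κ) (hlam : 0 < lam)
    (hF : ∀ i, MemLp (F i) 2 (muCyl m α T)) (hf : MemLp f 2 (muCyl m α T)) :
    ∃ (u : ℝ × Sp m → Val n) (Du : Fin (m + 1) → ℝ × Sp m → Val n),
      MemH1 α T a₀ u Du ∧ IsWeakSol α T lam a₀ A C₀ F f u Du := by
  have hsource := memLp_sourceJet lam hF hf
  obtain ⟨y, hy, hyφ⟩ := exists_mem_closure_range_inner_eq (testJet m n α T)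
    (testDual lam ha hA hC) (c := κ * min 1 lam) (by positivity)
    (le_inner_testJet_testDual ha hA hC hκ.le hlam.le) ((memLp_extendZero hsource).toLp _)
  have hyT : MemLp y 2 (muCyl m α T) := (Lp.memLp y).mono_measure (muCyl_mono le_top)
  have htime := hasTimeDeriv_residualJet_of_inner_testDual ha hA hC hsource hyφ
  have hjet : mkJet (fun z => y z none) (fun i z => y z (some i)) = y := by
    ext z o
    cases o <;> rfl
  refine ⟨fun z => y z none, fun i z => y z (some i), ⟨hyT.eval_piLp none,
    fun i => hyT.eval_piLp (some i), hasWeakGrad_of_mem_closure hy,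
    htime.timeDerivMemHMinusOne (memLp_residualJet hA hC lam hF hf hyT)⟩, ?_⟩
  rwa [isWeakSol_iff ha hA hC hF hf (hyT.eval_piLp none) fun i => hyT.eval_piLp (some i), hjet]

end Solution

end WeightedParabolic

end

open WeightedParabolic in
theorem theorem3p1 (m n : ℕ) (α : ℝ) (hα : -1 < α) (κ : ℝ) (hκ : 0 < κ) (hκ' : κ ≤ 1) :
    ∃ N : ℝ, 0 < N ∧
      ∀ (T : EReal) (_ : ⊥ < T) (lam : ℝ) (_ : 0 ≤ lam)
        (a₀ : Sp m → Matrix (Fin n) (Fin n) ℝ)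
        (A : Fin (m + 1) → Fin (m + 1) → ℝ × Sp m → Matrix (Fin n) (Fin n) ℝ)
        (C₀ : ℝ × Sp m → Matrix (Fin n) (Fin n) ℝ)
        (_ : EllipticCoeff κ T A)
        (_ : NondegCoeff κ (halfSpace m) a₀)
        (_ : ∀ᵐ x ∂(volume.restrict (halfSpace m)), (a₀ x)ᵀ = a₀ x)
        (_ : NondegCoeff κ (cyl m T) C₀)
        (F : Fin (m + 1) → ℝ × Sp m → Val n) (f : ℝ × Sp m → Val n)
        (_ : ∀ i, MemLp (F i) 2 (muCyl m α T)) (_ : MemLp f 2 (muCyl m α T)),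
        (∀ (u : ℝ × Sp m → Val n) (Du : Fin (m + 1) → ℝ × Sp m → Val n),
          MemH1 α T a₀ u Du → IsWeakSol α T lam a₀ A C₀ F f u Du →
          ∃ U : closure (timeRay T) →ᵇ Lp (Val n) 2 (muSpace m α),
            IsVersion α T u U ∧
            (⨆ t : timeRay T, ‖U ⟨t, subset_closure t.2⟩‖ ^ 2)
                + ∫ z, (∑ i, ‖Du i z‖ ^ 2) ∂(muCyl m α T)
                + lam * ∫ z, ‖u z‖ ^ 2 ∂(muCyl m α T)
              ≤ N * ∫ z, (∑ i, ‖F i z‖ ^ 2) ∂(muCyl m α T)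
                + N * ∫ z, ‖f z‖ ^ 2 ∂(muCyl m α T)) ∧
        (0 < lam →
          ∃ (u : ℝ × Sp m → Val n) (Du : Fin (m + 1) → ℝ × Sp m → Val n),
            MemH1 α T a₀ u Du ∧ IsWeakSol α T lam a₀ A C₀ F f u Du ∧
            ∀ (v : ℝ × Sp m → Val n) (Dv : Fin (m + 1) → ℝ × Sp m → Val n),
              MemH1 α T a₀ v Dv → IsWeakSol α T lam a₀ A C₀ F f v Dv →
              v =ᵐ[muCyl m α T] u) := by
  have := isLocallyFiniteMeasure_muCyl (m := m) hα ⊤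
  refine ⟨2 / κ ^ 2, by positivity, ?_⟩
  intro T hT lam hlam a₀ A C₀ hA ha hsymm hC F f hF hf
  have ha' : SymCoeff α κ a₀ := ha.symCoeff hsymm
  refine ⟨fun u Du hu hsol => hsol.exists_isVersion_energy_le ha' hA hC hκ hT hlam hF hf hu,
    fun hlam' => ?_⟩
  obtain ⟨u, Du, hu, hsol⟩ := exists_isWeakSol ha' hA hC hκ hlam' hF hf
  exact ⟨u, Du, hu, hsol, fun v Dv hv hsol' =>
    hsol'.ae_eq hsol ha' hA hC hκ hT hlam' hF hf hv hu⟩
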